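/- Let $K=SO(3)$ with Haar measure $dk$ of total mass $1$, let $U(\mathbb R)$ be the group of matrices $x=\begin{pmatrix}1&x_2&x_3\\&1&x_1\\&&1\end{pmatrix}$ with $x_1,x_2,x_3\in\mathbb R$ and $dx=dx_1\,dx_2\,dx_3$, and identify a pair $y=(y_1,y_2)$ of positive reals with the matrix $\mathrm{diag}(y_1y_2,\,y_1,\,1)$. For $\mu=(\mu_1,\mu_2,\mu_3)\in\mathbb C^3$ with $\mu_1+\mu_2+\mu_3=0$ define the power function on $GL(3,\mathbb R)$ through the Iwasawa decomposition by $$p_{\rho+\mu}(c\,xyk)=y_1^{1+\mu_1+\mu_2}\,y_2^{1+\mu_1}\qquad(c\in\mathbb R^\times,\ x\in U(\mathbb R),\ y_1,y_2>0,\ k\in K),$$ and define the spherical function $h_\mu(z)=\int_K p_{\rho+\mu}(kz)\,dk$. For nonzero reals $m_1,m_2$ let $\psi(x)=e^{2\pi i(m_1x_1+m_2x_2)}$. With $w_l=\begin{pmatrix}&&1\\&-1&\\1&&\end{pmatrix}$, let $W(z,\mu,\psi)$ be the Jacquet–Whittaker function, i.e. the continuation to an entire function of $(\mu_1,\mu_2)\in\mathbb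 C^2$ of $$\int_{U(\mathbb R)}p_{\rho+\mu}(w_l\,u\,z)\,\psi(u)\,du,\qquad \mathrm{Re}\,\mu_1>\mathrm{Re}\,\mu_2>\mathrm{Re}\,\mu_3 .$$ **Fourier transform of the spherical function.** Let $\kappa$ be the constant given by $$\frac1\kappa=\prod_{1\le i<j\le3}B\Bigl(\tfrac12,\tfrac{j-i}2\Bigr);\qquad\text{then}\qquad \frac1\kappa=2\pi^2 .$$ Let $0<\epsilon<\tfrac15$ and let $\mu$ satisfy $\mathrm{Re}(\mu_1,\mu_2)=\left(-\tfrac13+\epsilon,\,-\tfrac13+2\epsilon\right)$. Then for all $y_1,y_2>0$ and all $\psi$ as above the continuations $W(y^{-1},\cdot,\psi)$ and $W(I,\cdot,\psi)$ exist, the function $x\mapsto h_\mu({}^t x\,y)\,\psi(x)$ is absolutely integrable on $[-R_1,R_1]\times[-R_2,R_2]\times\mathbb R$ for all $R_1,R_2$, and $$\int_{U(\mathbb R)}h_\mu({}^t x\,y)\,\psi(x)\,dx:=\lim_{R_1,R_2\to\infty}\int_{[-R_1,R_1]\times[-R_2,R_2]\times\mathbb R}h_\mu({}^t x\,y)\,\psi(x)\,dx_1\,dx_2\,dx_3$$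 exists (with $R_1,R_2\to\infty$ independently) and equals $$\kappa\,W(y^{-1},-\mu,\psi)\,W(I,\mu,\psi).$$ -/

import Mathlib

open MeasureTheory Filter Topology Matrix

noncomputable section

namespace SphericalFourier

/-- Real `3 × 3` matrices. -/
abbrev Mat3 : Type := Matrix (Fin 3) (Fin 3) ℝ

/-- The unipotent matrix with coordinates `x = (x₁, x₂, x₃)`; note the ordering of the indices.
The measure on `U(ℝ)` is Lebesgue measure `dx₁ dx₂ dx₃`. -/
def unip (x : ℝ × ℝ × ℝ) : Mat3 :=
  !![1, x.2.1, x.2.2; 0, 1, x.1; 0, 0, 1]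

/-- The diagonal matrix `diag (y₁ y₂, y₁, 1)`. -/
def diagY (y : ℝ × ℝ) : Mat3 :=
  !![y.1 * y.2, 0, 0; 0, y.1, 0; 0, 0, 1]

/-- The long Weyl element. -/
def wLong : Mat3 :=
  !![0, 0, 1; 0, -1, 0; 1, 0, 0]

/-- The Iwasawa coordinate `y₁` of an invertible matrix taken modulo scalars,
written through the entries of `g gᵀ`; see `iwasawaY₁_eq`. -/
def iwasawaY₁ (g : Mat3) : ℝ :=
  √((g * gᵀ) 1 1 * (g * gᵀ) 2 2 - (g * gᵀ) 1 2 ^ 2) / (g * gᵀ) 2 2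

/-- The Iwasawa coordinate `y₂` of an invertible matrix taken modulo scalars,
written through the entries of `g gᵀ`; see `iwasawaY₂_eq`. -/
def iwasawaY₂ (g : Mat3) : ℝ :=
  |g.det| * √((g * gᵀ) 2 2) / ((g * gᵀ) 1 1 * (g * gᵀ) 2 2 - (g * gᵀ) 1 2 ^ 2)

theorem gram_iwasawa (c : ℝ) (x : ℝ × ℝ × ℝ) (y : ℝ × ℝ) (k : Mat3) (hk : k * kᵀ = 1) :
    (c • (unip x * diagY y * k)) * (c • (unip x * diagY y * k))ᵀ
      = c ^ 2 • ((unip x * diagY y) * (unip x * diagY y)ᵀ) := by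
  rw [Matrix.transpose_smul, Matrix.smul_mul, Matrix.mul_smul, smul_smul,
    Matrix.transpose_mul (unip x * diagY y) k, Matrix.mul_assoc (unip x * diagY y) k,
    ← Matrix.mul_assoc k, hk, Matrix.one_mul, sq]

theorem gram_entries (x : ℝ × ℝ × ℝ) (y : ℝ × ℝ) :
    ((unip x * diagY y) * (unip x * diagY y)ᵀ) 1 1 = y.1 ^ 2 + x.1 ^ 2 ∧
    ((unip x * diagY y) * (unip x * diagY y)ᵀ) 1 2 = x.1 ∧
    ((unip x * diagY y) * (unip x * diagY y)ᵀ) 2 2 = 1 := by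
  refine ⟨?_, ?_, ?_⟩ <;>
    simp [unip, diagY, Matrix.mul_apply, Fin.sum_univ_three, sq]

/-- If `g = c · x y k` with `c ≠ 0`, `x ∈ U(ℝ)`, `y ∈ Y(ℝ)` and `k` orthogonal,
then `iwasawaY₁ g = y₁`. -/
theorem iwasawaY₁_eq {c : ℝ} (hc : c ≠ 0) (x : ℝ × ℝ × ℝ) {y : ℝ × ℝ} (hy₁ : 0 < y.1)
    {k : Mat3} (hk : k * kᵀ = 1) :
    iwasawaY₁ (c • (unip x * diagY y * k)) = y.1 := by
  obtain ⟨h1, h2, h3⟩ := gram_entries x y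
  unfold iwasawaY₁
  rw [gram_iwasawa c x y k hk]
  simp only [Matrix.smul_apply, smul_eq_mul, h1, h2, h3]
  have : c ^ 2 * (y.1 ^ 2 + x.1 ^ 2) * (c ^ 2 * 1) - (c ^ 2 * x.1) ^ 2 = (c ^ 2 * y.1) ^ 2 := by
    ring
  rw [this, Real.sqrt_sq (by positivity)]
  field_simp

/-- If `g = c · x y k` with `c ≠ 0`, `x ∈ U(ℝ)`, `y ∈ Y(ℝ)` and `k` orthogonal,
then `iwasawaY₂ g = y₂`. -/
theorem iwasawaY₂_eq {c : ℝ} (hc : c ≠ 0) (x : ℝ × ℝ × ℝ) {y : ℝ × ℝ} (hy₁ : 0 < y.1)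
    (hy₂ : 0 < y.2) {k : Mat3} (hk : k * kᵀ = 1) :
    iwasawaY₂ (c • (unip x * diagY y * k)) = y.2 := by
  obtain ⟨h1, h2, h3⟩ := gram_entries x y
  have hdk : |k.det| = 1 := by
    have h := congrArg Matrix.det hk
    rw [Matrix.det_mul, Matrix.det_transpose, Matrix.det_one] at h
    rw [← sq_eq_sq₀ (abs_nonneg _) zero_le_one, sq_abs, sq, h, one_pow]
  have hdet : |(c • (unip x * diagY y * k)).det| = |c| ^ 3 * (y.1 ^ 2 * y.2) := by
    have hx : (unip x).det = 1 := by simp [unip, Matrix.det_fin_three]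
    have hy : (diagY y).det = y.1 ^ 2 * y.2 := by
      simp [diagY, Matrix.det_fin_three]; ring
    rw [Matrix.det_smul, Matrix.det_mul, Matrix.det_mul, hx, hy, abs_mul, abs_mul, hdk,
      Fintype.card_fin, abs_pow, one_mul, mul_one, abs_of_pos (by positivity : 0 < y.1 ^ 2 * y.2)]
  unfold iwasawaY₂
  rw [hdet, gram_iwasawa c x y k hk]
  simp only [Matrix.smul_apply, smul_eq_mul, h1, h2, h3]
  have : c ^ 2 * (y.1 ^ 2 + x.1 ^ 2) * (c ^ 2 * 1) - (c ^ 2 * x.1) ^ 2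
      = |c| ^ 4 * y.1 ^ 2 := by
    rw [show |c| ^ 4 = (|c| ^ 2) ^ 2 by ring, sq_abs]; ring
  rw [this, mul_one, Real.sqrt_sq_eq_abs]
  have : |c| ≠ 0 := abs_ne_zero.mpr hc
  field_simp

/-- The power function `p_{ρ+μ}`, `ρ = (1, 0, -1)`, with Langlands parameters
`(μ₁, μ₂, -μ₁-μ₂)` recorded by the pair `μ = (μ₁, μ₂)`:
`p_{ρ+μ}(x y k) = y₁ ^ (1+μ₁+μ₂) y₂ ^ (1+μ₁)`. -/
def powerFn (μ : ℂ × ℂ) (g : Mat3) : ℂ :=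
  (iwasawaY₁ g : ℂ) ^ (1 + μ.1 + μ.2) * (iwasawaY₂ g : ℂ) ^ (1 + μ.1)

/-- The character `ψ_m (x) = e (m₁ x₁ + m₂ x₂)`, `e (t) = exp (2 π i t)`. -/
def psi (m : ℝ × ℝ) (x : ℝ × ℝ × ℝ) : ℂ :=
  Complex.exp (2 * Real.pi * Complex.I * ((m.1 * x.1 + m.2 * x.2.1 : ℝ) : ℂ))

/-- The compact group `K = SO(3)`. -/
abbrev SO3 : Type := Matrix.specialOrthogonalGroup (Fin 3) ℝ

theorem SO3.mul_transpose (k : SO3) : (k : Mat3) * (k : Mat3)ᵀ = 1 :=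
  (Matrix.mem_orthogonalGroup_iff (Fin 3) ℝ).mp
    ((Matrix.mem_specialOrthogonalGroup_iff).mp k.2).1

theorem SO3.coe_inv (k : SO3) : ((k⁻¹ : SO3) : Mat3) = (k : Mat3)ᵀ := rfl

instance : IsTopologicalGroup SO3 where
  continuous_inv := by
    refine Continuous.subtype_mk ?_ _
    exact (continuous_subtype_val : Continuous fun k : SO3 => (k : Mat3)).matrix_transpose

theorem isCompact_SO3 : IsCompact ((Matrix.specialOrthogonalGroup (Fin 3) ℝ : Set Mat3)) := by
  have hset : (Matrix.specialOrthogonalGroup (Fin 3) ℝ : Set Mat3)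
      = {A : Mat3 | A * Aᵀ = 1 ∧ A.det = 1} := by
    ext A
    exact Matrix.mem_specialOrthogonalGroup_iff.trans
      (and_congr_left' (Matrix.mem_orthogonalGroup_iff (Fin 3) ℝ))
  have hbox : IsCompact (Set.univ.pi fun _ : Fin 3 => Set.univ.pi fun _ : Fin 3 =>
      Set.Icc (-1 : ℝ) 1) :=
    isCompact_univ_pi fun _ => isCompact_univ_pi fun _ => isCompact_Icc
  have hentry : ∀ A : Mat3, A * Aᵀ = 1 → ∀ i j, A i j ∈ Set.Icc (-1 : ℝ) 1 := by
    intro A hA i j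
    have h := congrFun (congrFun hA i) i
    rw [Matrix.mul_apply, Matrix.one_apply_eq] at h
    have h2 : A i j * A i j ≤ 1 := by
      rw [← h]
      exact Finset.single_le_sum (f := fun j => A i j * Aᵀ j i)
        (fun j _ => mul_self_nonneg (A i j)) (Finset.mem_univ j)
    exact abs_le.mp (abs_le_one_iff_mul_self_le_one.mpr h2)
  rw [hset]
  refine IsCompact.of_isClosed_subset (s := (Set.univ.pi fun _ : Fin 3 => Set.univ.pi
    fun _ : Fin 3 => Set.Icc (-1 : ℝ) 1 : Set (Fin 3 → Fin 3 → ℝ))) hbox ?_ ?_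
  · refine IsClosed.inter (s₁ := {A : Mat3 | A * Aᵀ = 1}) (s₂ := {A : Mat3 | A.det = 1}) ?_ ?_
    · exact isClosed_eq (continuous_id.matrix_mul continuous_id.matrix_transpose)
        continuous_const
    · exact isClosed_eq continuous_id.matrix_det continuous_const
  · exact fun A hA i _ j _ => hentry A hA.1 i j

instance : CompactSpace SO3 := isCompact_iff_compactSpace.mp isCompact_SO3

instance : MeasurableSpace SO3 := borel SO3

instance : BorelSpace SO3 := ⟨rfl⟩

/-- Haar measure on `K`, of total mass one. -/
def haarK : Measure SO3 := Measure.haarMeasure ⊤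

instance : IsProbabilityMeasure haarK :=
  ⟨by simpa [haarK] using Measure.haarMeasure_self (K₀ := (⊤ : TopologicalSpace.PositiveCompacts SO3))⟩

/-- The spherical function `h_μ (z) = ∫_K p_{ρ+μ}(k z) dk`. -/
def spherical (μ : ℂ × ℂ) (z : Mat3) : ℂ :=
  ∫ k : SO3, powerFn μ ((k : Mat3) * z) ∂haarK

/-- Jacquet's integral `∫_{U(ℝ)} p_{ρ+μ}(w_l u z) ψ_m (u) du`. -/
def jacquetIntegral (z : Mat3) (μ : ℂ × ℂ) (m : ℝ × ℝ) : ℂ :=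
  ∫ u : ℝ × ℝ × ℝ, powerFn μ (wLong * unip u * z) * psi m u

/-- The cone `Re μ₁ > Re μ₂ > Re μ₃`, `μ₃ = -μ₁-μ₂`, of absolute convergence of Jacquet's
integral. -/
def dominant : Set (ℂ × ℂ) :=
  {μ | μ.2.re < μ.1.re ∧ (-μ.1 - μ.2).re < μ.2.re}

/-- `F` is an entire function of `μ = (μ₁, μ₂) ∈ ℂ²` which is given by Jacquet's integral in its
cone of absolute convergence. -/
def IsWhittakerContinuation (z : Mat3) (m : ℝ × ℝ) (F : ℂ × ℂ → ℂ) : Prop :=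
  Differentiable ℂ F ∧ ∀ μ ∈ dominant, F μ = jacquetIntegral z μ m

open scoped Classical in
/-- The Jacquet–Whittaker function `W(z, μ, ψ_m)`: the analytic continuation in `μ` of Jacquet's
integral. It does not depend on the choice, see `jacquetWhittaker_eq`. -/
def jacquetWhittaker (z : Mat3) (μ : ℂ × ℂ) (m : ℝ × ℝ) : ℂ :=
  if h : ∃ F, IsWhittakerContinuation z m F then h.choose μ else 0

theorem IsWhittakerContinuation.unique {z : Mat3} {m : ℝ × ℝ} {F G : ℂ × ℂ → ℂ}
    (hF : IsWhittakerContinuation z m F) (hG : IsWhittakerContinuation z m G) : F = G := by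
  funext μ
  let ν : ℂ × ℂ := (1, 0)
  let l : ℂ → ℂ × ℂ := fun t => ν + t • (μ - ν)
  have hl : Differentiable ℂ l := by fun_prop
  have hopen : IsOpen dominant := by
    apply IsOpen.and <;> exact isOpen_lt (by fun_prop) (by fun_prop)
  have hev : (F ∘ l) =ᶠ[𝓝 0] (G ∘ l) := by
    have h0 : l 0 ∈ dominant := by simp [l, ν, dominant]
    filter_upwards [hl.continuous.continuousAt.preimage_mem_nhds (hopen.mem_nhds h0)] with t ht
    exact (hF.2 _ ht).trans (hG.2 _ ht).symm
  have hFa : AnalyticOnNhd ℂ (F ∘ l) Set.univ := (hF.1.comp hl).differentiableOn.analyticOnNhd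
    isOpen_univ
  have hGa : AnalyticOnNhd ℂ (G ∘ l) Set.univ := (hG.1.comp hl).differentiableOn.analyticOnNhd
    isOpen_univ
  have h1 := congrFun (hFa.eq_of_eventuallyEq hGa hev) 1
  simpa [l] using h1

theorem jacquetWhittaker_eq {z : Mat3} {m : ℝ × ℝ} {F : ℂ × ℂ → ℂ}
    (hF : IsWhittakerContinuation z m F) (μ : ℂ × ℂ) : jacquetWhittaker z μ m = F μ := by
  have h : ∃ F, IsWhittakerContinuation z m F := ⟨F, hF⟩
  rw [jacquetWhittaker, dif_pos h, h.choose_spec.unique hF]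

/-- The slab `[-R₁, R₁] × [-R₂, R₂] × ℝ` in `U(ℝ)`. -/
def slab (R : ℝ × ℝ) : Set (ℝ × ℝ × ℝ) :=
  Set.Icc (-R.1) R.1 ×ˢ Set.Icc (-R.2) R.2 ×ˢ Set.univ

/-- The integrand `h_μ (ᵗx y) ψ_m (x)`. -/
def sphericalIntegrand (y : ℝ × ℝ) (μ : ℂ × ℂ) (m : ℝ × ℝ) (x : ℝ × ℝ × ℝ) : ℂ :=
  spherical μ ((unip x)ᵀ * diagY y) * psi m x

/-- The constant `κ = (∏_{i<j} B(1/2, (j-i)/2))⁻¹`. -/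
def kappa : ℂ :=
  (∏ i : Fin 3, ∏ j ∈ Finset.Ioi i,
    Complex.betaIntegral (1 / 2) (((j : ℕ) - (i : ℕ) : ℂ) / 2))⁻¹

end SphericalFourier

end

noncomputable section

namespace SphericalFourier

/-! Put a = (1 + μ₁ + 2μ₂)/2 and b = (1 + μ₁ - μ₂)/2. At `w_l u` the power function is q₁^(-a)
q₂^(-b) (`cellFn a b`), where q₁ is the squared length of the last row and q₂ the Gram determinant
of the last two rows.

The formula is an unfolding. A function on K that depends only on the flag of the last two rows has
integral over K equal to its integral over the big cell U(ℝ) with density 1/(2π² q₁ q₂)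
(`integral_haarK_eq`). Since (q₁ q₂)⁻¹ / `cellFn a b` = `cellFn (1 - a) (1 - b)` and (a, b) ↦ (1 -
a, 1 - b) is μ ↦ -μ, both parameters μ and -μ appear. The polar decomposition gives h_μ(ᵗz) = h_μ(z)
for det z > 0, so h_μ(ᵗx y) = h_μ(y x), and `spherical_eq_convolution` writes this as a constant
times ∫ `cellFn a b` (ux) `cellFn (1 - a) (1 - b)` (y u y⁻¹) du. Replacing x by u⁻¹x separates the
Fourier transform into two Jacquet integrals, and 1/(2π²) is κ.

The difficulty is convergence. Here Re a and Re b lie in (0, 1/2) and Re (a + b) > 1/2. Thus -μ is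
dominant and the u-integral converges absolutely, but the x-integral is a limit over slabs, and the
substitution translates the slab by u. A bound uniform over all translated slabs is therefore
needed, together with the identification of the limit with the continued Whittaker function.

For the bound, q₁^(-a) q₂^(-b) is a Mellin integral over (t, s) of exp (-π(t q₁ + s q₂)). The
x₃-integral of this Gaussian is elementary and leaves a multiple of exp (-π(s x₁² + t x₂² + q x₁²
x₂²)) with q = ts/(t + s). That function is a signed superposition of indicators of rectangles
centred at the origin (`integral_mixDensity`), so its Fourier integral over any rectangle is at most
the mass of the density times 1/(π² |m₁ m₂|) (`norm_planeFourier_le`). The mass is at most 1 + C (t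
+ s)^(-δ) (`integral_abs_mixDensity_le`), which is integrable in the Mellin variables as soon as Re
(a + b) > 1/2 + δ. Dominated convergence then applies twice (`tendsto_mellinFourier`,
`tendsto_integral_convolutionKernel`).

For the identification, the quartic term is linearised by an auxiliary Gaussian variable v. For Re
(a + b) > 1 this leads to Gamma factors times a triple integral of Bessel type
(`Gamma_mul_mellinFourier_univ`), which is entire in (a, b). The identity theorem extends the
evaluation to Re (a + b) > 1/2 (`mellinFourier_univ_eq_besselIntegral`), and the same entire
function is Jacquet's integral for dominant parameters. -/

theorem ofReal_cpow_eq_exp {x : ℝ} (hx : 0 < x) (w : ℂ) :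
    (x : ℂ) ^ w = Complex.exp ((Real.log x : ℂ) * w) := by
  rw [Complex.cpow_def_of_ne_zero (by exact_mod_cast hx.ne'), Complex.ofReal_log hx.le]

theorem norm_ofReal_cpow {x : ℝ} (hx : 0 < x) (w : ℂ) : ‖(x : ℂ) ^ w‖ = x ^ w.re :=
  Complex.norm_cpow_eq_rpow_re_of_pos hx w

/-! ### The power function through the last two rows of a matrix -/

/-- The Gram determinant of two vectors of `ℝ³`. -/
def gram2 (r v : Fin 3 → ℝ) : ℝ := (r ⬝ᵥ r) * (v ⬝ᵥ v) - (r ⬝ᵥ v) ^ 2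

theorem gram2_eq (r v : Fin 3 → ℝ) :
    gram2 r v = (r 0 * v 1 - r 1 * v 0) ^ 2 + (r 0 * v 2 - r 2 * v 0) ^ 2
      + (r 1 * v 2 - r 2 * v 1) ^ 2 := by
  simp only [gram2, dotProduct, Fin.sum_univ_three]
  ring

/-- The power function in terms of the last two rows of a matrix, up to a power of the
determinant. -/
def flagFn (a b : ℂ) (r v : Fin 3 → ℝ) : ℂ :=
  ((v ⬝ᵥ v : ℝ) : ℂ) ^ (-a) * (gram2 r v : ℂ) ^ (-b)

theorem dotProduct_self_pos_of_gram2_pos {r v : Fin 3 → ℝ} (h : 0 < gram2 r v) : 0 < v ⬝ᵥ v := by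
  rw [gram2_eq] at h
  by_contra hv
  simp only [dotProduct, Fin.sum_univ_three] at hv
  have h0 : v 0 = 0 := by nlinarith [sq_nonneg (v 0), sq_nonneg (v 1), sq_nonneg (v 2)]
  have h1 : v 1 = 0 := by nlinarith [sq_nonneg (v 0), sq_nonneg (v 1), sq_nonneg (v 2)]
  have h2 : v 2 = 0 := by nlinarith [sq_nonneg (v 0), sq_nonneg (v 1), sq_nonneg (v 2)]
  simp [h0, h1, h2] at h

theorem gram2_rows_pos {g : Mat3} (hg : g.det ≠ 0) : 0 < gram2 (g 1) (g 2) := by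
  rw [gram2_eq]
  by_contra h
  have h0 : g 1 0 * g 2 1 - g 1 1 * g 2 0 = 0 := by
    nlinarith [sq_nonneg (g 1 0 * g 2 1 - g 1 1 * g 2 0),
      sq_nonneg (g 1 0 * g 2 2 - g 1 2 * g 2 0), sq_nonneg (g 1 1 * g 2 2 - g 1 2 * g 2 1)]
  have h1 : g 1 0 * g 2 2 - g 1 2 * g 2 0 = 0 := by
    nlinarith [sq_nonneg (g 1 0 * g 2 1 - g 1 1 * g 2 0),
      sq_nonneg (g 1 0 * g 2 2 - g 1 2 * g 2 0), sq_nonneg (g 1 1 * g 2 2 - g 1 2 * g 2 1)]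
  have h2 : g 1 1 * g 2 2 - g 1 2 * g 2 1 = 0 := by
    nlinarith [sq_nonneg (g 1 0 * g 2 1 - g 1 1 * g 2 0),
      sq_nonneg (g 1 0 * g 2 2 - g 1 2 * g 2 0), sq_nonneg (g 1 1 * g 2 2 - g 1 2 * g 2 1)]
  apply hg
  rw [Matrix.det_fin_three]
  linear_combination g 0 0 * h2 - g 0 1 * h1 + g 0 2 * h0

theorem gram_apply (g : Mat3) (i j : Fin 3) : (g * gᵀ) i j = g i ⬝ᵥ g j := rfl

/-- Here y₁ = √G / N and y₂ = |det g| √N / G, with N the squared length of the last row and G the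
Gram determinant. Collecting the powers of N and G gives the two exponents. -/
theorem powerFn_eq (μ : ℂ × ℂ) {g : Mat3} (hg : g.det ≠ 0) :
    powerFn μ g = ((|g.det| : ℝ) : ℂ) ^ (1 + μ.1)
      * flagFn ((1 + μ.1 + 2 * μ.2) / 2) ((1 + μ.1 - μ.2) / 2) (g 1) (g 2) := by
  have hD : 0 < |g.det| := abs_pos.mpr hg
  have hG := gram2_rows_pos hg
  have hN := dotProduct_self_pos_of_gram2_pos hG
  have e1 : iwasawaY₁ g = √(gram2 (g 1) (g 2)) / (g 2 ⬝ᵥ g 2) := rfl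
  have e2 : iwasawaY₂ g = |g.det| * √(g 2 ⬝ᵥ g 2) / gram2 (g 1) (g 2) := rfl
  rw [powerFn, flagFn, e1, e2, ofReal_cpow_eq_exp (by positivity), ofReal_cpow_eq_exp (by positivity),
    ofReal_cpow_eq_exp hD, ofReal_cpow_eq_exp hN, ofReal_cpow_eq_exp hG, ← Complex.exp_add,
    ← Complex.exp_add, ← Complex.exp_add, Real.log_div (by positivity) hN.ne',
    Real.log_div (by positivity) hG.ne', Real.log_mul hD.ne' (by positivity), Real.log_sqrt hG.le,
    Real.log_sqrt hN.le]
  push_cast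
  congr 1
  ring

/-! ### Invariance of the spherical function under SO(3) and transposition -/

theorem SO3.det_eq_one (k : SO3) : (k : Mat3).det = 1 :=
  (Matrix.mem_specialOrthogonalGroup_iff.mp k.2).2

theorem SO3.coe_mul (k l : SO3) : ((k * l : SO3) : Mat3) = (k : Mat3) * (l : Mat3) := rfl

theorem mem_SO3 {A : Mat3} (h : A * Aᵀ = 1) (hd : A.det = 1) :
    A ∈ Matrix.specialOrthogonalGroup (Fin 3) ℝ :=
  Matrix.mem_specialOrthogonalGroup_iff.mpr
    ⟨(Matrix.mem_orthogonalGroup_iff (Fin 3) ℝ).mpr h, hd⟩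

instance : SecondCountableTopology SO3 :=
  inferInstanceAs (SecondCountableTopology
    {A : Fin 3 → Fin 3 → ℝ // A ∈ (Matrix.specialOrthogonalGroup (Fin 3) ℝ : Set Mat3)})

instance : haarK.IsMulLeftInvariant := by unfold haarK; infer_instance

/-- A right translate of Haar measure is still left invariant and of mass one, so uniqueness
identifies it with the original measure. -/
instance : haarK.IsMulRightInvariant where
  map_mul_right_eq_self k := by
    have h : IsProbabilityMeasure (haarK.map (· * k)) :=
      Measure.isProbabilityMeasure_map (by fun_prop)
    have h1 := Measure.haarMeasure_unique (haarK.map (· * k)) ⊤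
    rw [h1, show ((⊤ : TopologicalSpace.PositiveCompacts SO3) : Set SO3) = Set.univ from rfl,
      measure_univ, one_smul, haarK]

theorem powerFn_mul_orthogonal (μ : ℂ × ℂ) (g : Mat3) {k : Mat3} (hk : k * kᵀ = 1) :
    powerFn μ (g * k) = powerFn μ g := by
  have h1 : (g * k) * (g * k)ᵀ = g * gᵀ := by
    rw [Matrix.transpose_mul, Matrix.mul_assoc, ← Matrix.mul_assoc k, hk, Matrix.one_mul]
  have h2 : |(g * k).det| = |g.det| := by
    have h := congrArg Matrix.det hk
    rw [Matrix.det_mul, Matrix.det_transpose, Matrix.det_one] at h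
    have : |k.det| = 1 := by
      rw [← sq_eq_sq₀ (abs_nonneg _) zero_le_one, sq_abs, sq, h, one_pow]
    rw [Matrix.det_mul, abs_mul, this, mul_one]
  unfold powerFn iwasawaY₁ iwasawaY₂
  rw [h1, h2]

theorem spherical_mul_SO3 (μ : ℂ × ℂ) (z : Mat3) (k : SO3) :
    spherical μ (z * (k : Mat3)) = spherical μ z := by
  unfold spherical
  simp_rw [← Matrix.mul_assoc, powerFn_mul_orthogonal μ _ (SO3.mul_transpose k)]

theorem spherical_SO3_mul (μ : ℂ × ℂ) (z : Mat3) (k : SO3) :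
    spherical μ ((k : Mat3) * z) = spherical μ z := by
  unfold spherical
  simp_rw [← Matrix.mul_assoc, ← SO3.coe_mul]
  exact integral_mul_right_eq_self (fun l : SO3 => powerFn μ ((l : Mat3) * z)) k

/-- Polar decomposition: an invertible matrix is conjugated to its transpose by a rotation. -/
theorem exists_SO3_transpose_eq {z : Mat3} (hz : 0 < z.det) :
    ∃ k : SO3, zᵀ = (k : Mat3) * z * (k : Mat3) := by
  open scoped MatrixOrder ComplexOrder in
  have hS : (zᵀ * z).PosSemidef := by
    simpa using Matrix.posSemidef_conjTranspose_mul_self z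
  open scoped MatrixOrder ComplexOrder in
  obtain ⟨P, hPs, hPP, hPd⟩ : ∃ P : Mat3, Pᵀ = P ∧ P * P = zᵀ * z ∧ 0 ≤ P.det := by
    have h0 : 0 ≤ zᵀ * z := hS.nonneg
    have h1 : (CFC.sqrt (zᵀ * z)).PosSemidef := (CFC.sqrt_nonneg (zᵀ * z)).posSemidef
    refine ⟨CFC.sqrt (zᵀ * z), ?_, CFC.sqrt_mul_sqrt_self _ h0, h1.det_nonneg⟩
    have h2 := h1.isHermitian.eq
    rwa [Matrix.conjTranspose_eq_transpose_of_trivial] at h2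
  have hzu : IsUnit z.det := isUnit_iff_ne_zero.mpr hz.ne'
  have hzz : z * z⁻¹ = 1 := Matrix.mul_nonsing_inv z hzu
  have hzz' : z⁻¹ * z = 1 := Matrix.nonsing_inv_mul z hzu
  have hdP : P.det = z.det := by
    have h := congrArg Matrix.det hPP
    rw [Matrix.det_mul, Matrix.det_mul, Matrix.det_transpose] at h
    exact (mul_self_inj_of_nonneg hPd hz.le).mp h
  have hPu : IsUnit P.det := by rw [hdP]; exact hzu
  have hk : (P * z⁻¹)ᵀ * (P * z⁻¹) = 1 := by
    rw [Matrix.transpose_mul, hPs, Matrix.mul_assoc, ← Matrix.mul_assoc P, hPP, Matrix.mul_assoc zᵀ,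
      hzz, Matrix.mul_one, ← Matrix.transpose_mul, hzz, Matrix.transpose_one]
  have hkd : (P * z⁻¹).det = 1 := by
    rw [Matrix.det_mul, hdP, ← Matrix.det_mul, hzz, Matrix.det_one]
  -- With P = √(zᵀz), the matrix k = P z⁻¹ is orthogonal and kz = P, so zᵀ = P² z⁻¹ = (kz)k.
  -- Positivity of det z makes det k = 1.
  refine ⟨⟨P * z⁻¹, mem_SO3 (mul_eq_one_comm.mp hk) hkd⟩, ?_⟩
  have hkz : P * z⁻¹ * z = P := by rw [Matrix.mul_assoc, hzz', Matrix.mul_one]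
  change zᵀ = P * z⁻¹ * z * (P * z⁻¹)
  rw [hkz, ← Matrix.mul_assoc, hPP, Matrix.mul_assoc, hzz, Matrix.mul_one]

theorem spherical_transpose (μ : ℂ × ℂ) {z : Mat3} (hz : 0 < z.det) :
    spherical μ zᵀ = spherical μ z := by
  obtain ⟨k, hk⟩ := exists_SO3_transpose_eq hz
  rw [hk, spherical_mul_SO3, spherical_SO3_mul]

/-! ### Lebesgue measure on pairs of vectors in flag coordinates -/

theorem lintegral_affine (f : ℝ → ENNReal) {t : ℝ} (ht : t ≠ 0) (b : ℝ) (hf : Measurable f) :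
    ∫⁻ x, f x = ENNReal.ofReal |t| * ∫⁻ x, f (t * x + b) := by
  have h1 : ∫⁻ x, f (x + b) = ∫⁻ x, f x := lintegral_add_right_eq_self f b
  have h2 := Real.smul_map_volume_mul_left ht
  rw [← h1]
  conv_lhs => rw [← h2]
  rw [lintegral_smul_measure, lintegral_map (by fun_prop) (by fun_prop), smul_eq_mul]

theorem measurePreserving_vecCons :
    MeasurePreserving (fun p : ℝ × ℝ × ℝ => (![p.1, p.2.1, p.2.2] : Fin 3 → ℝ)) := by
  have h1 := (volume_preserving_piFinSuccAbove (fun _ : Fin 3 => ℝ) 0).symm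
  have h2 := (volume_preserving_finTwoArrow ℝ).symm
  have h3 : MeasurePreserving (Prod.map (id : ℝ → ℝ) (MeasurableEquiv.finTwoArrow (α := ℝ)).symm) :=
    (MeasurePreserving.id volume).prod h2
  have h4 := h1.comp h3
  convert h4 using 1
  ext p i
  fin_cases i <;> rfl

theorem measurable_vecCons {α : Type*} [MeasurableSpace α] {f g h : α → ℝ} (hf : Measurable f)
    (hg : Measurable g) (hh : Measurable h) : Measurable fun x => (![f x, g x, h x] : Fin 3 → ℝ) :=
  measurePreserving_vecCons.measurable.comp (hf.prodMk (hg.prodMk hh))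

theorem lintegral_fin_three (g : (Fin 3 → ℝ) → ENNReal) (hg : Measurable g) :
    ∫⁻ v, g v = ∫⁻ a, ∫⁻ b, ∫⁻ c, g ![a, b, c] := by
  have hm : Measurable fun p : ℝ × ℝ × ℝ => g ![p.1, p.2.1, p.2.2] :=
    hg.comp measurePreserving_vecCons.measurable
  rw [← measurePreserving_vecCons.lintegral_comp hg, Measure.volume_eq_prod, lintegral_prod _ hm.aemeasurable]
  refine lintegral_congr fun a => ?_
  rw [Measure.volume_eq_prod, lintegral_prod]
  exact (hm.comp measurable_prodMk_left).aemeasurable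

/-- Substitution v = t (1, x₂, x₃): for fixed t ≠ 0 the last two coordinates scale by t each, whence
the Jacobian t². -/
theorem lintegral_projective (g : (Fin 3 → ℝ) → ENNReal) (hg : Measurable g) :
    ∫⁻ v, g v = ∫⁻ x₂, ∫⁻ x₃, ∫⁻ t, ENNReal.ofReal (t ^ 2) * g ![t, t * x₂, t * x₃] := by
  have hm : Measurable fun p : ℝ × ℝ × ℝ =>
      ENNReal.ofReal (p.1 ^ 2) * g ![p.1, p.1 * p.2.1, p.1 * p.2.2] :=
    (by fun_prop : Measurable fun p : ℝ × ℝ × ℝ => ENNReal.ofReal (p.1 ^ 2)).mul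
      (hg.comp (measurable_vecCons (by fun_prop) (by fun_prop) (by fun_prop)))
  calc ∫⁻ v, g v = ∫⁻ t, ∫⁻ x₂, ∫⁻ x₃, ENNReal.ofReal (t ^ 2) * g ![t, t * x₂, t * x₃] := by
        rw [lintegral_fin_three g hg]
        have h0 : ∀ᵐ t : ℝ, t ≠ 0 := by simp [ae_iff]
        refine lintegral_congr_ae ?_
        filter_upwards [h0] with t ht
        have hb : Measurable fun b : ℝ × ℝ => g ![t, b.1, b.2] :=
          hg.comp (measurable_vecCons (by fun_prop) (by fun_prop) (by fun_prop))
        rw [lintegral_affine _ ht 0 hb.lintegral_prod_right']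
        rw [← lintegral_const_mul' _ _ ENNReal.ofReal_ne_top]
        refine lintegral_congr fun x₂ => ?_
        rw [lintegral_affine (fun y => g ![t, t * x₂ + 0, y]) ht 0 (hb.comp measurable_prodMk_left),
          ← mul_assoc,
          ← ENNReal.ofReal_mul (abs_nonneg _), ← lintegral_const_mul' _ _ ENNReal.ofReal_ne_top]
        simp [abs_mul_abs_self, sq]
    _ = ∫⁻ x₂, ∫⁻ t, ∫⁻ x₃, ENNReal.ofReal (t ^ 2) * g ![t, t * x₂, t * x₃] := by
        refine lintegral_lintegral_swap (Measurable.aemeasurable ?_)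
        exact Measurable.lintegral_prod_right'
          (f := fun q : (ℝ × ℝ) × ℝ => ENNReal.ofReal (q.1.1 ^ 2) * g ![q.1.1, q.1.1 * q.1.2, q.1.1 * q.2])
          (hm.comp (by fun_prop : Measurable fun q : (ℝ × ℝ) × ℝ => (q.1.1, q.1.2, q.2)))
    _ = _ := by
        refine lintegral_congr fun x₂ => ?_
        refine lintegral_lintegral_swap (Measurable.aemeasurable ?_)
        exact hm.comp (by fun_prop : Measurable fun q : ℝ × ℝ => (q.1, x₂, q.2))

/-- Substitution r = s (1, x₂, x₃) + a (0, 1, x₁): a shear in the second coordinate, and a scaling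
by a in the third, which gives the Jacobian |a|. -/
theorem lintegral_affine_flag (g : (Fin 3 → ℝ) → ENNReal) (hg : Measurable g) (x₂ x₃ : ℝ) :
    ∫⁻ r, g r = ∫⁻ x₁, ∫⁻ s, ∫⁻ a,
      ENNReal.ofReal |a| * g ![s, s * x₂ + a, s * x₃ + a * x₁] := by
  have hm : Measurable fun p : ℝ × ℝ × ℝ =>
      ENNReal.ofReal |p.2.2| * g ![p.2.1, p.2.1 * x₂ + p.2.2, p.2.1 * x₃ + p.2.2 * p.1] :=
    (by fun_prop : Measurable fun p : ℝ × ℝ × ℝ => ENNReal.ofReal |p.2.2|).mul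
      (hg.comp (measurable_vecCons (by fun_prop) (by fun_prop) (by fun_prop)))
  calc ∫⁻ r, g r = ∫⁻ s, ∫⁻ a, ∫⁻ x₁, ENNReal.ofReal |a| * g ![s, s * x₂ + a, s * x₃ + a * x₁] := by
        rw [lintegral_fin_three g hg]
        refine lintegral_congr fun s => ?_
        have hb : Measurable fun b : ℝ × ℝ => g ![s, b.1, b.2] :=
          hg.comp (measurable_vecCons (by fun_prop) (by fun_prop) (by fun_prop))
        rw [lintegral_affine _ one_ne_zero (s * x₂) hb.lintegral_prod_right']
        rw [abs_one, ENNReal.ofReal_one, one_mul]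
        have h0 : ∀ᵐ t : ℝ, t ≠ 0 := by simp [ae_iff]
        refine lintegral_congr_ae ?_
        filter_upwards [h0] with a ha
        rw [lintegral_affine (fun y => g ![s, 1 * a + s * x₂, y]) ha (s * x₃)
            (hb.comp measurable_prodMk_left),
          ← lintegral_const_mul' _ _ ENNReal.ofReal_ne_top]
        refine lintegral_congr fun x₁ => ?_
        simp only [one_mul, add_comm]
    _ = ∫⁻ s, ∫⁻ x₁, ∫⁻ a, ENNReal.ofReal |a| * g ![s, s * x₂ + a, s * x₃ + a * x₁] := by
        refine lintegral_congr fun s => ?_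
        refine lintegral_lintegral_swap (Measurable.aemeasurable ?_)
        exact hm.comp (by fun_prop : Measurable fun q : ℝ × ℝ => (q.2, s, q.1))
    _ = _ := by
        refine lintegral_lintegral_swap (Measurable.aemeasurable ?_)
        exact Measurable.lintegral_prod_right'
          (f := fun q : (ℝ × ℝ) × ℝ => ENNReal.ofReal |q.2|
            * g ![q.1.1, q.1.1 * x₂ + q.2, q.1.1 * x₃ + q.2 * q.1.2])
          (hm.comp (by fun_prop : Measurable fun q : (ℝ × ℝ) × ℝ => (q.1.2, q.1.1, q.2)))

/-! ### Gaussian measure on pairs of vectors and its image on the big cell -/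

theorem lintegral_gaussian {c : ℝ} (hc : 0 < c) :
    ∫⁻ s : ℝ, ENNReal.ofReal (Real.exp (-(Real.pi * c) * s ^ 2)) = ENNReal.ofReal (1 / √c) := by
  rw [← ofReal_integral_eq_lintegral_ofReal (integrable_exp_neg_mul_sq (by positivity))
    (Eventually.of_forall fun s => (Real.exp_pos _).le), integral_gaussian]
  rw [div_mul_cancel_left₀ Real.pi_pos.ne', Real.sqrt_inv, one_div]

theorem lintegral_abs_mul_gaussian {c : ℝ} (hc : 0 < c) :
    ∫⁻ s : ℝ, ENNReal.ofReal |s| * ENNReal.ofReal (Real.exp (-(Real.pi * c) * s ^ 2))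
      = ENNReal.ofReal (1 / (Real.pi * c)) := by
  have hb : 0 < Real.pi * c := by positivity
  simp_rw [← ENNReal.ofReal_mul (abs_nonneg _)]
  rw [← ofReal_integral_eq_lintegral_ofReal ?_ (Eventually.of_forall fun s => by positivity)]
  · congr 1
    have h1 := integral_comp_abs (f := fun s => s * Real.exp (-(Real.pi * c) * s ^ 2))
    simp only [sq_abs] at h1
    rw [h1]
    have h2 := integral_rpow_mul_exp_neg_mul_rpow (p := 2) (q := 1) two_pos (by norm_num) hb
    norm_num at h2
    simp only [neg_mul]
    rw [h2, Real.rpow_neg_one]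
    field_simp
  · have := (integrable_mul_exp_neg_mul_sq hb).abs
    simpa [abs_mul] using this

theorem lintegral_sq_mul_gaussian {c : ℝ} (hc : 0 < c) :
    ∫⁻ s : ℝ, ENNReal.ofReal (s ^ 2) * ENNReal.ofReal (Real.exp (-(Real.pi * c) * s ^ 2))
      = ENNReal.ofReal (1 / (2 * Real.pi * (c * √c))) := by
  have hb : 0 < Real.pi * c := by positivity
  simp_rw [← ENNReal.ofReal_mul (sq_nonneg _)]
  rw [← ofReal_integral_eq_lintegral_ofReal ?_ (Eventually.of_forall fun s => by positivity)]
  · congr 1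
    have h1 := integral_comp_abs (f := fun s => s ^ 2 * Real.exp (-(Real.pi * c) * s ^ 2))
    simp only [sq_abs] at h1
    rw [h1]
    have h2 := integral_rpow_mul_exp_neg_mul_rpow (p := 2) (q := 2) two_pos (by norm_num) hb
    have h3 : Real.Gamma (3 / 2) = √Real.pi / 2 := by
      rw [show (3 / 2 : ℝ) = 1 / 2 + 1 by norm_num, Real.Gamma_add_one (by norm_num),
        Real.Gamma_one_half_eq]
      ring
    norm_num at h2
    simp only [neg_mul]
    rw [h2, h3, show (-(3 / 2) : ℝ) = -(1 + 1 / 2) by norm_num, Real.rpow_neg hb.le,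
      Real.rpow_add hb, Real.rpow_one, ← Real.sqrt_eq_rpow, Real.sqrt_mul Real.pi_pos.le]
    field_simp
  · have := integrable_rpow_mul_exp_neg_mul_sq hb (s := 2) (by norm_num)
    simpa using this

/-- The squared length of the last row of `w_l u`. -/
def q₁ (x : ℝ × ℝ × ℝ) : ℝ := 1 + x.2.1 ^ 2 + x.2.2 ^ 2

/-- The Gram determinant of the last two rows of `w_l u`. -/
def q₂ (x : ℝ × ℝ × ℝ) : ℝ := 1 + x.1 ^ 2 + (x.1 * x.2.1 - x.2.2) ^ 2

theorem one_le_q₁ (x : ℝ × ℝ × ℝ) : 1 ≤ q₁ x := by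
  unfold q₁; nlinarith [sq_nonneg x.2.1, sq_nonneg x.2.2]

theorem one_le_q₂ (x : ℝ × ℝ × ℝ) : 1 ≤ q₂ x := by
  unfold q₂; nlinarith [sq_nonneg x.1, sq_nonneg (x.1 * x.2.1 - x.2.2)]

theorem q₁_pos (x : ℝ × ℝ × ℝ) : 0 < q₁ x := one_pos.trans_le (one_le_q₁ x)

theorem q₂_pos (x : ℝ × ℝ × ℝ) : 0 < q₂ x := one_pos.trans_le (one_le_q₂ x)

@[fun_prop]
theorem continuous_q₁ : Continuous q₁ := by unfold q₁; fun_prop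

@[fun_prop]
theorem continuous_q₂ : Continuous q₂ := by unfold q₂; fun_prop

@[fun_prop]
theorem measurable_q₁ : Measurable q₁ := continuous_q₁.measurable

@[fun_prop]
theorem measurable_q₂ : Measurable q₂ := continuous_q₂.measurable

/-- The Gaussian density on pairs of vectors of `ℝ³`. -/
def gaussDensity (p : (Fin 3 → ℝ) × (Fin 3 → ℝ)) : ENNReal :=
  ENNReal.ofReal (Real.exp (-(Real.pi * (p.1 ⬝ᵥ p.1 + p.2 ⬝ᵥ p.2))))

theorem measurable_gaussDensity : Measurable gaussDensity := by
  unfold gaussDensity dotProduct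
  fun_prop

/-- Completing the square in s diagonalises the quadratic form to q₁ t² + q₁ (s + aw/q₁)² + (q₂/q₁)
a², because (1, x₂, x₃) and (0, 1, x₁) have Gram determinant q₂. The moments of t², 1 and |a| are
1/(2π q₁^(3/2)), q₁^(-1/2) and q₁/(π q₂). -/
theorem lintegral_gaussDensity_fiber (x : ℝ × ℝ × ℝ) :
    ∫⁻ t : ℝ, ∫⁻ s : ℝ, ∫⁻ a : ℝ, ENNReal.ofReal (t ^ 2) * (ENNReal.ofReal |a|
      * gaussDensity (![s, s * x.2.1 + a, s * x.2.2 + a * x.1], ![t, t * x.2.1, t * x.2.2]))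
      = ENNReal.ofReal (1 / (2 * Real.pi ^ 2) * (1 / (q₁ x * q₂ x))) := by
  have h1 := q₁_pos x
  have h2 := q₂_pos x
  set w := x.2.1 + x.1 * x.2.2 with hw
  have hq : (1 + x.1 ^ 2) * q₁ x - w ^ 2 = q₂ x := by simp only [hw, q₁, q₂]; ring
  have hd : ∀ t s a : ℝ,
      gaussDensity (![s, s * x.2.1 + a, s * x.2.2 + a * x.1], ![t, t * x.2.1, t * x.2.2])
      = ENNReal.ofReal (Real.exp (-(Real.pi * q₁ x) * t ^ 2))
        * (ENNReal.ofReal (Real.exp (-(Real.pi * (q₂ x / q₁ x)) * a ^ 2))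
          * ENNReal.ofReal (Real.exp (-(Real.pi * q₁ x) * (s + a * w / q₁ x) ^ 2))) := by
    intro t s a
    rw [gaussDensity, ← ENNReal.ofReal_mul (Real.exp_pos _).le,
      ← ENNReal.ofReal_mul (Real.exp_pos _).le, ← Real.exp_add, ← Real.exp_add]
    congr 2
    simp only [dotProduct, Fin.sum_univ_three, Matrix.cons_val]
    have h3 : (q₂ x / q₁ x) * a ^ 2 + q₁ x * (s + a * w / q₁ x) ^ 2
        = q₁ x * s ^ 2 + 2 * s * a * w + (1 + x.1 ^ 2) * a ^ 2 := by
      rw [← hq]; field_simp; ring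
    have h4 : q₁ x * s ^ 2 + 2 * s * a * w + (1 + x.1 ^ 2) * a ^ 2
        = s * s + (s * x.2.1 + a) * (s * x.2.1 + a)
          + (s * x.2.2 + a * x.1) * (s * x.2.2 + a * x.1) := by
      simp only [hw, q₁]; ring
    rw [← h4, ← h3]
    simp only [q₁]
    ring
  simp_rw [hd]
  have hin : ∀ t : ℝ, ∫⁻ s : ℝ, ∫⁻ a : ℝ, ENNReal.ofReal (t ^ 2) * (ENNReal.ofReal |a|
      * (ENNReal.ofReal (Real.exp (-(Real.pi * q₁ x) * t ^ 2))
        * (ENNReal.ofReal (Real.exp (-(Real.pi * (q₂ x / q₁ x)) * a ^ 2))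
          * ENNReal.ofReal (Real.exp (-(Real.pi * q₁ x) * (s + a * w / q₁ x) ^ 2)))))
      = ENNReal.ofReal (t ^ 2) * ENNReal.ofReal (Real.exp (-(Real.pi * q₁ x) * t ^ 2))
        * ENNReal.ofReal (1 / (Real.pi * (q₂ x / q₁ x)) * (1 / √(q₁ x))) := by
    intro t
    rw [lintegral_lintegral_swap (by fun_prop)]
    have hs : ∀ a : ℝ, ∫⁻ s : ℝ, ENNReal.ofReal (t ^ 2) * (ENNReal.ofReal |a|
      * (ENNReal.ofReal (Real.exp (-(Real.pi * q₁ x) * t ^ 2))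
        * (ENNReal.ofReal (Real.exp (-(Real.pi * (q₂ x / q₁ x)) * a ^ 2))
          * ENNReal.ofReal (Real.exp (-(Real.pi * q₁ x) * (s + a * w / q₁ x) ^ 2)))))
        = ENNReal.ofReal (t ^ 2) * ENNReal.ofReal (Real.exp (-(Real.pi * q₁ x) * t ^ 2))
          * ENNReal.ofReal (1 / √(q₁ x))
          * (ENNReal.ofReal |a| * ENNReal.ofReal (Real.exp (-(Real.pi * (q₂ x / q₁ x)) * a ^ 2))) := by
      intro a
      rw [lintegral_const_mul _ (by fun_prop), lintegral_const_mul _ (by fun_prop),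
        lintegral_const_mul _ (by fun_prop), lintegral_const_mul _ (by fun_prop),
        lintegral_add_right_eq_self
          (fun s => ENNReal.ofReal (Real.exp (-(Real.pi * q₁ x) * s ^ 2))),
        lintegral_gaussian h1]
      ring
    simp_rw [hs]
    rw [lintegral_const_mul _ (by fun_prop), lintegral_abs_mul_gaussian (by positivity), mul_assoc,
      mul_comm (ENNReal.ofReal (1 / √(q₁ x))),
      ← ENNReal.ofReal_mul (p := 1 / (Real.pi * (q₂ x / q₁ x))) (by positivity)]
  simp_rw [hin]
  rw [lintegral_mul_const _ (by fun_prop), lintegral_sq_mul_gaussian h1,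
    ← ENNReal.ofReal_mul (by positivity)]
  congr 1
  have h5 : √(q₁ x) * √(q₁ x) = q₁ x := Real.mul_self_sqrt h1.le
  have h6 : √(q₁ x) ≠ 0 := by positivity
  field_simp
  rw [sq, h5]

/-- The two substitutions combined: x runs through the big cell, and (t, s, a) through the pairs (r,
v) that span the same flag. -/
theorem lintegral_flag (g : (Fin 3 → ℝ) × (Fin 3 → ℝ) → ENNReal) (hg : Measurable g) :
    ∫⁻ p, g p = ∫⁻ x : ℝ × ℝ × ℝ, ∫⁻ t : ℝ, ∫⁻ s : ℝ, ∫⁻ a : ℝ, ENNReal.ofReal (t ^ 2)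
      * (ENNReal.ofReal |a|
        * g (![s, s * x.2.1 + a, s * x.2.2 + a * x.1], ![t, t * x.2.1, t * x.2.2])) := by
  have hm : Measurable fun w : (((ℝ × ℝ × ℝ) × ℝ) × ℝ) × ℝ => ENNReal.ofReal (w.1.1.2 ^ 2)
      * (ENNReal.ofReal |w.2|
        * g (![w.1.2, w.1.2 * w.1.1.1.2.1 + w.2, w.1.2 * w.1.1.1.2.2 + w.2 * w.1.1.1.1],
          ![w.1.1.2, w.1.1.2 * w.1.1.1.2.1, w.1.1.2 * w.1.1.1.2.2])) := by
    refine (by fun_prop : Measurable fun w : (((ℝ × ℝ × ℝ) × ℝ) × ℝ) × ℝ =>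
      ENNReal.ofReal (w.1.1.2 ^ 2)).mul ((by fun_prop : Measurable
        fun w : (((ℝ × ℝ × ℝ) × ℝ) × ℝ) × ℝ => ENNReal.ofReal |w.2|).mul (hg.comp
        ((measurable_vecCons ?_ ?_ ?_).prodMk (measurable_vecCons ?_ ?_ ?_)))) <;> fun_prop
  have hm1 : Measurable fun q : (ℝ × ℝ × ℝ) × ℝ => ∫⁻ s : ℝ, ∫⁻ a : ℝ, ENNReal.ofReal (q.2 ^ 2)
      * (ENNReal.ofReal |a|
        * g (![s, s * q.1.2.1 + a, s * q.1.2.2 + a * q.1.1],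
          ![q.2, q.2 * q.1.2.1, q.2 * q.1.2.2])) :=
    hm.lintegral_prod_right'.lintegral_prod_right'
  have hm2 : Measurable fun x : ℝ × ℝ × ℝ => ∫⁻ t : ℝ, ∫⁻ s : ℝ, ∫⁻ a : ℝ, ENNReal.ofReal (t ^ 2)
      * (ENNReal.ofReal |a|
        * g (![s, s * x.2.1 + a, s * x.2.2 + a * x.1], ![t, t * x.2.1, t * x.2.2])) :=
    hm1.lintegral_prod_right'
  rw [Measure.volume_eq_prod, lintegral_prod_symm _ hg.aemeasurable,
    lintegral_projective _ hg.lintegral_prod_left']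
  calc _ = ∫⁻ x₂ : ℝ, ∫⁻ x₃ : ℝ, ∫⁻ t : ℝ, ∫⁻ x₁ : ℝ, ∫⁻ s : ℝ, ∫⁻ a : ℝ, ENNReal.ofReal (t ^ 2)
      * (ENNReal.ofReal |a|
        * g (![s, s * x₂ + a, s * x₃ + a * x₁], ![t, t * x₂, t * x₃])) := by
        refine lintegral_congr fun x₂ => lintegral_congr fun x₃ => lintegral_congr fun t => ?_
        rw [lintegral_affine_flag (fun r => g (r, ![t, t * x₂, t * x₃]))
          (hg.comp (by fun_prop)) x₂ x₃, ← lintegral_const_mul' _ _ ENNReal.ofReal_ne_top]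
        refine lintegral_congr fun x₁ => ?_
        rw [← lintegral_const_mul' _ _ ENNReal.ofReal_ne_top]
        refine lintegral_congr fun s => ?_
        rw [← lintegral_const_mul' _ _ ENNReal.ofReal_ne_top]
    _ = ∫⁻ x₂ : ℝ, ∫⁻ x₃ : ℝ, ∫⁻ x₁ : ℝ, ∫⁻ t : ℝ, ∫⁻ s : ℝ, ∫⁻ a : ℝ, ENNReal.ofReal (t ^ 2)
      * (ENNReal.ofReal |a|
        * g (![s, s * x₂ + a, s * x₃ + a * x₁], ![t, t * x₂, t * x₃])) := by
        refine lintegral_congr fun x₂ => lintegral_congr fun x₃ => ?_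
        refine lintegral_lintegral_swap (Measurable.aemeasurable ?_)
        exact hm1.comp (by fun_prop : Measurable fun w : ℝ × ℝ => ((w.2, x₂, x₃), w.1))
    _ = ∫⁻ x₂ : ℝ, ∫⁻ x₁ : ℝ, ∫⁻ x₃ : ℝ, ∫⁻ t : ℝ, ∫⁻ s : ℝ, ∫⁻ a : ℝ, ENNReal.ofReal (t ^ 2)
      * (ENNReal.ofReal |a|
        * g (![s, s * x₂ + a, s * x₃ + a * x₁], ![t, t * x₂, t * x₃])) := by
        refine lintegral_congr fun x₂ => ?_
        refine lintegral_lintegral_swap (Measurable.aemeasurable ?_)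
        exact hm2.comp (by fun_prop : Measurable fun w : ℝ × ℝ => (w.2, x₂, w.1))
    _ = ∫⁻ x₁ : ℝ, ∫⁻ x₂ : ℝ, ∫⁻ x₃ : ℝ, ∫⁻ t : ℝ, ∫⁻ s : ℝ, ∫⁻ a : ℝ, ENNReal.ofReal (t ^ 2)
      * (ENNReal.ofReal |a|
        * g (![s, s * x₂ + a, s * x₃ + a * x₁], ![t, t * x₂, t * x₃])) := by
        refine lintegral_lintegral_swap (Measurable.aemeasurable ?_)
        exact Measurable.lintegral_prod_right'
          (hm2.comp (by fun_prop : Measurable fun w : (ℝ × ℝ) × ℝ => (w.1.2, w.1.1, w.2)))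
    _ = _ := by
        rw [Measure.volume_eq_prod, lintegral_prod _ hm2.aemeasurable]
        refine lintegral_congr fun x₁ => ?_
        rw [Measure.volume_eq_prod, lintegral_prod]
        exact (hm2.comp measurable_prodMk_left).aemeasurable

/-- The Gaussian measure on pairs of vectors of `ℝ³`. -/
def gaussFlag : Measure ((Fin 3 → ℝ) × (Fin 3 → ℝ)) := volume.withDensity gaussDensity

instance : IsProbabilityMeasure gaussFlag := by
  constructor
  have h1 : ∫⁻ v : Fin 3 → ℝ, ENNReal.ofReal (Real.exp (-(Real.pi * (v ⬝ᵥ v)))) = 1 := by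
    rw [lintegral_fin_three _ (by unfold dotProduct; fun_prop)]
    have h : ∀ a b c : ℝ, ENNReal.ofReal (Real.exp (-(Real.pi * (![a, b, c] ⬝ᵥ ![a, b, c]))))
        = ENNReal.ofReal (Real.exp (-(Real.pi * 1) * a ^ 2))
          * (ENNReal.ofReal (Real.exp (-(Real.pi * 1) * b ^ 2))
            * ENNReal.ofReal (Real.exp (-(Real.pi * 1) * c ^ 2))) := by
      intro a b c
      rw [← ENNReal.ofReal_mul (Real.exp_pos _).le, ← ENNReal.ofReal_mul (Real.exp_pos _).le,
        ← Real.exp_add, ← Real.exp_add]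
      congr 2
      simp only [dotProduct, Fin.sum_univ_three, Matrix.cons_val]
      ring
    simp_rw [h]
    simp_rw [lintegral_const_mul' _ _ ENNReal.ofReal_ne_top, lintegral_gaussian one_pos]
    rw [lintegral_mul_const _ (by fun_prop), lintegral_gaussian one_pos]
    simpa using lintegral_gaussian one_pos
  rw [gaussFlag, withDensity_apply _ MeasurableSet.univ, Measure.restrict_univ,
    Measure.volume_eq_prod]
  have h2 : ∀ p, gaussDensity p = ENNReal.ofReal (Real.exp (-(Real.pi * (p.1 ⬝ᵥ p.1))))
      * ENNReal.ofReal (Real.exp (-(Real.pi * (p.2 ⬝ᵥ p.2)))) := by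
    intro p
    rw [gaussDensity, ← ENNReal.ofReal_mul (Real.exp_pos _).le, ← Real.exp_add]
    congr 2
    ring
  simp_rw [h2]
  have h3 : Measurable fun v : Fin 3 → ℝ => ENNReal.ofReal (Real.exp (-(Real.pi * (v ⬝ᵥ v)))) := by
    unfold dotProduct
    fun_prop
  rw [lintegral_prod_mul (f := fun v : Fin 3 → ℝ => ENNReal.ofReal (Real.exp (-(Real.pi * (v ⬝ᵥ v)))))
    (g := fun v : Fin 3 → ℝ => ENNReal.ofReal (Real.exp (-(Real.pi * (v ⬝ᵥ v)))))
    h3.aemeasurable h3.aemeasurable, h1, mul_one]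

/-- The coordinates of a flag with respect to the big cell. -/
def flagCoord (p : (Fin 3 → ℝ) × (Fin 3 → ℝ)) : ℝ × ℝ × ℝ :=
  ((p.1 0 * p.2 2 - p.1 2 * p.2 0) / (p.1 0 * p.2 1 - p.1 1 * p.2 0), p.2 1 / p.2 0,
    p.2 2 / p.2 0)

/-- The last two rows of `w_l u`. -/
def cellRows (x : ℝ × ℝ × ℝ) : (Fin 3 → ℝ) × (Fin 3 → ℝ) :=
  (![0, -1, -x.1], ![1, x.2.1, x.2.2])

theorem measurable_flagCoord : Measurable flagCoord := by
  unfold flagCoord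
  fun_prop

theorem measurable_cellRows : Measurable cellRows :=
  (measurable_vecCons (by fun_prop) (by fun_prop) (by fun_prop)).prodMk
    (measurable_vecCons (by fun_prop) (by fun_prop) (by fun_prop))

theorem flagCoord_eq (x : ℝ × ℝ × ℝ) {t a : ℝ} (ht : t ≠ 0) (ha : a ≠ 0) (s : ℝ) :
    flagCoord (![s, s * x.2.1 + a, s * x.2.2 + a * x.1], ![t, t * x.2.1, t * x.2.2]) = x := by
  have h : s * (t * x.2.1) - (s * x.2.1 + a) * t = -(a * t) := by ring
  have h' : s * (t * x.2.2) - (s * x.2.2 + a * x.1) * t = -(a * t) * x.1 := by ring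
  have h0 : -(a * t) ≠ 0 := neg_ne_zero.mpr (mul_ne_zero ha ht)
  simp only [flagCoord, Matrix.cons_val, h, h', mul_div_cancel_left₀ _ h0, mul_div_cancel_left₀ _ ht]

theorem ae_gaussFlag_generic :
    ∀ᵐ p ∂gaussFlag, p.2 0 ≠ 0 ∧ p.1 0 * p.2 1 - p.1 1 * p.2 0 ≠ 0 := by
  have hS : MeasurableSet {p : (Fin 3 → ℝ) × (Fin 3 → ℝ) |
      ¬(p.2 0 ≠ 0 ∧ p.1 0 * p.2 1 - p.1 1 * p.2 0 ≠ 0)} := by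
    apply MeasurableSet.compl
    apply MeasurableSet.inter
    · exact (measurableSet_eq_fun (by fun_prop) (by fun_prop)).compl
    · exact (measurableSet_eq_fun (by fun_prop) (by fun_prop)).compl
  refine (withDensity_absolutelyContinuous volume gaussDensity) ?_
  change volume {p : (Fin 3 → ℝ) × (Fin 3 → ℝ) |
      ¬(p.2 0 ≠ 0 ∧ p.1 0 * p.2 1 - p.1 1 * p.2 0 ≠ 0)} = 0
  rw [← lintegral_indicator_one hS, lintegral_flag _ (measurable_one.indicator hS)]
  have : ∀ (x : ℝ × ℝ × ℝ) (t s a : ℝ), ENNReal.ofReal (t ^ 2) * (ENNReal.ofReal |a|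
      * ({p : (Fin 3 → ℝ) × (Fin 3 → ℝ) |
      ¬(p.2 0 ≠ 0 ∧ p.1 0 * p.2 1 - p.1 1 * p.2 0 ≠ 0)}.indicator 1
        (![s, s * x.2.1 + a, s * x.2.2 + a * x.1], ![t, t * x.2.1, t * x.2.2]) : ENNReal)) = 0 := by
    intro x t s a
    by_cases ht : t = 0
    · simp [ht]
    by_cases ha : a = 0
    · simp [ha]
    rw [Set.indicator_of_notMem, mul_zero, mul_zero]
    rw [Set.mem_ofPred_eq, not_not]
    refine ⟨by simpa using ht, ?_⟩
    have h : s * (t * x.2.1) - (s * x.2.1 + a) * t = -(a * t) := by ring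
    simp only [Matrix.cons_val, h]
    exact neg_ne_zero.mpr (mul_ne_zero ha ht)
  simp_rw [this]
  simp

/-- `flagCoord` is constant along the fibres of the flag parametrisation, so the density of the
image is the fibre integral of the Gaussian. This is the source of the constant 1/(2π²). -/
theorem map_flagCoord_gaussFlag : gaussFlag.map flagCoord
    = volume.withDensity fun x => ENNReal.ofReal (1 / (2 * Real.pi ^ 2) * (1 / (q₁ x * q₂ x))) := by
  refine Measure.ext_of_lintegral _ fun f hf => ?_
  rw [lintegral_map hf measurable_flagCoord, gaussFlag]
  change ∫⁻ p, (f ∘ flagCoord) p ∂_ = _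
  rw [lintegral_withDensity_eq_lintegral_mul _ measurable_gaussDensity (hf.comp measurable_flagCoord),
    lintegral_withDensity_eq_lintegral_mul _ (by fun_prop) hf,
    lintegral_flag _ (measurable_gaussDensity.mul (hf.comp measurable_flagCoord))]
  refine lintegral_congr fun x => ?_
  have hm : Measurable fun q : (ℝ × ℝ) × ℝ => ENNReal.ofReal (q.1.1 ^ 2) * (ENNReal.ofReal |q.2|
      * gaussDensity (![q.1.2, q.1.2 * x.2.1 + q.2, q.1.2 * x.2.2 + q.2 * x.1],
        ![q.1.1, q.1.1 * x.2.1, q.1.1 * x.2.2])) := by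
    refine (by fun_prop : Measurable fun q : (ℝ × ℝ) × ℝ =>
      ENNReal.ofReal (q.1.1 ^ 2)).mul ((by fun_prop : Measurable
        fun q : (ℝ × ℝ) × ℝ => ENNReal.ofReal |q.2|).mul (measurable_gaussDensity.comp
        ((measurable_vecCons ?_ ?_ ?_).prodMk (measurable_vecCons ?_ ?_ ?_)))) <;> fun_prop
  rw [Pi.mul_apply, ← lintegral_gaussDensity_fiber x]
  rw [← lintegral_mul_const _ (Measurable.lintegral_prod_right' (Measurable.lintegral_prod_right' hm))]
  refine lintegral_congr fun t => ?_
  have hm1 := hm.comp (by fun_prop : Measurable fun q : ℝ × ℝ => ((t, q.1), q.2))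
  dsimp only [Function.comp_def] at hm1 ⊢
  rw [← lintegral_mul_const _ hm1.lintegral_prod_right']
  refine lintegral_congr fun s => ?_
  have hm2 := hm1.comp (measurable_prodMk_left (x := s))
  dsimp only [Function.comp_def] at hm2 ⊢
  rw [← lintegral_mul_const _ hm2]
  refine lintegral_congr fun a => ?_
  by_cases ht : t = 0
  · simp [ht]
  by_cases ha : a = 0
  · simp [ha]
  simp only [Pi.mul_apply, flagCoord_eq x ht ha]
  ring

/-! ### From SO(3) to the big cell -/

theorem exists_SO3_rows {e f : Fin 3 → ℝ} (he : e ⬝ᵥ e = 1) (hf : f ⬝ᵥ f = 1) (hef : e ⬝ᵥ f = 0) :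
    ∃ k : SO3, (k : Mat3) 1 = e ∧ (k : Mat3) 2 = f := by
  have he' := he
  have hf' := hf
  have hef' := hef
  simp only [dotProduct, Fin.sum_univ_three] at he' hf' hef'
  -- The missing first row is the cross product of the other two.
  let A : Mat3 := Matrix.of ![![e 1 * f 2 - e 2 * f 1, e 2 * f 0 - e 0 * f 2, e 0 * f 1 - e 1 * f 0],
    e, f]
  have hcc : (e 1 * f 2 - e 2 * f 1) ^ 2 + (e 2 * f 0 - e 0 * f 2) ^ 2
      + (e 0 * f 1 - e 1 * f 0) ^ 2 = 1 := by
    linear_combination (f 0 * f 0 + f 1 * f 1 + f 2 * f 2) * he' + hf'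
      - (e 0 * f 0 + e 1 * f 1 + e 2 * f 2) * hef'
  refine ⟨⟨A, mem_SO3 ?_ ?_⟩, rfl, rfl⟩
  · ext i j
    fin_cases i <;> fin_cases j <;>
      simp only [A, Matrix.mul_apply, Fin.sum_univ_three, Matrix.transpose_apply, Matrix.of_apply,
        Matrix.one_apply, Matrix.cons_val, Fin.zero_eta, Fin.mk_one, Fin.reduceFinMk, Fin.isValue,
        if_true, Fin.reduceEq, if_false, zero_ne_one, one_ne_zero]
    · linear_combination hcc
    · ring
    · ring
    · ring
    · linear_combination he'
    · linear_combination hef'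
    · ring
    · linear_combination hef'
    · linear_combination hf'
  · rw [Matrix.det_fin_three]
    simp only [A, Matrix.of_apply, Matrix.cons_val]
    linear_combination hcc

theorem exists_SO3_flag {r v : Fin 3 → ℝ} (h : 0 < gram2 r v) :
    ∃ (k : SO3) (α β δ : ℝ), α ≠ 0 ∧ δ ≠ 0 ∧
      r = α • (k : Mat3) 1 + β • (k : Mat3) 2 ∧ v = δ • (k : Mat3) 2 := by
  have hv := dotProduct_self_pos_of_gram2_pos h
  set n := √(v ⬝ᵥ v) with hn
  have hn0 : 0 < n := Real.sqrt_pos.mpr hv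
  have hnn : n * n = v ⬝ᵥ v := Real.mul_self_sqrt hv.le
  set d := √(gram2 r v) with hd
  have hd0 : 0 < d := Real.sqrt_pos.mpr h
  have hdd : d * d = gram2 r v := Real.mul_self_sqrt h.le
  let w : Fin 3 → ℝ := r - ((r ⬝ᵥ v) / (v ⬝ᵥ v)) • v
  -- Gram–Schmidt: `w` is the component of r orthogonal to v, of length d/n.
  have hww : w ⬝ᵥ w = gram2 r v / (v ⬝ᵥ v) := by
    simp only [w, sub_dotProduct, dotProduct_sub, smul_dotProduct, dotProduct_smul, smul_eq_mul,
      gram2, dotProduct_comm v r]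
    field_simp
    ring
  have hwv : w ⬝ᵥ v = 0 := by
    simp only [w, sub_dotProduct, smul_dotProduct, smul_eq_mul]
    field_simp
    ring
  obtain ⟨k, hk1, hk2⟩ := exists_SO3_rows (e := (n / d) • w) (f := (1 / n) • v)
    (by simp only [smul_dotProduct, dotProduct_smul, smul_eq_mul, hww]
        rw [← hdd, ← hnn]; field_simp)
    (by simp only [smul_dotProduct, dotProduct_smul, smul_eq_mul]
        rw [← hnn]; field_simp)
    (by simp [smul_dotProduct, dotProduct_smul, hwv])
  refine ⟨k, d / n, (r ⬝ᵥ v) / n, n, by positivity, hn0.ne', ?_, ?_⟩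
  · rw [hk1, hk2, smul_smul, smul_smul]
    have e1 : d / n * (n / d) = 1 := by field_simp
    have e2 : (r ⬝ᵥ v) / n * (1 / n) = (r ⬝ᵥ v) / (v ⬝ᵥ v) := by rw [← hnn]; field_simp
    rw [e1, e2, one_smul]
    simp [w]
  · rw [hk2, smul_smul, mul_one_div_cancel hn0.ne', one_smul]

theorem measurePreserving_vecMul_SO3 (k : SO3) :
    MeasurePreserving (fun v : Fin 3 → ℝ => v ᵥ* (k : Mat3)) := by
  have h : (k : Mat3)ᵀ.det ≠ 0 := by rw [Matrix.det_transpose, SO3.det_eq_one]; exact one_ne_zero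
  have h1 := Real.map_matrix_volume_pi_eq_smul_volume_pi h
  rw [Matrix.det_transpose, SO3.det_eq_one, inv_one, abs_one, ENNReal.ofReal_one, one_smul] at h1
  have h2 : (fun v : Fin 3 → ℝ => v ᵥ* (k : Mat3)) = Matrix.toLin' (k : Mat3)ᵀ := by
    ext1 v
    rw [Matrix.toLin'_apply, Matrix.mulVec_transpose]
  rw [h2]
  exact ⟨(Matrix.toLin' (k : Mat3)ᵀ).continuous_of_finiteDimensional.measurable, h1⟩

theorem vecMul_SO3_dotProduct (k : SO3) (v w : Fin 3 → ℝ) :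
    (v ᵥ* (k : Mat3)) ⬝ᵥ (w ᵥ* (k : Mat3)) = v ⬝ᵥ w := by
  rw [← Matrix.mulVec_transpose (k : Mat3) w, Matrix.dotProduct_mulVec, Matrix.vecMul_vecMul,
    SO3.mul_transpose, Matrix.vecMul_one]

theorem measurePreserving_gaussFlag (k : SO3) :
    MeasurePreserving (fun p : (Fin 3 → ℝ) × (Fin 3 → ℝ) => (p.1 ᵥ* (k : Mat3), p.2 ᵥ* (k : Mat3)))
      gaussFlag gaussFlag := by
  have h : MeasurePreserving
      (fun p : (Fin 3 → ℝ) × (Fin 3 → ℝ) => (p.1 ᵥ* (k : Mat3), p.2 ᵥ* (k : Mat3))) :=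
    (measurePreserving_vecMul_SO3 k).prod (measurePreserving_vecMul_SO3 k)
  refine ⟨h.measurable, ?_⟩
  refine Measure.ext_of_lintegral _ fun f hf => ?_
  rw [lintegral_map hf h.measurable, gaussFlag]
  change ∫⁻ p, (f ∘ fun p : (Fin 3 → ℝ) × (Fin 3 → ℝ) =>
    (p.1 ᵥ* (k : Mat3), p.2 ᵥ* (k : Mat3))) p ∂_ = _
  rw [lintegral_withDensity_eq_lintegral_mul _ measurable_gaussDensity (hf.comp h.measurable),
    lintegral_withDensity_eq_lintegral_mul _ measurable_gaussDensity hf,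
    ← h.lintegral_comp (measurable_gaussDensity.mul hf)]
  refine lintegral_congr fun p => ?_
  simp [gaussDensity, vecMul_SO3_dotProduct]

/-- The integral over `SO(3)` of a function on flags, as an integral over the big cell. -/
theorem integral_haarK_eq {G : (Fin 3 → ℝ) × (Fin 3 → ℝ) → ℂ} (hG : Measurable G)
    (hinv : ∀ (α β δ : ℝ) (r v : Fin 3 → ℝ), α ≠ 0 → δ ≠ 0 → G (α • r + β • v, δ • v) = G (r, v))
    {C : ℝ} (hC : ∀ k : SO3, ‖G ((k : Mat3) 1, (k : Mat3) 2)‖ ≤ C) :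
    ∫ k : SO3, G ((k : Mat3) 1, (k : Mat3) 2) ∂haarK
      = ∫ x : ℝ × ℝ × ℝ, ((1 / (2 * Real.pi ^ 2) * (1 / (q₁ x * q₂ x)) : ℝ) : ℂ) * G (cellRows x) := by
  -- K acts transitively on flags: up to the scalings and shears that leave G unchanged, a generic
  -- pair p is the pair of last two rows of some k₀.
  have hgen : ∀ p : (Fin 3 → ℝ) × (Fin 3 → ℝ), p.1 0 * p.2 1 - p.1 1 * p.2 0 ≠ 0 →
      ∃ k₀ : SO3, ∀ k : SO3, G (p.1 ᵥ* (k : Mat3), p.2 ᵥ* (k : Mat3))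
        = G (((k₀ * k : SO3) : Mat3) 1, ((k₀ * k : SO3) : Mat3) 2) := by
    intro p hp
    have hg : 0 < gram2 p.1 p.2 := by
      rw [gram2_eq]
      have := pow_pos (abs_pos.mpr hp) 2
      rw [sq_abs] at this
      positivity
    obtain ⟨k₀, α, β, δ, hα, hδ, hr, hv⟩ := exists_SO3_flag hg
    refine ⟨k₀, fun k => ?_⟩
    rw [hr, hv, Matrix.add_vecMul, Matrix.smul_vecMul, Matrix.smul_vecMul, Matrix.smul_vecMul,
      hinv _ _ _ _ _ hα hδ]
    rfl
  have hK : ∀ᵐ p ∂gaussFlag, ∫ k : SO3, G (p.1 ᵥ* (k : Mat3), p.2 ᵥ* (k : Mat3)) ∂haarK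
      = ∫ k : SO3, G ((k : Mat3) 1, (k : Mat3) 2) ∂haarK := by
    filter_upwards [ae_gaussFlag_generic] with p hp
    obtain ⟨k₀, hk₀⟩ := hgen p hp.2
    simp_rw [hk₀]
    exact integral_mul_left_eq_self (fun k : SO3 => G ((k : Mat3) 1, (k : Mat3) 2)) k₀
  have hcoe : Continuous fun k : SO3 => (k : Mat3) := continuous_subtype_val
  have hmeas : Measurable fun q : ((Fin 3 → ℝ) × (Fin 3 → ℝ)) × SO3 =>
      G (q.1.1 ᵥ* (q.2 : Mat3), q.1.2 ᵥ* (q.2 : Mat3)) := by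
    refine hG.comp (Continuous.measurable ?_)
    exact (Continuous.matrix_vecMul (by fun_prop) (hcoe.comp continuous_snd)).prodMk
      (Continuous.matrix_vecMul (by fun_prop) (hcoe.comp continuous_snd))
  -- The double integral of G (p k) over the Gaussian measure and K is evaluated in both orders. The
  -- k-integral is the integral over K for almost every p; the p-integral is independent of k
  -- because the Gaussian is rotation invariant. Boundedness of G on K justifies Fubini.
  have hint : Integrable (Function.uncurry fun (p : (Fin 3 → ℝ) × (Fin 3 → ℝ)) (k : SO3) =>
      G (p.1 ᵥ* (k : Mat3), p.2 ᵥ* (k : Mat3))) (gaussFlag.prod haarK) := by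
    refine Integrable.of_bound hmeas.aestronglyMeasurable C ?_
    refine (Measure.ae_prod_iff_ae_ae (measurableSet_le hmeas.norm measurable_const)).mpr ?_
    filter_upwards [ae_gaussFlag_generic] with p hp
    obtain ⟨k₀, hk₀⟩ := hgen p hp.2
    refine Eventually.of_forall fun k => ?_
    rw [hk₀]
    exact hC _
  have h1 : ∫ p, (∫ k : SO3, G (p.1 ᵥ* (k : Mat3), p.2 ᵥ* (k : Mat3)) ∂haarK) ∂gaussFlag
      = ∫ k : SO3, G ((k : Mat3) 1, (k : Mat3) 2) ∂haarK := by
    rw [integral_congr_ae hK]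
    simp
  have h2 : ∀ k : SO3, ∫ p, G (p.1 ᵥ* (k : Mat3), p.2 ᵥ* (k : Mat3)) ∂gaussFlag
      = ∫ p, G p ∂gaussFlag := by
    intro k
    have h := measurePreserving_gaussFlag k
    conv_rhs => rw [← h.map_eq]
    rw [integral_map h.measurable.aemeasurable hG.aestronglyMeasurable]
  have h3 : ∀ᵐ p ∂gaussFlag, G p = G (cellRows (flagCoord p)) := by
    filter_upwards [ae_gaussFlag_generic] with p hp
    obtain ⟨hv, hm⟩ := hp
    set m := p.1 0 * p.2 1 - p.1 1 * p.2 0 with hmd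
    -- The pair p and its representative in the big cell span the same flag: r = (m/v₀)(0, -1, -x₁)
    -- + r₀ (1, x₂, x₃) and v = v₀ (1, x₂, x₃).
    have h := hinv (m / p.2 0) (p.1 0) (p.2 0) (cellRows (flagCoord p)).1
      (cellRows (flagCoord p)).2 (div_ne_zero hm hv) hv
    rw [← show G ((cellRows (flagCoord p)).1, (cellRows (flagCoord p)).2)
      = G (cellRows (flagCoord p)) from rfl, ← h]
    congr 1
    ext i
    · fin_cases i
      · simp [cellRows]
      · simp [cellRows, flagCoord]
        field_simp
        rw [hmd]; ring
      · simp [cellRows, flagCoord, ← hmd]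
        field_simp
        ring
    · fin_cases i <;> simp [cellRows, flagCoord] <;> field_simp
  have hGc : Measurable fun x => G (cellRows x) := hG.comp measurable_cellRows
  rw [← h1, integral_integral_swap hint]
  simp_rw [h2]
  rw [integral_const, probReal_univ, one_smul, integral_congr_ae h3,
    ← integral_map (f := fun x => G (cellRows x)) measurable_flagCoord.aemeasurable
      hGc.aestronglyMeasurable, map_flagCoord_gaussFlag,
    integral_withDensity_eq_integral_toReal_smul (by fun_prop) (by simp)]
  refine integral_congr_ae (Eventually.of_forall fun x => ?_)
  have := q₁_pos x
  have := q₂_pos x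
  change (ENNReal.ofReal _).toReal • _ = _
  rw [ENNReal.toReal_ofReal (by positivity), Complex.real_smul]

/-! ### The spherical function as an integral over U(ℝ) -/

theorem continuous_ofReal_cpow {α : Type*} [TopologicalSpace α] {f : α → ℝ} (hf : Continuous f)
    (h0 : ∀ x, 0 < f x) (w : ℂ) : Continuous fun x => (f x : ℂ) ^ w := by
  simp_rw [fun x => ofReal_cpow_eq_exp (h0 x) w]
  have := hf.log fun x => (h0 x).ne'
  fun_prop

theorem gram2_smul_add (α β δ : ℝ) (r v : Fin 3 → ℝ) :
    gram2 (α • r + β • v) (δ • v) = (α * δ) ^ 2 * gram2 r v := by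
  simp only [gram2_eq, Pi.add_apply, Pi.smul_apply, smul_eq_mul]
  ring

/-- The factor does not involve the flag, so ratios such as `flagFn (pz) / flagFn p` descend to
functions on flags. -/
theorem flagFn_smul_add (a b : ℂ) (α β δ : ℝ) (r v : Fin 3 → ℝ) :
    flagFn a b (α • r + β • v) (δ • v)
      = ((δ ^ 2 : ℝ) : ℂ) ^ (-a) * (((α * δ) ^ 2 : ℝ) : ℂ) ^ (-b) * flagFn a b r v := by
  have hv : 0 ≤ v ⬝ᵥ v := by
    simp only [dotProduct, Fin.sum_univ_three]
    exact add_nonneg (add_nonneg (mul_self_nonneg _) (mul_self_nonneg _)) (mul_self_nonneg _)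
  have hg : 0 ≤ gram2 r v := by rw [gram2_eq]; positivity
  have h1 : (δ • v) ⬝ᵥ (δ • v) = δ ^ 2 * (v ⬝ᵥ v) := by
    simp only [smul_dotProduct, dotProduct_smul, smul_eq_mul]
    ring
  rw [flagFn, flagFn, gram2_smul_add, h1, Complex.ofReal_mul, Complex.ofReal_mul,
    Complex.mul_cpow_ofReal_nonneg (sq_nonneg _) hv, Complex.mul_cpow_ofReal_nonneg (sq_nonneg _) hg]
  ring

@[fun_prop]
theorem measurable_flagFn (a b : ℂ) :
    Measurable fun p : (Fin 3 → ℝ) × (Fin 3 → ℝ) => flagFn a b p.1 p.2 := by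
  unfold flagFn gram2 dotProduct
  fun_prop

/-- The power function on the big cell, up to normalisation. -/
def cellFn (a b : ℂ) (x : ℝ × ℝ × ℝ) : ℂ := (q₁ x : ℂ) ^ (-a) * (q₂ x : ℂ) ^ (-b)

theorem continuous_cellFn (a b : ℂ) : Continuous (cellFn a b) :=
  (continuous_ofReal_cpow continuous_q₁ q₁_pos _).mul
    (continuous_ofReal_cpow continuous_q₂ q₂_pos _)

theorem norm_cellFn (a b : ℂ) (x : ℝ × ℝ × ℝ) :
    ‖cellFn a b x‖ = q₁ x ^ (-a.re) * q₂ x ^ (-b.re) := by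
  rw [cellFn, norm_mul, norm_ofReal_cpow (q₁_pos x), norm_ofReal_cpow (q₂_pos x), Complex.neg_re,
    Complex.neg_re]

theorem cellRows_dot (x : ℝ × ℝ × ℝ) : (cellRows x).2 ⬝ᵥ (cellRows x).2 = q₁ x := by
  simp only [cellRows, q₁, dotProduct, Fin.sum_univ_three, Matrix.cons_val]
  ring

theorem cellRows_gram2 (x : ℝ × ℝ × ℝ) : gram2 (cellRows x).1 (cellRows x).2 = q₂ x := by
  simp only [cellRows, q₂, gram2_eq, Matrix.cons_val]
  ring

theorem flagFn_cellRows (a b : ℂ) (x : ℝ × ℝ × ℝ) :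
    flagFn a b (cellRows x).1 (cellRows x).2 = cellFn a b x := by
  rw [flagFn, cellFn, cellRows_dot, cellRows_gram2]

/-- The passage from μ to -μ: the density of the big cell turns the reciprocal of the power function
into the power function with exponents 1 - a and 1 - b. -/
theorem inv_mul_inv_cellFn (a b : ℂ) (x : ℝ × ℝ × ℝ) :
    ((1 / (q₁ x * q₂ x) : ℝ) : ℂ) / cellFn a b x = cellFn (1 - a) (1 - b) x := by
  have h1 := q₁_pos x
  have h2 := q₂_pos x
  have e1 : (q₁ x : ℂ) ≠ 0 := by exact_mod_cast h1.ne'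
  have e2 : (q₂ x : ℂ) ≠ 0 := by exact_mod_cast h2.ne'
  rw [cellFn, cellFn, show -(1 - a) = a - 1 by ring, show -(1 - b) = b - 1 by ring,
    Complex.cpow_sub _ _ e1, Complex.cpow_sub _ _ e2, Complex.cpow_neg, Complex.cpow_neg,
    Complex.cpow_one, Complex.cpow_one]
  have e3 : (q₁ x : ℂ) ^ a ≠ 0 := by simp [Complex.cpow_eq_zero_iff, e1]
  have e4 : (q₂ x : ℂ) ^ b ≠ 0 := by simp [Complex.cpow_eq_zero_iff, e2]
  push_cast
  field_simp

theorem spherical_eq_integral_cell (μ : ℂ × ℂ) {z : Mat3} (hz : z.det ≠ 0) :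
    spherical μ z = ((|z.det| : ℝ) : ℂ) ^ (1 + μ.1) * ∫ x : ℝ × ℝ × ℝ,
      (1 / (2 * (Real.pi : ℂ) ^ 2)) * (flagFn ((1 + μ.1 + 2 * μ.2) / 2) ((1 + μ.1 - μ.2) / 2)
        ((cellRows x).1 ᵥ* z) ((cellRows x).2 ᵥ* z)
        * cellFn (1 - (1 + μ.1 + 2 * μ.2) / 2) (1 - (1 + μ.1 - μ.2) / 2) x) := by
  set a := (1 + μ.1 + 2 * μ.2) / 2
  set b := (1 + μ.1 - μ.2) / 2
  -- `flagFn` equals 1 on orthonormal rows, so on K the division changes nothing; it makes G a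
  -- function of the flag alone, to which `integral_haarK_eq` applies.
  let G : (Fin 3 → ℝ) × (Fin 3 → ℝ) → ℂ := fun p =>
    flagFn a b (p.1 ᵥ* z) (p.2 ᵥ* z) / flagFn a b p.1 p.2
  have hdet : ∀ k : SO3, ((k : Mat3) * z).det = z.det := by
    intro k
    rw [Matrix.det_mul, SO3.det_eq_one, one_mul]
  have hone : ∀ k : SO3, flagFn a b ((k : Mat3) 1) ((k : Mat3) 2) = 1 := by
    intro k
    have h : ∀ i j, (k : Mat3) i ⬝ᵥ (k : Mat3) j = (1 : Mat3) i j := by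
      intro i j
      rw [← gram_apply, SO3.mul_transpose]
    simp [flagFn, gram2, h]
  have hGm : Measurable G := by
    have : Measurable fun p : (Fin 3 → ℝ) × (Fin 3 → ℝ) => (p.1 ᵥ* z, p.2 ᵥ* z) := by
      refine Continuous.measurable ?_
      exact (Continuous.matrix_vecMul (by fun_prop) (by fun_prop)).prodMk
        (Continuous.matrix_vecMul (by fun_prop) (by fun_prop))
    exact Measurable.div (Measurable.comp (g := fun p : (Fin 3 → ℝ) × (Fin 3 → ℝ) =>
      flagFn a b p.1 p.2) (f := fun p : (Fin 3 → ℝ) × (Fin 3 → ℝ) => (p.1 ᵥ* z, p.2 ᵥ* z))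
      (measurable_flagFn a b) this) (measurable_flagFn a b)
  have hinv : ∀ (α β δ : ℝ) (r v : Fin 3 → ℝ), α ≠ 0 → δ ≠ 0 →
      G (α • r + β • v, δ • v) = G (r, v) := by
    intro α β δ r v hα hδ
    simp only [G, Matrix.add_vecMul, Matrix.smul_vecMul, flagFn_smul_add]
    rw [mul_div_mul_left]
    refine mul_ne_zero ?_ ?_
    · rw [Ne, Complex.cpow_eq_zero_iff]
      simp [hδ]
    · rw [Ne, Complex.cpow_eq_zero_iff]
      simp [hα, hδ]
  have hcont : Continuous fun k : SO3 => G ((k : Mat3) 1, (k : Mat3) 2) := by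
    have hk : Continuous fun k : SO3 => (k : Mat3) * z :=
      Continuous.matrix_mul continuous_subtype_val continuous_const
    have hr : ∀ i, Continuous fun k : SO3 => ((k : Mat3) * z) i := fun i =>
      (continuous_apply i).comp hk
    have hpos : ∀ k : SO3, 0 < gram2 (((k : Mat3) * z) 1) (((k : Mat3) * z) 2) := fun k =>
      gram2_rows_pos (by rw [hdet]; exact hz)
    have e : (fun k : SO3 => G ((k : Mat3) 1, (k : Mat3) 2))
        = fun k : SO3 => flagFn a b (((k : Mat3) * z) 1) (((k : Mat3) * z) 2) := by
      ext1 k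
      simp only [G, hone, div_one]
      rfl
    rw [e]
    refine (continuous_ofReal_cpow ?_ (fun k => dotProduct_self_pos_of_gram2_pos (hpos k)) _).mul
      (continuous_ofReal_cpow ?_ hpos _)
    · exact (hr 2).dotProduct (hr 2)
    · exact (((hr 1).dotProduct (hr 1)).mul ((hr 2).dotProduct (hr 2))).sub
        (((hr 1).dotProduct (hr 2)).pow 2)
  obtain ⟨C, hC⟩ := isCompact_univ.exists_bound_of_continuousOn hcont.continuousOn
  have h := integral_haarK_eq hGm hinv (C := C) fun k => hC k (Set.mem_univ k)
  rw [spherical]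
  have e1 : ∀ k : SO3, powerFn μ ((k : Mat3) * z)
      = ((|z.det| : ℝ) : ℂ) ^ (1 + μ.1) * G ((k : Mat3) 1, (k : Mat3) 2) := by
    intro k
    rw [powerFn_eq μ (by rw [hdet]; exact hz), hdet]
    simp only [G, hone, div_one]
    rfl
  simp_rw [e1]
  rw [integral_const_mul, h]
  congr 1
  refine integral_congr_ae (Eventually.of_forall fun x => ?_)
  simp only [G, flagFn_cellRows]
  rw [← inv_mul_inv_cellFn a b x]
  push_cast
  ring

/-- Multiplication in `U(ℝ)`, in coordinates. -/
def unipMul (u x : ℝ × ℝ × ℝ) : ℝ × ℝ × ℝ :=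
  (x.1 + u.1, x.2.1 + u.2.1, x.2.2 + (u.2.2 + u.2.1 * x.1))

/-- Conjugation of `U(ℝ)` by `diag (y₁ y₂, y₁, 1)`, in coordinates. -/
def unipScale (y : ℝ × ℝ) (u : ℝ × ℝ × ℝ) : ℝ × ℝ × ℝ :=
  (y.1 * u.1, y.2 * u.2.1, y.1 * y.2 * u.2.2)

theorem continuous_unipScale (y : ℝ × ℝ) : Continuous (unipScale y) := by
  unfold unipScale
  fun_prop

theorem map_unipScale {y : ℝ × ℝ} (hy₁ : 0 < y.1) (hy₂ : 0 < y.2) :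
    Measure.map (unipScale y) volume = ENNReal.ofReal ((y.1 ^ 2 * y.2 ^ 2)⁻¹) • volume := by
  have hy : 0 < y.1 * y.2 := mul_pos hy₁ hy₂
  have e : unipScale y = Prod.map (y.1 * ·) (Prod.map (y.2 * ·) (y.1 * y.2 * ·)) := rfl
  rw [e, Measure.volume_eq_prod, ← Measure.map_prod_map _ _ (by fun_prop) (by fun_prop),
    Measure.volume_eq_prod, ← Measure.map_prod_map _ _ (by fun_prop) (by fun_prop),
    Real.map_volume_mul_left hy₁.ne', Real.map_volume_mul_left hy₂.ne',
    Real.map_volume_mul_left hy.ne', Measure.prod_smul_left, Measure.prod_smul_left,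
    Measure.prod_smul_right, Measure.prod_smul_right, Measure.prod_smul_right, smul_smul, smul_smul,
    ← ENNReal.ofReal_mul (by positivity), ← ENNReal.ofReal_mul (by positivity)]
  congr 2
  rw [abs_of_pos (by positivity), abs_of_pos (by positivity), abs_of_pos (by positivity)]
  field_simp

theorem integral_unipScale {y : ℝ × ℝ} (hy₁ : 0 < y.1) (hy₂ : 0 < y.2) (F : ℝ × ℝ × ℝ → ℂ) :
    ∫ x, F x = ((y.1 ^ 2 * y.2 ^ 2 : ℝ) : ℂ) * ∫ u, F (unipScale y u) := by
  have hy : 0 < y.1 * y.2 := mul_pos hy₁ hy₂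
  let e : (ℝ × ℝ × ℝ) ≃ᵐ (ℝ × ℝ × ℝ) := (MeasurableEquiv.mulLeft₀ y.1 hy₁.ne').prodCongr
    ((MeasurableEquiv.mulLeft₀ y.2 hy₂.ne').prodCongr (MeasurableEquiv.mulLeft₀ (y.1 * y.2) hy.ne'))
  have h1 : Measure.map e volume = ENNReal.ofReal ((y.1 ^ 2 * y.2 ^ 2)⁻¹) • volume :=
    map_unipScale hy₁ hy₂
  have h2 : ∫ u, F (unipScale y u) = ∫ x, F x ∂(Measure.map e volume) :=
    (integral_map_equiv e F).symm
  rw [h2, h1, integral_smul_measure, ENNReal.toReal_ofReal (by positivity), Complex.real_smul,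
    ← mul_assoc, ← Complex.ofReal_mul, mul_inv_cancel₀ (by positivity), Complex.ofReal_one, one_mul]

theorem det_unip (x : ℝ × ℝ × ℝ) : (unip x).det = 1 := by simp [unip, Matrix.det_fin_three]

theorem det_diagY (y : ℝ × ℝ) : (diagY y).det = y.1 ^ 2 * y.2 := by
  simp [diagY, Matrix.det_fin_three]; ring

/-- The spherical function on `ᵗx y` as a convolution integral over `U(ℝ)`. -/
theorem spherical_eq_convolution (μ : ℂ × ℂ) (x : ℝ × ℝ × ℝ) {y : ℝ × ℝ} (hy₁ : 0 < y.1)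
    (hy₂ : 0 < y.2) :
    spherical μ ((unip x)ᵀ * diagY y) = (1 / (2 * (Real.pi : ℂ) ^ 2))
      * (((y.1 ^ 2 * y.2 : ℝ) : ℂ) ^ (1 + μ.1) * ((y.1 ^ 2 * y.2 ^ 2 : ℝ) : ℂ)
        * (((y.1 * y.2) ^ 2 : ℝ) : ℂ) ^ (-((1 + μ.1 + 2 * μ.2) / 2))
        * (((y.1 * (y.1 * y.2)) ^ 2 : ℝ) : ℂ) ^ (-((1 + μ.1 - μ.2) / 2)))
      * ∫ u : ℝ × ℝ × ℝ, cellFn ((1 + μ.1 + 2 * μ.2) / 2) ((1 + μ.1 - μ.2) / 2) (unipMul u x)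
        * cellFn (1 - (1 + μ.1 + 2 * μ.2) / 2) (1 - (1 + μ.1 - μ.2) / 2) (unipScale y u) := by
  set a := (1 + μ.1 + 2 * μ.2) / 2
  set b := (1 + μ.1 - μ.2) / 2
  have hdY : (diagY y)ᵀ = diagY y := by
    ext i j; fin_cases i <;> fin_cases j <;> rfl
  have hdet : (diagY y * unip x).det = y.1 ^ 2 * y.2 := by
    rw [Matrix.det_mul, det_unip, det_diagY, mul_one]
  have hpos : 0 < (diagY y * unip x).det := by rw [hdet]; positivity
  -- Transposition replaces ᵗx y by y x, so that the unipotent factor stands on the right and merges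
  -- with u.
  have ht : (unip x)ᵀ * diagY y = (diagY y * unip x)ᵀ := by rw [Matrix.transpose_mul, hdY]
  have hflag : ∀ u : ℝ × ℝ × ℝ, flagFn a b ((cellRows (unipScale y u)).1 ᵥ* (diagY y * unip x))
      ((cellRows (unipScale y u)).2 ᵥ* (diagY y * unip x))
      = (((y.1 * y.2) ^ 2 : ℝ) : ℂ) ^ (-a) * (((y.1 * (y.1 * y.2)) ^ 2 : ℝ) : ℂ) ^ (-b)
        * cellFn a b (unipMul u x) := by
    intro u
    -- The rows come from w_l (y u y⁻¹) y x = (w_l y w_l⁻¹) w_l (u x), where w_l y w_l⁻¹ = diag (1,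
    -- y₁, y₁ y₂) only rescales them.
    have e1 : (cellRows (unipScale y u)).1 ᵥ* (diagY y * unip x)
        = y.1 • (cellRows (unipMul u x)).1 + (0 : ℝ) • (cellRows (unipMul u x)).2 := by
      rw [← Matrix.vecMul_vecMul]
      ext i
      fin_cases i <;> simp [cellRows, unipScale, unipMul, diagY, unip, Matrix.vecMul, dotProduct,
        Fin.sum_univ_three] <;> ring
    have e2 : (cellRows (unipScale y u)).2 ᵥ* (diagY y * unip x)
        = (y.1 * y.2) • (cellRows (unipMul u x)).2 := by
      rw [← Matrix.vecMul_vecMul]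
      ext i
      fin_cases i <;> simp [cellRows, unipScale, unipMul, diagY, unip, Matrix.vecMul, dotProduct,
        Fin.sum_univ_three] <;> ring
    rw [e1, e2, flagFn_smul_add, flagFn_cellRows]
  rw [ht, spherical_transpose μ hpos, spherical_eq_integral_cell μ hpos.ne', hdet,
    abs_of_pos (by positivity : 0 < y.1 ^ 2 * y.2), integral_const_mul,
    integral_unipScale hy₁ hy₂]
  have hint : ∀ u : ℝ × ℝ × ℝ, flagFn a b ((cellRows (unipScale y u)).1 ᵥ* (diagY y * unip x))
      ((cellRows (unipScale y u)).2 ᵥ* (diagY y * unip x)) * cellFn (1 - a) (1 - b) (unipScale y u)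
      = (((y.1 * y.2) ^ 2 : ℝ) : ℂ) ^ (-a) * (((y.1 * (y.1 * y.2)) ^ 2 : ℝ) : ℂ) ^ (-b)
        * (cellFn a b (unipMul u x) * cellFn (1 - a) (1 - b) (unipScale y u)) := by
    intro u
    rw [hflag]
    ring
  rw [integral_congr_ae (Eventually.of_forall hint), integral_const_mul]
  ring

/-! ### Jacquet's integral on the big cell, and the constant κ -/

theorem det_wLong : wLong.det = 1 := by simp [wLong, Matrix.det_fin_three]

theorem psi_unipScale (y m : ℝ × ℝ) (hy₁ : y.1 ≠ 0) (hy₂ : y.2 ≠ 0) (u : ℝ × ℝ × ℝ) :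
    psi (m.1 / y.1, m.2 / y.2) (unipScale y u) = psi m u := by
  have : m.1 / y.1 * (y.1 * u.1) + m.2 / y.2 * (y.2 * u.2.1) = m.1 * u.1 + m.2 * u.2.1 := by
    field_simp
  simp only [psi, unipScale, this]

theorem powerFn_wLong_unip_inv (μ : ℂ × ℂ) {y : ℝ × ℝ} (hy₁ : 0 < y.1) (hy₂ : 0 < y.2)
    (u : ℝ × ℝ × ℝ) :
    powerFn μ (wLong * unip u * (diagY y)⁻¹) = (((y.1 ^ 2 * y.2)⁻¹ : ℝ) : ℂ) ^ (1 + μ.1)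
      * (((y.1 * y.2)⁻¹ ^ 2 : ℝ) : ℂ) ^ (-((1 + μ.1 + 2 * μ.2) / 2))
      * (((y.1⁻¹ * (y.1 * y.2)⁻¹) ^ 2 : ℝ) : ℂ) ^ (-((1 + μ.1 - μ.2) / 2))
      * cellFn ((1 + μ.1 + 2 * μ.2) / 2) ((1 + μ.1 - μ.2) / 2) (unipScale y u) := by
  have hinv : (diagY y)⁻¹ = !![(y.1 * y.2)⁻¹, 0, 0; 0, y.1⁻¹, 0; 0, 0, 1] := by
    refine Matrix.inv_eq_right_inv ?_
    ext i j
    fin_cases i <;> fin_cases j <;>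
      simp [diagY, Matrix.mul_apply, Fin.sum_univ_three, hy₁.ne']
    field_simp
  have hdet : (wLong * unip u * (diagY y)⁻¹).det = (y.1 ^ 2 * y.2)⁻¹ := by
    rw [Matrix.det_mul, Matrix.det_mul, det_wLong, det_unip, Matrix.det_nonsing_inv, det_diagY,
      one_mul, one_mul, Ring.inverse_eq_inv']
  have hpos : 0 < (y.1 ^ 2 * y.2)⁻¹ := by positivity
  have e1 : (wLong * unip u * (diagY y)⁻¹) 1
      = y.1⁻¹ • (cellRows (unipScale y u)).1 + (0 : ℝ) • (cellRows (unipScale y u)).2 := by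
    rw [hinv]
    ext i
    fin_cases i <;> simp [cellRows, unipScale, wLong, unip, Matrix.mul_apply, Fin.sum_univ_three]
    field_simp
  have e2 : (wLong * unip u * (diagY y)⁻¹) 2
      = (y.1 * y.2)⁻¹ • (cellRows (unipScale y u)).2 := by
    rw [hinv]
    ext i
    fin_cases i <;> simp [cellRows, unipScale, wLong, unip, Matrix.mul_apply, Fin.sum_univ_three]
    · field_simp
    · field_simp
  rw [powerFn_eq μ (by rw [hdet]; exact hpos.ne'), hdet, abs_of_pos hpos, e1, e2, flagFn_smul_add,
    flagFn_cellRows]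
  ring

theorem jacquetIntegral_diagY_inv (μ : ℂ × ℂ) {y : ℝ × ℝ} (hy₁ : 0 < y.1) (hy₂ : 0 < y.2)
    (m : ℝ × ℝ) :
    jacquetIntegral (diagY y)⁻¹ μ m = (((y.1 ^ 2 * y.2)⁻¹ : ℝ) : ℂ) ^ (1 + μ.1)
      * (((y.1 * y.2)⁻¹ ^ 2 : ℝ) : ℂ) ^ (-((1 + μ.1 + 2 * μ.2) / 2))
      * (((y.1⁻¹ * (y.1 * y.2)⁻¹) ^ 2 : ℝ) : ℂ) ^ (-((1 + μ.1 - μ.2) / 2))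
      * ∫ u : ℝ × ℝ × ℝ, cellFn ((1 + μ.1 + 2 * μ.2) / 2) ((1 + μ.1 - μ.2) / 2) (unipScale y u)
        * psi m u := by
  rw [jacquetIntegral]
  simp_rw [powerFn_wLong_unip_inv μ hy₁ hy₂, mul_assoc, integral_const_mul]

theorem kappa_eq : kappa = 1 / (2 * (Real.pi : ℂ) ^ 2) := by
  have h0 : Finset.Ioi (0 : Fin 3) = {1, 2} := by decide
  have h1 : Finset.Ioi (1 : Fin 3) = {2} := by decide
  have h2 : Finset.Ioi (2 : Fin 3) = ∅ := by decide
  have hb1 : Complex.betaIntegral (1 / 2) (1 / 2) = Real.pi := by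
    rw [Complex.betaIntegral_eq_Gamma_mul_div _ _ (by norm_num) (by norm_num),
      Complex.Gamma_one_half_eq, ← Complex.cpow_add _ _ (by exact_mod_cast Real.pi_ne_zero)]
    norm_num
  have hb2 : Complex.betaIntegral (1 / 2) 1 = 2 := by
    rw [Complex.betaIntegral_eval_one_right (by norm_num)]
    norm_num
  rw [kappa, Fin.prod_univ_three, h0, h1, h2, Finset.prod_pair (by decide), Finset.prod_singleton,
    Finset.prod_empty]
  have e1 : (((1 : Fin 3) : ℕ) - ((0 : Fin 3) : ℕ) : ℂ) / 2 = 1 / 2 := by norm_num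
  have e2 : (((2 : Fin 3) : ℕ) - ((0 : Fin 3) : ℕ) : ℂ) / 2 = 1 := by norm_num
  have e3 : (((2 : Fin 3) : ℕ) - ((1 : Fin 3) : ℕ) : ℂ) / 2 = 1 / 2 := by norm_num
  rw [e1, e2, e3, hb1, hb2]
  field_simp

/-! ### Absolute convergence of integrals of q₁^(-A) q₂^(-B) -/

/-- The constant `∫ (1 + x²) ^ (-p)`. -/
def japaneseIntegral (p : ℝ) : ℝ := ∫ x : ℝ, (1 + x ^ 2) ^ (-p)

theorem integrable_one_add_sq_rpow {p : ℝ} (hp : 1 / 2 < p) :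
    Integrable fun x : ℝ => (1 + x ^ 2) ^ (-p) := by
  have := integrable_rpow_neg_one_add_norm_sq (E := ℝ) (μ := volume) (r := 2 * p)
    (by simp; linarith)
  simpa [neg_div] using this

theorem lintegral_quadratic_rpow {p α γ : ℝ} (hp : 1 / 2 < p) (hα : 0 < α) (hγ : 0 < γ) (β : ℝ) :
    ∫⁻ x : ℝ, ENNReal.ofReal ((α * (x - β) ^ 2 + γ) ^ (-p))
      = ENNReal.ofReal (japaneseIntegral p * (α ^ (-(1 / 2) : ℝ) * γ ^ (1 / 2 - p))) := by
  have hk : √(γ / α) ≠ 0 := by positivity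
  rw [lintegral_affine _ hk β (by fun_prop)]
  have h : ∀ x : ℝ, ENNReal.ofReal ((α * (√(γ / α) * x + β - β) ^ 2 + γ) ^ (-p))
      = ENNReal.ofReal (γ ^ (-p)) * ENNReal.ofReal ((1 + x ^ 2) ^ (-p)) := by
    intro x
    rw [← ENNReal.ofReal_mul (by positivity), ← Real.mul_rpow hγ.le (by positivity)]
    congr 2
    rw [add_sub_cancel_right, mul_pow, Real.sq_sqrt (by positivity)]
    field_simp
    ring
  simp_rw [h]
  rw [lintegral_const_mul _ (by fun_prop),
    ← ofReal_integral_eq_lintegral_ofReal (integrable_one_add_sq_rpow hp)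
      (Eventually.of_forall fun x => by positivity),
    ← ENNReal.ofReal_mul (by positivity), ← ENNReal.ofReal_mul (by positivity)]
  congr 1
  rw [abs_of_nonneg (by positivity), japaneseIntegral, Real.sqrt_eq_rpow, Real.div_rpow hγ.le hα.le,
    Real.rpow_sub hγ, Real.rpow_neg hα.le, Real.rpow_neg hγ.le]
  field_simp

/-- Completing the square in x₁; the remainder is a multiple of q₁, which lets the iterated integral
close up. -/
theorem q₂_eq_quadratic (x : ℝ × ℝ × ℝ) :
    q₂ x = (1 + x.2.1 ^ 2) * (x.1 - x.2.1 * x.2.2 / (1 + x.2.1 ^ 2)) ^ 2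
      + q₁ x / (1 + x.2.1 ^ 2) := by
  unfold q₁ q₂
  field_simp
  ring

theorem japaneseIntegral_nonneg (p : ℝ) : 0 ≤ japaneseIntegral p :=
  integral_nonneg fun x => by positivity

theorem measurable_q_rpow (A B : ℝ) :
    Measurable fun x : ℝ × ℝ × ℝ => q₁ x ^ (-A) * q₂ x ^ (-B) := by fun_prop

/-- Integrating over x₁, then x₃, then x₂, each step is a one-dimensional integral of (α x² +
γ)^(-p), with p equal to B, A + B - 1/2 and A in turn. -/
theorem integrable_q_rpow {A B : ℝ} (hA : 1 / 2 < A) (hB : 1 / 2 < B) :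
    Integrable fun x : ℝ × ℝ × ℝ => q₁ x ^ (-A) * q₂ x ^ (-B) := by
  have hnn : ∀ x : ℝ × ℝ × ℝ, 0 ≤ q₁ x ^ (-A) * q₂ x ^ (-B) := fun x => by
    have := q₁_pos x
    have := q₂_pos x
    positivity
  refine ⟨(measurable_q_rpow A B).aestronglyMeasurable, ?_⟩
  rw [hasFiniteIntegral_iff_ofReal (Eventually.of_forall hnn)]
  have hm : Measurable fun x : ℝ × ℝ × ℝ => ENNReal.ofReal (q₁ x ^ (-A) * q₂ x ^ (-B)) := by
    fun_prop
  rw [Measure.volume_eq_prod, lintegral_prod_symm _ hm.aemeasurable]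
  have h1 : ∀ w : ℝ × ℝ, ∫⁻ x₁ : ℝ, ENNReal.ofReal (q₁ (x₁, w) ^ (-A) * q₂ (x₁, w) ^ (-B))
      = ENNReal.ofReal (japaneseIntegral B * (1 + w.1 ^ 2) ^ (B - 1)) *
        ENNReal.ofReal ((1 * (w.2 - 0) ^ 2 + (1 + w.1 ^ 2)) ^ (-(A + B - 1 / 2))) := by
    intro w
    have hα : 0 < 1 + w.1 ^ 2 := by positivity
    have hq : 0 < 1 + w.1 ^ 2 + w.2 ^ 2 := by positivity
    have e : ∀ x₁ : ℝ, q₁ (x₁, w) = 1 + w.1 ^ 2 + w.2 ^ 2 := fun _ => rfl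
    simp_rw [q₂_eq_quadratic, e]
    simp_rw [ENNReal.ofReal_mul (Real.rpow_nonneg hq.le (-A))]
    rw [lintegral_const_mul _ (by fun_prop), lintegral_quadratic_rpow hB hα (by positivity),
      ← ENNReal.ofReal_mul (by positivity),
      ← ENNReal.ofReal_mul (mul_nonneg (japaneseIntegral_nonneg B) (by positivity))]
    congr 1
    rw [one_mul, sub_zero, add_comm (w.2 ^ 2), Real.div_rpow hq.le hα.le,
      show -(A + B - 1 / 2) = -A + (1 / 2 - B) by ring, Real.rpow_add hq,
      show B - 1 = -(1 / 2) - (1 / 2 - B) by ring, Real.rpow_sub hα (-(1 / 2))]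
    ring
  simp_rw [h1]
  rw [Measure.volume_eq_prod, lintegral_prod _ (by fun_prop)]
  have h2 : ∀ x₂ : ℝ, ∫⁻ x₃ : ℝ, ENNReal.ofReal (japaneseIntegral B * (1 + x₂ ^ 2) ^ (B - 1)) *
        ENNReal.ofReal ((1 * (x₃ - 0) ^ 2 + (1 + x₂ ^ 2)) ^ (-(A + B - 1 / 2)))
      = ENNReal.ofReal (japaneseIntegral B * japaneseIntegral (A + B - 1 / 2))
        * ENNReal.ofReal ((1 * (x₂ - 0) ^ 2 + 1) ^ (-A)) := by
    intro x₂
    have hα : 0 < 1 + x₂ ^ 2 := by positivity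
    rw [lintegral_const_mul _ (by fun_prop),
      lintegral_quadratic_rpow (by linarith) one_pos hα,
      ← ENNReal.ofReal_mul (mul_nonneg (japaneseIntegral_nonneg B) (by positivity)),
      ← ENNReal.ofReal_mul (mul_nonneg (japaneseIntegral_nonneg B) (japaneseIntegral_nonneg _))]
    congr 1
    rw [Real.one_rpow, one_mul, one_mul, sub_zero, add_comm (x₂ ^ 2),
      show -A = B - 1 + (1 / 2 - (A + B - 1 / 2)) by ring, Real.rpow_add hα]
    ring
  simp_rw [h2]
  rw [lintegral_const_mul _ (by fun_prop), lintegral_quadratic_rpow hA one_pos one_pos]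
  exact ENNReal.mul_lt_top ENNReal.ofReal_lt_top ENNReal.ofReal_lt_top

/-- The product is at most min(q₁, q₂)^(-(A + B)), and q₁ ≥ 1 + x₃², q₂ ≥ 1 + (x₃ - x₁ x₂)². Hence
the x₃-integral alone needs only A + B > 1/2, with a bound free of x₁ and x₂. -/
theorem q_rpow_le {A B : ℝ} (hA : 0 ≤ A) (hB : 0 ≤ B) (x : ℝ × ℝ × ℝ) :
    q₁ x ^ (-A) * q₂ x ^ (-B) ≤ (1 * (x.2.2 - 0) ^ 2 + 1) ^ (-(A + B))
      + (1 * (x.2.2 - x.1 * x.2.1) ^ 2 + 1) ^ (-(A + B)) := by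
  have h1 : 1 * (x.2.2 - 0) ^ 2 + 1 ≤ q₁ x := by unfold q₁; nlinarith [sq_nonneg x.2.1]
  have h2 : 1 * (x.2.2 - x.1 * x.2.1) ^ 2 + 1 ≤ q₂ x := by unfold q₂; nlinarith [sq_nonneg x.1]
  have p1 : 0 < 1 * (x.2.2 - 0) ^ 2 + 1 := by positivity
  have p2 : 0 < 1 * (x.2.2 - x.1 * x.2.1) ^ 2 + 1 := by positivity
  have hq1 := q₁_pos x
  have hq2 := q₂_pos x
  have hAB : -(A + B) ≤ 0 := by linarith
  rcases le_total (q₁ x) (q₂ x) with h | h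
  · have : q₂ x ^ (-B) ≤ q₁ x ^ (-B) := Real.rpow_le_rpow_of_nonpos hq1 h (by linarith)
    calc q₁ x ^ (-A) * q₂ x ^ (-B) ≤ q₁ x ^ (-A) * q₁ x ^ (-B) := by gcongr
      _ = q₁ x ^ (-(A + B)) := by rw [← Real.rpow_add hq1]; ring_nf
      _ ≤ (1 * (x.2.2 - 0) ^ 2 + 1) ^ (-(A + B)) := Real.rpow_le_rpow_of_nonpos p1 h1 hAB
      _ ≤ _ := le_add_of_nonneg_right (by positivity)
  · have : q₁ x ^ (-A) ≤ q₂ x ^ (-A) := Real.rpow_le_rpow_of_nonpos hq2 h (by linarith)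
    calc q₁ x ^ (-A) * q₂ x ^ (-B) ≤ q₂ x ^ (-A) * q₂ x ^ (-B) := by gcongr
      _ = q₂ x ^ (-(A + B)) := by rw [← Real.rpow_add hq2]; ring_nf
      _ ≤ (1 * (x.2.2 - x.1 * x.2.1) ^ 2 + 1) ^ (-(A + B)) :=
        Real.rpow_le_rpow_of_nonpos p2 h2 hAB
      _ ≤ _ := le_add_of_nonneg_left (by positivity)

theorem lintegral_q_rpow_le {A B : ℝ} (hA : 0 ≤ A) (hB : 0 ≤ B) (hAB : 1 / 2 < A + B)
    (x₁ x₂ : ℝ) :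
    ∫⁻ x₃ : ℝ, ENNReal.ofReal (q₁ (x₁, x₂, x₃) ^ (-A) * q₂ (x₁, x₂, x₃) ^ (-B))
      ≤ ENNReal.ofReal (2 * japaneseIntegral (A + B)) := by
  calc _ ≤ ∫⁻ x₃ : ℝ, (ENNReal.ofReal ((1 * (x₃ - 0) ^ 2 + 1) ^ (-(A + B)))
        + ENNReal.ofReal ((1 * (x₃ - x₁ * x₂) ^ 2 + 1) ^ (-(A + B)))) := by
        refine lintegral_mono fun x₃ => ?_
        rw [← ENNReal.ofReal_add (by positivity) (by positivity)]
        exact ENNReal.ofReal_le_ofReal (q_rpow_le hA hB (x₁, x₂, x₃))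
    _ = _ := by
        rw [lintegral_add_left (by fun_prop), lintegral_quadratic_rpow hAB one_pos one_pos,
          lintegral_quadratic_rpow hAB one_pos one_pos,
          ← ENNReal.ofReal_add (by have := japaneseIntegral_nonneg (A + B); positivity)
            (by have := japaneseIntegral_nonneg (A + B); positivity)]
        congr 1
        rw [Real.one_rpow, Real.one_rpow]
        ring

/-- The bound sees only the lengths of the intervals, so it is the same for all translates of a
slab. -/
theorem lintegral_slab_q_rpow_le {A B : ℝ} (hA : 0 ≤ A) (hB : 0 ≤ B) (hAB : 1 / 2 < A + B)
    (I₁ I₂ : Set ℝ) :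
    ∫⁻ x in I₁ ×ˢ I₂ ×ˢ (Set.univ : Set ℝ), ENNReal.ofReal (q₁ x ^ (-A) * q₂ x ^ (-B))
      ≤ ENNReal.ofReal (2 * japaneseIntegral (A + B)) * (volume I₁ * volume I₂) := by
  have hm : Measurable fun x : ℝ × ℝ × ℝ => ENNReal.ofReal (q₁ x ^ (-A) * q₂ x ^ (-B)) := by
    fun_prop
  rw [Measure.volume_eq_prod, Measure.volume_eq_prod, ← Measure.prod_restrict,
    ← Measure.prod_restrict, Measure.restrict_univ, lintegral_prod _ hm.aemeasurable]
  calc _ ≤ ∫⁻ _ in I₁, ENNReal.ofReal (2 * japaneseIntegral (A + B)) * volume I₂ := by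
        refine lintegral_mono fun x₁ => ?_
        have hm1 := hm.comp (measurable_prodMk_left (x := x₁))
        dsimp only [Function.comp_def] at hm1
        rw [lintegral_prod _ hm1.aemeasurable]
        calc _ ≤ ∫⁻ _ in I₂, ENNReal.ofReal (2 * japaneseIntegral (A + B)) :=
              lintegral_mono fun x₂ => lintegral_q_rpow_le hA hB hAB x₁ x₂
          _ = _ := by simp
    _ = _ := by simp; ring

theorem integrableOn_slab_q_rpow {A B : ℝ} (hA : 0 ≤ A) (hB : 0 ≤ B) (hAB : 1 / 2 < A + B)
    {I₁ I₂ : Set ℝ} (h₁ : volume I₁ ≠ ⊤) (h₂ : volume I₂ ≠ ⊤) :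
    IntegrableOn (fun x : ℝ × ℝ × ℝ => q₁ x ^ (-A) * q₂ x ^ (-B))
      (I₁ ×ˢ I₂ ×ˢ (Set.univ : Set ℝ)) := by
  have hnn : ∀ x : ℝ × ℝ × ℝ, 0 ≤ q₁ x ^ (-A) * q₂ x ^ (-B) := fun x => by
    have := q₁_pos x
    have := q₂_pos x
    positivity
  refine ⟨(measurable_q_rpow A B).aestronglyMeasurable, ?_⟩
  rw [hasFiniteIntegral_iff_ofReal (Eventually.of_forall hnn)]
  refine (lintegral_slab_q_rpow_le hA hB hAB I₁ I₂).trans_lt ?_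
  exact ENNReal.mul_lt_top ENNReal.ofReal_lt_top (ENNReal.mul_lt_top h₁.lt_top h₂.lt_top)

/-! ### Mellin representation by Gaussians -/

/-- The open positive quadrant. -/
def quadrant : Set (ℝ × ℝ) := Set.Ioi 0 ×ˢ Set.Ioi 0

theorem measurableSet_quadrant : MeasurableSet quadrant := measurableSet_Ioi.prod measurableSet_Ioi

theorem volume_restrict_quadrant : (volume : Measure (ℝ × ℝ)).restrict quadrant
    = ((volume : Measure ℝ).restrict (Set.Ioi 0)).prod (volume.restrict (Set.Ioi 0)) := by
  rw [Measure.prod_restrict, ← Measure.volume_eq_prod, quadrant]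

/-- The Gaussian kernel in the Mellin representation of `cellFn`. -/
def cellKernel (p : ℝ × ℝ) (x : ℝ × ℝ × ℝ) : ℝ :=
  Real.exp (-(Real.pi * (p.1 * q₁ x + p.2 * q₂ x)))

theorem cellKernel_eq (p : ℝ × ℝ) (x : ℝ × ℝ × ℝ) : cellKernel p x
    = Real.exp (-(Real.pi * q₁ x * p.1)) * Real.exp (-(Real.pi * q₂ x * p.2)) := by
  rw [cellKernel, ← Real.exp_add]
  congr 1
  ring

theorem integrableOn_rpow_mul_exp {A r : ℝ} (hA : 0 < A) (hr : 0 < r) :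
    IntegrableOn (fun t : ℝ => t ^ (A - 1) * Real.exp (-(r * t))) (Set.Ioi 0) := by
  have := integrableOn_rpow_mul_exp_neg_mul_rpow (p := 1) (s := A - 1) (by linarith) one_pos hr
  simpa using this

theorem integral_rpow_mul_exp {A r : ℝ} (hA : 0 < A) (hr : 0 < r) :
    ∫ t in Set.Ioi (0 : ℝ), t ^ (A - 1) * Real.exp (-(r * t)) = r ^ (-A) * Real.Gamma A := by
  rw [Real.integral_rpow_mul_exp_neg_mul_Ioi hA hr, one_div, Real.inv_rpow hr.le,
    Real.rpow_neg hr.le]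

theorem integral_cpow_mul_exp {a : ℂ} {r : ℝ} (ha : 0 < a.re) (hr : 0 < r) :
    ∫ t in Set.Ioi (0 : ℝ), (t : ℂ) ^ (a - 1) * (Real.exp (-(r * t)) : ℂ)
      = (r : ℂ) ^ (-a) * Complex.Gamma a := by
  have h := Complex.integral_cpow_mul_exp_neg_mul_Ioi ha hr
  rw [one_div, Complex.inv_cpow _ _ (by rw [Complex.arg_ofReal_of_nonneg hr.le]; exact Real.pi_pos.ne),
    ← Complex.cpow_neg] at h
  rw [← h]
  refine integral_congr_ae (Eventually.of_forall fun t => ?_)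
  simp

theorem aestronglyMeasurable_quadrant_cpow (a b : ℂ) :
    Measurable fun p : ℝ × ℝ => (p.1 : ℂ) ^ a * (p.2 : ℂ) ^ b := by fun_prop

theorem norm_quadrant_cpow {p : ℝ × ℝ} (hp : p ∈ quadrant) (a b : ℂ) :
    ‖(p.1 : ℂ) ^ (a - 1) * (p.2 : ℂ) ^ (b - 1)‖ = p.1 ^ (a.re - 1) * p.2 ^ (b.re - 1) := by
  rw [norm_mul, norm_ofReal_cpow hp.1, norm_ofReal_cpow hp.2, Complex.sub_re, Complex.sub_re,
    Complex.one_re]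

theorem integrableOn_quadrant_mul {f g : ℝ → ℝ} (hf : IntegrableOn f (Set.Ioi 0))
    (hg : IntegrableOn g (Set.Ioi 0)) : IntegrableOn (fun p : ℝ × ℝ => f p.1 * g p.2) quadrant := by
  rw [IntegrableOn, volume_restrict_quadrant]
  exact hf.mul_prod hg

theorem integral_quadrant_rpow_cellKernel {A B : ℝ} (hA : 0 < A) (hB : 0 < B) (x : ℝ × ℝ × ℝ) :
    ∫ p in quadrant, p.1 ^ (A - 1) * p.2 ^ (B - 1) * cellKernel p x
      = Real.pi ^ (-A) * Real.pi ^ (-B) * (Real.Gamma A * Real.Gamma B)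
        * (q₁ x ^ (-A) * q₂ x ^ (-B)) := by
  have h1 := q₁_pos x
  have h2 := q₂_pos x
  have e : ∀ p : ℝ × ℝ, p.1 ^ (A - 1) * p.2 ^ (B - 1) * cellKernel p x
      = (p.1 ^ (A - 1) * Real.exp (-(Real.pi * q₁ x * p.1)))
        * (p.2 ^ (B - 1) * Real.exp (-(Real.pi * q₂ x * p.2))) := by
    intro p
    rw [cellKernel_eq]
    ring
  simp_rw [e]
  rw [volume_restrict_quadrant,
    integral_prod_mul (fun t : ℝ => t ^ (A - 1) * Real.exp (-(Real.pi * q₁ x * t)))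
      (fun s : ℝ => s ^ (B - 1) * Real.exp (-(Real.pi * q₂ x * s))),
    integral_rpow_mul_exp hA (by positivity), integral_rpow_mul_exp hB (by positivity),
    Real.mul_rpow Real.pi_pos.le h1.le, Real.mul_rpow Real.pi_pos.le h2.le]
  ring

theorem integrableOn_quadrant_rpow_cellKernel {A B : ℝ} (hA : 0 < A) (hB : 0 < B)
    (x : ℝ × ℝ × ℝ) :
    IntegrableOn (fun p : ℝ × ℝ => p.1 ^ (A - 1) * p.2 ^ (B - 1) * cellKernel p x) quadrant := by
  have h1 := q₁_pos x
  have h2 := q₂_pos x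
  have := integrableOn_quadrant_mul (integrableOn_rpow_mul_exp hA (by positivity : 0 < Real.pi * q₁ x))
    (integrableOn_rpow_mul_exp hB (by positivity : 0 < Real.pi * q₂ x))
  refine this.congr (Eventually.of_forall fun p => ?_)
  simp only [cellKernel_eq]
  ring

theorem integral_quadrant_cpow_cellKernel {a b : ℂ} (ha : 0 < a.re) (hb : 0 < b.re)
    (x : ℝ × ℝ × ℝ) :
    ∫ p in quadrant, (p.1 : ℂ) ^ (a - 1) * (p.2 : ℂ) ^ (b - 1) * (cellKernel p x : ℂ)
      = (Real.pi : ℂ) ^ (-(a + b)) * (Complex.Gamma a * Complex.Gamma b) * cellFn a b x := by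
  have h1 := q₁_pos x
  have h2 := q₂_pos x
  have e : ∀ p : ℝ × ℝ, (p.1 : ℂ) ^ (a - 1) * (p.2 : ℂ) ^ (b - 1) * (cellKernel p x : ℂ)
      = ((p.1 : ℂ) ^ (a - 1) * (Real.exp (-(Real.pi * q₁ x * p.1)) : ℂ))
        * ((p.2 : ℂ) ^ (b - 1) * (Real.exp (-(Real.pi * q₂ x * p.2)) : ℂ)) := by
    intro p
    rw [cellKernel_eq, Complex.ofReal_mul]
    ring
  simp_rw [e]
  rw [volume_restrict_quadrant,
    integral_prod_mul (fun t : ℝ => (t : ℂ) ^ (a - 1) * (Real.exp (-(Real.pi * q₁ x * t)) : ℂ))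
      (fun s : ℝ => (s : ℂ) ^ (b - 1) * (Real.exp (-(Real.pi * q₂ x * s)) : ℂ)),
    integral_cpow_mul_exp ha (by positivity), integral_cpow_mul_exp hb (by positivity),
    Complex.ofReal_mul, Complex.ofReal_mul,
    Complex.mul_cpow_ofReal_nonneg Real.pi_pos.le h1.le,
    Complex.mul_cpow_ofReal_nonneg Real.pi_pos.le h2.le, cellFn, neg_add,
    Complex.cpow_add _ _ (by exact_mod_cast Real.pi_ne_zero)]
  ring

theorem norm_psi (m : ℝ × ℝ) (x : ℝ × ℝ × ℝ) : ‖psi m x‖ = 1 := by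
  rw [psi, show 2 * (Real.pi : ℂ) * Complex.I * ((m.1 * x.1 + m.2 * x.2.1 : ℝ) : ℂ)
    = ((2 * Real.pi * (m.1 * x.1 + m.2 * x.2.1) : ℝ) : ℂ) * Complex.I by push_cast; ring,
    Complex.norm_exp_ofReal_mul_I]

@[fun_prop]
theorem continuous_psi (m : ℝ × ℝ) : Continuous (psi m) := by unfold psi; fun_prop

/-- The Fourier integral of the Gaussian kernel over a part of `U(ℝ)`. -/
def cellFourier (S : Set (ℝ × ℝ × ℝ)) (m : ℝ × ℝ) (p : ℝ × ℝ) : ℂ :=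
  ∫ x in S, (cellKernel p x : ℂ) * psi m x

@[fun_prop]
theorem continuous_cellKernel : Continuous fun w : (ℝ × ℝ) × (ℝ × ℝ × ℝ) => cellKernel w.1 w.2 := by
  unfold cellKernel q₁ q₂
  fun_prop

theorem cellKernel_pos (p : ℝ × ℝ) (x : ℝ × ℝ × ℝ) : 0 < cellKernel p x := Real.exp_pos _

/-- The Fourier integral of `cellFn` as a Mellin transform. -/
theorem setIntegral_cellFn_mul_psi {a b : ℂ} (ha : 0 < a.re) (hb : 0 < b.re)
    {S : Set (ℝ × ℝ × ℝ)}
    (hS : IntegrableOn (fun x : ℝ × ℝ × ℝ => q₁ x ^ (-a.re) * q₂ x ^ (-b.re)) S) (m : ℝ × ℝ) :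
    (Real.pi : ℂ) ^ (-(a + b)) * (Complex.Gamma a * Complex.Gamma b)
        * ∫ x in S, cellFn a b x * psi m x
      = ∫ p in quadrant, (p.1 : ℂ) ^ (a - 1) * (p.2 : ℂ) ^ (b - 1) * cellFourier S m p := by
  have hmeas : Measurable fun w : (ℝ × ℝ × ℝ) × (ℝ × ℝ) =>
      (w.2.1 : ℂ) ^ (a - 1) * (w.2.2 : ℂ) ^ (b - 1) * ((cellKernel w.2 w.1 : ℂ) * psi m w.1) := by
    have h1 : Measurable fun w : (ℝ × ℝ × ℝ) × (ℝ × ℝ) => cellKernel w.2 w.1 :=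
      (continuous_cellKernel.comp continuous_swap).measurable
    have h2 : Measurable fun w : (ℝ × ℝ × ℝ) × (ℝ × ℝ) => psi m w.1 :=
      ((continuous_psi m).comp continuous_fst).measurable
    fun_prop
  -- The modulus of the integrand is the Mellin integrand for the real parts of a and b, so Fubini
  -- requires exactly the integrability `hS`.
  have hnorm : ∀ (x : ℝ × ℝ × ℝ) (p : ℝ × ℝ), p ∈ quadrant →
      ‖(p.1 : ℂ) ^ (a - 1) * (p.2 : ℂ) ^ (b - 1) * ((cellKernel p x : ℂ) * psi m x)‖
      = p.1 ^ (a.re - 1) * p.2 ^ (b.re - 1) * cellKernel p x := by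
    intro x p hp
    rw [norm_mul, norm_quadrant_cpow hp, norm_mul, norm_psi, mul_one, Complex.norm_real,
      Real.norm_of_nonneg (cellKernel_pos p x).le]
  have hint : Integrable (Function.uncurry fun (x : ℝ × ℝ × ℝ) (p : ℝ × ℝ) =>
      (p.1 : ℂ) ^ (a - 1) * (p.2 : ℂ) ^ (b - 1) * ((cellKernel p x : ℂ) * psi m x))
      ((volume.restrict S).prod (volume.restrict quadrant)) := by
    refine (integrable_prod_iff hmeas.aestronglyMeasurable).mpr ⟨Eventually.of_forall fun x => ?_, ?_⟩
    · refine (integrable_norm_iff (hmeas.comp measurable_prodMk_left).aestronglyMeasurable).mp ?_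
      refine (integrableOn_quadrant_rpow_cellKernel ha hb x).congr ?_
      filter_upwards [ae_restrict_mem measurableSet_quadrant] with p hp
      exact (hnorm x p hp).symm
    · have e : ∀ x : ℝ × ℝ × ℝ, ∫ p in quadrant,
          ‖(p.1 : ℂ) ^ (a - 1) * (p.2 : ℂ) ^ (b - 1) * ((cellKernel p x : ℂ) * psi m x)‖
          = Real.pi ^ (-a.re) * Real.pi ^ (-b.re) * (Real.Gamma a.re * Real.Gamma b.re)
            * (q₁ x ^ (-a.re) * q₂ x ^ (-b.re)) := by
        intro x
        rw [← integral_quadrant_rpow_cellKernel ha hb x]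
        exact setIntegral_congr_fun measurableSet_quadrant fun p hp => hnorm x p hp
      simp only [e]
      exact hS.const_mul _
  have h := integral_integral_swap hint
  have e1 : ∀ x : ℝ × ℝ × ℝ, ∫ p in quadrant,
      (p.1 : ℂ) ^ (a - 1) * (p.2 : ℂ) ^ (b - 1) * ((cellKernel p x : ℂ) * psi m x)
      = (Real.pi : ℂ) ^ (-(a + b)) * (Complex.Gamma a * Complex.Gamma b)
        * (cellFn a b x * psi m x) := by
    intro x
    simp_rw [← mul_assoc]
    rw [integral_mul_const, integral_quadrant_cpow_cellKernel ha hb x]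
    ring
  simp_rw [e1, integral_const_mul] at h
  exact h

/-! ### Superposition of indicators and its total mass -/

/-- The additive character `x ↦ e (m x)`. -/
def echar (m x : ℝ) : ℂ := Complex.exp (((2 * Real.pi * m : ℝ) : ℂ) * Complex.I * (x : ℂ))

@[fun_prop]
theorem continuous_echar (m : ℝ) : Continuous (echar m) := by unfold echar; fun_prop

theorem norm_echar (m x : ℝ) : ‖echar m x‖ = 1 := by
  rw [echar, show ((2 * Real.pi * m : ℝ) : ℂ) * Complex.I * (x : ℂ)
    = ((2 * Real.pi * m * x : ℝ) : ℂ) * Complex.I by push_cast; ring, Complex.norm_exp_ofReal_mul_I]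

theorem psi_eq_echar (m : ℝ × ℝ) (x : ℝ × ℝ × ℝ) : psi m x = echar m.1 x.1 * echar m.2 x.2.1 := by
  rw [psi, echar, echar, ← Complex.exp_add]
  congr 1
  push_cast
  ring

theorem norm_integral_echar_le {m : ℝ} (hm : m ≠ 0) (α β : ℝ) :
    ‖∫ x in Set.Icc α β, echar m x‖ ≤ 1 / (Real.pi * |m|) := by
  have hpos : 0 < Real.pi * |m| := mul_pos Real.pi_pos (abs_pos.mpr hm)
  rcases le_or_gt α β with h | h
  · have hc : ((2 * Real.pi * m : ℝ) : ℂ) * Complex.I ≠ 0 := by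
      refine mul_ne_zero ?_ Complex.I_ne_zero
      exact_mod_cast mul_ne_zero Real.two_pi_pos.ne' hm
    rw [integral_Icc_eq_integral_Ioc, ← intervalIntegral.integral_of_le h]
    simp only [echar]
    rw [integral_exp_mul_complex hc, norm_div]
    have h1 : ‖((2 * Real.pi * m : ℝ) : ℂ) * Complex.I‖ = 2 * (Real.pi * |m|) := by
      rw [norm_mul, Complex.norm_I, mul_one, Complex.norm_real, Real.norm_eq_abs, abs_mul,
        abs_of_pos Real.two_pi_pos]
      ring
    rw [h1, div_le_div_iff₀ (by positivity) hpos]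
    have h2 := norm_sub_le (echar m β) (echar m α)
    rw [norm_echar, norm_echar] at h2
    simp only [echar] at h2
    nlinarith
  · rw [Set.Icc_eq_empty (not_le.mpr h)]
    simp
    positivity

/-- The condition x² < r cuts out an interval, and the integral of a nontrivial character over any
interval is bounded independently of the endpoints. -/
theorem norm_integral_indicator_echar_le {m : ℝ} (hm : m ≠ 0) (α β r : ℝ) :
    ‖∫ x in Set.Icc α β, {x : ℝ | x ^ 2 < r}.indicator (echar m) x‖ ≤ 1 / (Real.pi * |m|) := by
  have hs : {x : ℝ | x ^ 2 < r} = Set.Ioo (-√r) (√r) := by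
    ext x
    exact Real.sq_lt
  rw [hs, setIntegral_indicator measurableSet_Ioo]
  have h : (Set.Icc α β ∩ Set.Ioo (-√r) (√r) : Set ℝ) =ᵐ[volume]
      (Set.Icc α β ∩ Set.Icc (-√r) (√r) : Set ℝ) :=
    (ae_eq_refl _).inter Ioo_ae_eq_Icc
  rw [setIntegral_congr_set h, Set.Icc_inter_Icc]
  exact norm_integral_echar_le hm _ _

theorem integrableOn_linear_mul_exp {l : ℝ} (hl : 0 < l) (A B : ℝ) :
    IntegrableOn (fun y : ℝ => (A + B * y) * Real.exp (-(l * y))) (Set.Ioi 0) := by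
  have h1 := (integrableOn_rpow_mul_exp one_pos hl).const_mul A
  have h2 := (integrableOn_rpow_mul_exp two_pos hl).const_mul B
  refine (h1.add h2).congr (Eventually.of_forall fun y => ?_)
  have : (2 : ℝ) - 1 = 1 := by norm_num
  simp only [Pi.add_apply, sub_self, Real.rpow_zero, this, Real.rpow_one]
  ring

theorem integral_linear_mul_exp {l : ℝ} (hl : 0 < l) (u v : ℝ) {Y : ℝ} (hY : 0 ≤ Y) :
    ∫ y in Set.Ioi Y, ((u + v * y) * l - v) * Real.exp (-(l * y))
      = (u + v * Y) * Real.exp (-(l * Y)) := by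
  have hsub : Set.Ioi Y ⊆ Set.Ioi 0 := Set.Ioi_subset_Ioi hY
  have hd : ∀ y : ℝ, HasDerivAt (fun y => -((u + v * y) * Real.exp (-(l * y))))
      (((u + v * y) * l - v) * Real.exp (-(l * y))) y := by
    intro y
    have h1 : HasDerivAt (fun y : ℝ => u + v * y) v y := by
      simpa using ((hasDerivAt_id y).const_mul v).const_add u
    have h2 : HasDerivAt (fun y : ℝ => Real.exp (-(l * y))) (Real.exp (-(l * y)) * (-l)) y := by
      have : HasDerivAt (fun y : ℝ => -(l * y)) (-l) y := by
        simpa using ((hasDerivAt_id y).const_mul l).fun_neg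
      exact this.exp
    convert! (h1.mul h2).neg using 1
    ring
  have hi : IntegrableOn (fun y => ((u + v * y) * l - v) * Real.exp (-(l * y))) (Set.Ioi Y) := by
    refine ((integrableOn_linear_mul_exp hl (u * l - v) (v * l)).mono_set hsub).congr
      (Eventually.of_forall fun y => ?_)
    ring
  have hi' : IntegrableOn (fun y => -((u + v * y) * Real.exp (-(l * y)))) (Set.Ioi Y) :=
    ((integrableOn_linear_mul_exp hl u v).mono_set hsub).neg
  have ht := tendsto_zero_of_hasDerivAt_of_integrableOn_Ioi (fun y _ => hd y) hi hi'
  rw [integral_Ioi_of_hasDerivAt_of_tendsto' (fun y _ => hd y) hi ht]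
  ring

/-- The density which represents `exp (-π (s X + t Y + q X Y))` as a superposition of indicator
functions. -/
def mixDensity (s t q : ℝ) (w : ℝ × ℝ) : ℝ :=
  (Real.pi ^ 2 * (s + q * w.2) * (t + q * w.1) - Real.pi * q)
    * Real.exp (-(Real.pi * (s * w.1 + t * w.2 + q * (w.1 * w.2))))

theorem measurable_mixDensity (s t q : ℝ) : Measurable (mixDensity s t q) := by
  unfold mixDensity
  fun_prop

theorem integrableOn_mixDensity {s t q : ℝ} (hs : 0 < s) (ht : 0 < t) (hq : 0 < q) :
    IntegrableOn (mixDensity s t q) quadrant := by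
  have hps : 0 < Real.pi * s := by positivity
  have hpt : 0 < Real.pi * t := by positivity
  have h1 := integrableOn_quadrant_mul (integrableOn_linear_mul_exp hps t q)
    (integrableOn_linear_mul_exp hpt s q)
  have h2 := integrableOn_quadrant_mul (integrableOn_linear_mul_exp hps 1 0)
    (integrableOn_linear_mul_exp hpt 1 0)
  refine Integrable.mono' ((h1.const_mul (Real.pi ^ 2)).add (h2.const_mul (Real.pi * q)))
    (measurable_mixDensity s t q).aestronglyMeasurable ?_
  filter_upwards [ae_restrict_mem measurableSet_quadrant] with w hw
  have hw1 : 0 < w.1 := hw.1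
  have hw2 : 0 < w.2 := hw.2
  have he : Real.exp (-(Real.pi * (s * w.1 + t * w.2 + q * (w.1 * w.2))))
      ≤ Real.exp (-(Real.pi * s * w.1)) * Real.exp (-(Real.pi * t * w.2)) := by
    rw [← Real.exp_add, Real.exp_le_exp]
    have : 0 ≤ Real.pi * (q * (w.1 * w.2)) := by positivity
    nlinarith
  have hab : |Real.pi ^ 2 * (s + q * w.2) * (t + q * w.1) - Real.pi * q|
      ≤ Real.pi ^ 2 * (s + q * w.2) * (t + q * w.1) + Real.pi * q := by
    refine (abs_sub _ _).trans (le_of_eq ?_)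
    rw [abs_of_pos (by positivity), abs_of_pos (by positivity)]
  rw [mixDensity, Real.norm_eq_abs, abs_mul, abs_of_pos (Real.exp_pos _)]
  refine (mul_le_mul hab he (Real.exp_pos _).le (by positivity)).trans (le_of_eq ?_)
  simp only [Pi.add_apply]
  ring

/-- `mixDensity` is the mixed derivative ∂²/∂X∂Y of the right-hand side, which vanishes at infinity.
-/
theorem integral_mixDensity {s t q : ℝ} (hs : 0 < s) (ht : 0 < t) (hq : 0 < q) {X Y : ℝ}
    (hX : 0 ≤ X) (hY : 0 ≤ Y) :
    ∫ w in Set.Ioi X ×ˢ Set.Ioi Y, mixDensity s t q w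
      = Real.exp (-(Real.pi * (s * X + t * Y + q * (X * Y)))) := by
  have hsub : Set.Ioi X ×ˢ Set.Ioi Y ⊆ quadrant :=
    Set.prod_mono (Set.Ioi_subset_Ioi hX) (Set.Ioi_subset_Ioi hY)
  rw [Measure.volume_eq_prod, setIntegral_prod _ ((integrableOn_mixDensity hs ht hq).mono_set hsub)]
  have hin : ∀ r ∈ Set.Ioi X, ∫ y in Set.Ioi Y, mixDensity s t q (r, y)
      = Real.exp (-(Real.pi * t * Y))
        * (((1 + 0 * r) * (Real.pi * s + Real.pi * q * Y) - 0)
          * Real.exp (-((Real.pi * s + Real.pi * q * Y) * r))) := by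
    intro r hr
    have hr0 : 0 < r := hX.trans_lt hr
    have h := integral_linear_mul_exp (by positivity : 0 < Real.pi * (t + q * r)) (Real.pi * s)
      (Real.pi * q) hY
    have e : ∀ y, mixDensity s t q (r, y) = Real.exp (-(Real.pi * s * r))
        * (((Real.pi * s + Real.pi * q * y) * (Real.pi * (t + q * r)) - Real.pi * q)
          * Real.exp (-(Real.pi * (t + q * r) * y))) := by
      intro y
      rw [mixDensity, show -(Real.pi * (s * r + t * y + q * (r * y)))
        = -(Real.pi * s * r) + -(Real.pi * (t + q * r) * y) by ring, Real.exp_add]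
      ring
    simp_rw [e]
    rw [integral_const_mul, h, show -(Real.pi * (t + q * r) * Y)
      = -(Real.pi * t * Y) + -(Real.pi * q * Y * r) by ring, Real.exp_add,
      show -((Real.pi * s + Real.pi * q * Y) * r)
        = -(Real.pi * s * r) + -(Real.pi * q * Y * r) by ring, Real.exp_add]
    ring
  rw [setIntegral_congr_fun measurableSet_Ioi hin, integral_const_mul,
    integral_linear_mul_exp (by positivity) 1 0 hX, zero_mul, add_zero, one_mul, ← Real.exp_add]
  congr 1
  ring

theorem exp_neg_pi_mul_le_rpow {δ z : ℝ} (hδ : 0 < δ) (hδ' : δ < 1) (hz : 0 < z) :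
    Real.exp (-(Real.pi * z)) ≤ z ^ (δ - 1) := by
  have h1 : z ^ (1 - δ) ≤ Real.exp (Real.pi * z) := by
    have h2 : z ^ (1 - δ) ≤ 1 + z := by
      rcases le_total z 1 with h | h
      · have := Real.rpow_le_one hz.le h (by linarith : 0 ≤ 1 - δ)
        linarith
      · have := Real.rpow_le_rpow_of_exponent_le h (by linarith : 1 - δ ≤ 1)
        rw [Real.rpow_one] at this
        linarith
    have h3 := Real.add_one_le_exp (Real.pi * z)
    nlinarith [Real.pi_gt_three]
  rw [show δ - 1 = -(1 - δ) by ring, Real.rpow_neg hz.le, Real.exp_neg]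
  exact inv_anti₀ (by positivity) h1

/-- The mass of the mixing density of the kernel with parameters `t`, `s`. -/
theorem integral_abs_mixDensity_le {s t δ : ℝ} (hs : 0 < s) (ht : 0 < t) (hδ : 0 < δ)
    (hδ' : δ < 1) :
    ∫ w in quadrant, |mixDensity s t (t * s / (t + s)) w|
      ≤ 1 + 2 * Real.pi * (Real.pi ^ (-δ) * Real.Gamma δ) ^ 2 * (t + s) ^ (-δ) := by
  set q := t * s / (t + s) with hqd
  have hq : 0 < q := by positivity
  have hps : 0 < Real.pi * s := by positivity
  have hpt : 0 < Real.pi * t := by positivity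
  have h0 := integral_mixDensity hs ht hq le_rfl le_rfl
  have hD := integrableOn_mixDensity hs ht hq
  have hP := integrableOn_quadrant_mul (integrableOn_rpow_mul_exp hδ hps)
    (integrableOn_rpow_mul_exp hδ hpt)
  have hPi : ∫ w in quadrant, w.1 ^ (δ - 1) * Real.exp (-(Real.pi * s * w.1))
      * (w.2 ^ (δ - 1) * Real.exp (-(Real.pi * t * w.2)))
      = (Real.pi ^ (-δ) * Real.Gamma δ) ^ 2 * (s ^ (-δ) * t ^ (-δ)) := by
    rw [volume_restrict_quadrant,
      integral_prod_mul (fun r : ℝ => r ^ (δ - 1) * Real.exp (-(Real.pi * s * r)))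
        (fun y : ℝ => y ^ (δ - 1) * Real.exp (-(Real.pi * t * y))),
      integral_rpow_mul_exp hδ hps, integral_rpow_mul_exp hδ hpt,
      Real.mul_rpow Real.pi_pos.le hs.le, Real.mul_rpow Real.pi_pos.le ht.le]
    ring
  calc ∫ w in quadrant, |mixDensity s t q w|
      ≤ ∫ w in quadrant, (mixDensity s t q w + 2 * Real.pi * q ^ δ
        * (w.1 ^ (δ - 1) * Real.exp (-(Real.pi * s * w.1))
      * (w.2 ^ (δ - 1) * Real.exp (-(Real.pi * t * w.2))))) := by
        refine setIntegral_mono_on hD.abs (hD.add (hP.const_mul _)) measurableSet_quadrant ?_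
        intro w hw
        have hw1 : 0 < w.1 := hw.1
        have hw2 : 0 < w.2 := hw.2
        set E := Real.exp (-(Real.pi * (s * w.1 + t * w.2 + q * (w.1 * w.2)))) with hE
        have hE0 : 0 < E := Real.exp_pos _
        -- Only the term -πqE of the density is negative, so |D| ≤ D + 2πqE, and D has integral 1 by
        -- `integral_mixDensity` at X = Y = 0.
        have h1 : |mixDensity s t q w| ≤ mixDensity s t q w + 2 * Real.pi * (q * E) := by
          have : mixDensity s t q w
              = Real.pi ^ 2 * (s + q * w.2) * (t + q * w.1) * E - Real.pi * q * E := by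
            rw [mixDensity, hE]; ring
          rw [this, abs_le]
          have p1 : 0 < Real.pi ^ 2 * (s + q * w.2) * (t + q * w.1) * E := by positivity
          have p2 : 0 < Real.pi * q * E := by positivity
          constructor <;> nlinarith
        -- Bounding exp (-πqXY) by (qXY)^(δ - 1) separates the variables and leaves two Gamma
        -- integrals.
        have h2 : q * E ≤ q ^ δ * (w.1 ^ (δ - 1) * Real.exp (-(Real.pi * s * w.1))
            * (w.2 ^ (δ - 1) * Real.exp (-(Real.pi * t * w.2)))) := by
          have h3 := exp_neg_pi_mul_le_rpow hδ hδ' (by positivity : 0 < q * (w.1 * w.2))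
          have e1 : E = Real.exp (-(Real.pi * (q * (w.1 * w.2))))
              * (Real.exp (-(Real.pi * s * w.1)) * Real.exp (-(Real.pi * t * w.2))) := by
            rw [hE, ← Real.exp_add, ← Real.exp_add]
            congr 1
            ring
          have e2 : q ^ δ = q * q ^ (δ - 1) := by
            rw [Real.rpow_sub_one hq.ne']; field_simp
          rw [Real.mul_rpow hq.le (by positivity), Real.mul_rpow hw1.le hw2.le] at h3
          rw [e1, e2]
          calc _ ≤ q * (q ^ (δ - 1) * (w.1 ^ (δ - 1) * w.2 ^ (δ - 1))
                * (Real.exp (-(Real.pi * s * w.1)) * Real.exp (-(Real.pi * t * w.2)))) := by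
                gcongr
            _ = _ := by ring
        have h3 : 2 * Real.pi * (q * E) ≤ 2 * Real.pi * (q ^ δ
            * (w.1 ^ (δ - 1) * Real.exp (-(Real.pi * s * w.1))
            * (w.2 ^ (δ - 1) * Real.exp (-(Real.pi * t * w.2))))) := by gcongr
        linarith
    _ = _ := by
        rw [integral_add hD (hP.const_mul _), integral_const_mul, hPi, quadrant, h0]
        -- The choice q = ts/(t + s) collapses the three powers to one power of t + s.
        have e3 : q ^ δ * (s ^ (-δ) * t ^ (-δ)) = (t + s) ^ (-δ) := by
          rw [hqd, Real.div_rpow (by positivity) (by positivity), Real.mul_rpow ht.le hs.le,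
            Real.rpow_neg hs.le, Real.rpow_neg ht.le, Real.rpow_neg (by positivity)]
          field_simp
        rw [← e3]
        simp
        ring

/-! ### A bound for the Gaussian Fourier integral uniform over slabs -/

/-- The Gaussian kernel after integration over the centre of `U(ℝ)`. -/
def planeKernel (p w : ℝ × ℝ) : ℝ :=
  Real.exp (-(Real.pi * (p.2 * w.1 ^ 2 + p.1 * w.2 ^ 2
    + p.1 * p.2 / (p.1 + p.2) * (w.1 ^ 2 * w.2 ^ 2))))

@[fun_prop]
theorem continuous_planeKernel (p : ℝ × ℝ) : Continuous (planeKernel p) := by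
  unfold planeKernel; fun_prop

theorem planeKernel_pos (p w : ℝ × ℝ) : 0 < planeKernel p w := Real.exp_pos _

theorem planeKernel_le {p : ℝ × ℝ} (hp : p ∈ quadrant) (w : ℝ × ℝ) : planeKernel p w
    ≤ Real.exp (-(Real.pi * p.2) * w.1 ^ 2) * Real.exp (-(Real.pi * p.1) * w.2 ^ 2) := by
  have h1 : 0 < p.1 := hp.1
  have h2 : 0 < p.2 := hp.2
  rw [planeKernel, ← Real.exp_add, Real.exp_le_exp]
  have : 0 ≤ Real.pi * (p.1 * p.2 / (p.1 + p.2) * (w.1 ^ 2 * w.2 ^ 2)) := by positivity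
  linarith

theorem integrable_planeKernel {p : ℝ × ℝ} (hp : p ∈ quadrant) : Integrable (planeKernel p) := by
  have h1 : 0 < p.1 := hp.1
  have h2 : 0 < p.2 := hp.2
  have h := (integrable_exp_neg_mul_sq (by positivity : 0 < Real.pi * p.2)).mul_prod
    (integrable_exp_neg_mul_sq (by positivity : 0 < Real.pi * p.1))
  rw [← Measure.volume_eq_prod] at h
  refine h.mono' (continuous_planeKernel p).aestronglyMeasurable (Eventually.of_forall fun w => ?_)
  rw [Real.norm_of_nonneg (planeKernel_pos p w).le]
  exact planeKernel_le hp w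

/-- Completing the square in x₃; the discrepancy is the quartic term with coefficient ts/(t + s). -/
theorem cellKernel_eq_planeKernel {p : ℝ × ℝ} (hp : p ∈ quadrant) (x : ℝ × ℝ × ℝ) :
    cellKernel p x = Real.exp (-(Real.pi * (p.1 + p.2))) * planeKernel p (x.1, x.2.1)
      * Real.exp (-(Real.pi * (p.1 + p.2)) * (x.2.2 + -(p.2 * (x.1 * x.2.1) / (p.1 + p.2))) ^ 2) := by
  have h1 : 0 < p.1 := hp.1
  have h2 : 0 < p.2 := hp.2
  rw [cellKernel, planeKernel, ← Real.exp_add, ← Real.exp_add]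
  congr 1
  unfold q₁ q₂
  field_simp
  ring

theorem integral_cellKernel_center {p : ℝ × ℝ} (hp : p ∈ quadrant) (x₁ x₂ : ℝ) :
    ∫ x₃, cellKernel p (x₁, x₂, x₃) = Real.exp (-(Real.pi * (p.1 + p.2))) * planeKernel p (x₁, x₂)
      * (p.1 + p.2) ^ (-(1 / 2) : ℝ) := by
  have h1 : 0 < p.1 := hp.1
  have h2 : 0 < p.2 := hp.2
  simp_rw [cellKernel_eq_planeKernel hp]
  rw [integral_const_mul, integral_add_right_eq_self
    (fun x₃ => Real.exp (-(Real.pi * (p.1 + p.2)) * x₃ ^ 2)), integral_gaussian,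
    div_mul_cancel_left₀ Real.pi_pos.ne', Real.sqrt_inv, Real.sqrt_eq_rpow,
    Real.rpow_neg (by positivity)]

theorem integrable_cellKernel {p : ℝ × ℝ} (hp : p ∈ quadrant) : Integrable (cellKernel p) := by
  have h1 : 0 < p.1 := hp.1
  have h2 : 0 < p.2 := hp.2
  have hc : Continuous (cellKernel p) :=
    continuous_cellKernel.comp (continuous_const.prodMk continuous_id)
  have hc2 : Continuous fun z : (ℝ × ℝ) × ℝ => cellKernel p (z.1.1, z.1.2, z.2) :=
    hc.comp (by fun_prop)
  have h3 : Integrable (fun z : (ℝ × ℝ) × ℝ => cellKernel p (z.1.1, z.1.2, z.2))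
      (volume.prod volume) := by
    refine (integrable_prod_iff hc2.aestronglyMeasurable).mpr ⟨Eventually.of_forall fun w => ?_, ?_⟩
    · simp_rw [cellKernel_eq_planeKernel hp]
      exact ((integrable_exp_neg_mul_sq (by positivity)).comp_add_right _).const_mul _
    · simp_rw [Real.norm_of_nonneg (cellKernel_pos p _).le, integral_cellKernel_center hp]
      exact ((integrable_planeKernel hp).const_mul _).mul_const _
  have h4 := (volume_preserving_prodAssoc (α₁ := ℝ) (β₁ := ℝ) (γ₁ := ℝ)).symm
  exact (h4.integrable_comp_emb MeasurableEquiv.prodAssoc.symm.measurableEmbedding).mpr h3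

/-- The Fourier integral of `planeKernel` over a rectangle. -/
def planeFourier (I₁ I₂ : Set ℝ) (m p : ℝ × ℝ) : ℂ :=
  ∫ w in I₁ ×ˢ I₂, (planeKernel p w : ℂ) * (echar m.1 w.1 * echar m.2 w.2)

/-- The character does not involve x₃, so the full x₃-integral is a plain Gaussian integral. -/
theorem cellFourier_prod {p : ℝ × ℝ} (hp : p ∈ quadrant) (I₁ I₂ : Set ℝ) (m : ℝ × ℝ) :
    cellFourier (I₁ ×ˢ I₂ ×ˢ Set.univ) m p
      = ((Real.exp (-(Real.pi * (p.1 + p.2))) * (p.1 + p.2) ^ (-(1 / 2) : ℝ) : ℝ) : ℂ)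
        * planeFourier I₁ I₂ m p := by
  have h4 := volume_preserving_prodAssoc (α₁ := ℝ) (β₁ := ℝ) (γ₁ := ℝ)
  have hi : Integrable (fun x : ℝ × ℝ × ℝ => (cellKernel p x : ℂ) * psi m x) := by
    have h1 := (integrable_cellKernel hp).ofReal (𝕜 := ℂ)
    exact h1.mul_bdd (c := 1) (continuous_psi m).aestronglyMeasurable
      (Eventually.of_forall fun x => (norm_psi m x).le)
  have hi' : Integrable (fun z : (ℝ × ℝ) × ℝ =>
      (cellKernel p (z.1.1, z.1.2, z.2) : ℂ) * psi m (z.1.1, z.1.2, z.2)) (volume.prod volume) :=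
    (h4.integrable_comp_emb MeasurableEquiv.prodAssoc.measurableEmbedding).mpr hi
  have h5 := h4.setIntegral_preimage_emb MeasurableEquiv.prodAssoc.measurableEmbedding
    (fun x : ℝ × ℝ × ℝ => (cellKernel p x : ℂ) * psi m x) (I₁ ×ˢ I₂ ×ˢ Set.univ)
  have h6 : (MeasurableEquiv.prodAssoc : (ℝ × ℝ) × ℝ ≃ᵐ ℝ × ℝ × ℝ) ⁻¹' (I₁ ×ˢ I₂ ×ˢ Set.univ)
      = (I₁ ×ˢ I₂) ×ˢ Set.univ := by
    ext z
    simp [MeasurableEquiv.prodAssoc]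
  rw [h6, Measure.volume_eq_prod (ℝ × ℝ) ℝ] at h5
  rw [cellFourier, ← h5, planeFourier, ← integral_const_mul]
  refine (setIntegral_prod _ hi'.integrableOn).trans ?_
  refine integral_congr_ae (Eventually.of_forall fun w => ?_)
  have e : ∀ x₃ : ℝ, (cellKernel p (w.1, w.2, x₃) : ℂ) * psi m (w.1, w.2, x₃)
      = (cellKernel p (w.1, w.2, x₃) : ℂ) * (echar m.1 w.1 * echar m.2 w.2) := by
    intro x₃
    rw [psi_eq_echar]
  change ∫ x₃ in Set.univ, (cellKernel p (w.1, w.2, x₃) : ℂ) * psi m (w.1, w.2, x₃) = _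
  simp_rw [e]
  rw [integral_mul_const, Measure.restrict_univ, integral_complex_ofReal,
    integral_cellKernel_center hp]
  push_cast
  ring

/-- With X = w₁² and Y = w₂², `integral_mixDensity` expresses `planeKernel` through indicators of
w₁² < v₁, w₂² < v₂. For each v the oscillatory integral factors into two integrals over intervals,
bounded without regard to their endpoints. -/
theorem norm_planeFourier_le {p : ℝ × ℝ} (hp : p ∈ quadrant) {m : ℝ × ℝ} (hm₁ : m.1 ≠ 0)
    (hm₂ : m.2 ≠ 0) (α₁ β₁ α₂ β₂ : ℝ) :
    ‖planeFourier (Set.Icc α₁ β₁) (Set.Icc α₂ β₂) m p‖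
      ≤ 1 / (Real.pi * |m.1|) * (1 / (Real.pi * |m.2|))
        * ∫ v in quadrant, |mixDensity p.2 p.1 (p.1 * p.2 / (p.1 + p.2)) v| := by
  have h1 : 0 < p.1 := hp.1
  have h2 : 0 < p.2 := hp.2
  set q := p.1 * p.2 / (p.1 + p.2) with hqd
  have hq : 0 < q := by positivity
  have hD := integrableOn_mixDensity h2 h1 hq
  let S : Set (ℝ × ℝ) := Set.Icc α₁ β₁ ×ˢ Set.Icc α₂ β₂
  let F : ℝ × ℝ → ℝ × ℝ → ℂ := fun w v => (mixDensity p.2 p.1 q v : ℂ)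
    * ({x : ℝ | x ^ 2 < v.1}.indicator (echar m.1) w.1
      * {x : ℝ | x ^ 2 < v.2}.indicator (echar m.2) w.2)
  have hind : ∀ (n x r : ℝ), ‖{x : ℝ | x ^ 2 < r}.indicator (echar n) x‖ ≤ 1 := by
    intro n x r
    refine (norm_indicator_le_norm_self _ _).trans (norm_echar n x).le
  have hFle : ∀ w v, ‖F w v‖ ≤ 1 * |mixDensity p.2 p.1 q v| := by
    intro w v
    rw [norm_mul, norm_mul, Complex.norm_real, Real.norm_eq_abs, one_mul]
    refine mul_le_of_le_one_right (abs_nonneg _) ?_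
    exact mul_le_one₀ (hind _ _ _) (norm_nonneg _) (hind _ _ _)
  have hmi : ∀ n : ℝ, Measurable fun z : ℝ × ℝ => {x : ℝ | x ^ 2 < z.2}.indicator (echar n) z.1 := by
    intro n
    have e : (fun z : ℝ × ℝ => {x : ℝ | x ^ 2 < z.2}.indicator (echar n) z.1)
        = {z : ℝ × ℝ | z.1 ^ 2 < z.2}.indicator fun z => echar n z.1 := by
      ext z
      simp only [Set.indicator_apply]
      rfl
    rw [e]
    refine Measurable.indicator (by fun_prop) (measurableSet_lt (by fun_prop) (by fun_prop))
  have hFm : Measurable (Function.uncurry F) := by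
    have m1 := (hmi m.1).comp (by fun_prop : Measurable fun z : (ℝ × ℝ) × (ℝ × ℝ) => (z.1.1, z.2.1))
    have m2 := (hmi m.2).comp (by fun_prop : Measurable fun z : (ℝ × ℝ) × (ℝ × ℝ) => (z.1.2, z.2.2))
    have m3 := (measurable_mixDensity p.2 p.1 q).comp
      (measurable_snd : Measurable fun z : (ℝ × ℝ) × (ℝ × ℝ) => z.2)
    exact (Complex.measurable_ofReal.comp m3).mul (m1.mul m2)
  have hvol : IsFiniteMeasure ((volume : Measure (ℝ × ℝ)).restrict S) :=
    ⟨by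
      rw [Measure.restrict_apply_univ]
      exact (isCompact_Icc.prod isCompact_Icc).measure_lt_top⟩
  have hint : Integrable (Function.uncurry F) ((volume.restrict S).prod (volume.restrict quadrant)) :=
    Integrable.mono' ((integrable_const (1 : ℝ)).mul_prod hD.abs) hFm.aestronglyMeasurable
      (Eventually.of_forall fun z => hFle z.1 z.2)
  have hsw := integral_integral_swap hint
  have hleft : ∀ w : ℝ × ℝ, ∫ v in quadrant, F w v
      = (planeKernel p w : ℂ) * (echar m.1 w.1 * echar m.2 w.2) := by
    intro w
    have hsub : Set.Ioi (w.1 ^ 2) ×ˢ Set.Ioi (w.2 ^ 2) ⊆ quadrant :=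
      Set.prod_mono (Set.Ioi_subset_Ioi (sq_nonneg _)) (Set.Ioi_subset_Ioi (sq_nonneg _))
    have e : ∀ v : ℝ × ℝ, F w v = (Set.Ioi (w.1 ^ 2) ×ˢ Set.Ioi (w.2 ^ 2)).indicator
        (fun v => (mixDensity p.2 p.1 q v : ℂ) * (echar m.1 w.1 * echar m.2 w.2)) v := by
      intro v
      simp only [F, Set.indicator_apply, Set.mem_prod, Set.mem_Ioi]
      change (mixDensity p.2 p.1 q v : ℂ) * ((if w.1 ^ 2 < v.1 then echar m.1 w.1 else 0)
        * (if w.2 ^ 2 < v.2 then echar m.2 w.2 else 0)) = _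
      by_cases c1 : w.1 ^ 2 < v.1 <;> by_cases c2 : w.2 ^ 2 < v.2 <;> simp [c1, c2]
    simp_rw [e]
    rw [setIntegral_indicator (measurableSet_Ioi.prod measurableSet_Ioi),
      Set.inter_eq_right.mpr hsub, integral_mul_const, integral_complex_ofReal,
      integral_mixDensity h2 h1 hq (sq_nonneg _) (sq_nonneg _)]
    rfl
  have hright : ∀ v : ℝ × ℝ, ∫ w in S, F w v = (mixDensity p.2 p.1 q v : ℂ)
      * ((∫ x in Set.Icc α₁ β₁, {x : ℝ | x ^ 2 < v.1}.indicator (echar m.1) x)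
        * ∫ x in Set.Icc α₂ β₂, {x : ℝ | x ^ 2 < v.2}.indicator (echar m.2) x) := by
    intro v
    simp only [F]
    rw [integral_const_mul, Measure.volume_eq_prod]
    congr 1
    exact setIntegral_prod_mul (μ := (volume : Measure ℝ)) (ν := (volume : Measure ℝ))
      (fun x => {x : ℝ | x ^ 2 < v.1}.indicator (echar m.1) x)
      (fun x => {x : ℝ | x ^ 2 < v.2}.indicator (echar m.2) x) _ _
  have e0 : planeFourier (Set.Icc α₁ β₁) (Set.Icc α₂ β₂) m p = ∫ v in quadrant, ∫ w in S, F w v := by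
    rw [← hsw]
    simp_rw [hleft]
    rfl
  rw [e0, ← integral_const_mul]
  refine norm_integral_le_of_norm_le (hD.abs.const_mul _) (Eventually.of_forall fun v => ?_)
  rw [hright, norm_mul, norm_mul, Complex.norm_real, Real.norm_eq_abs, mul_comm]
  have b1 := norm_integral_indicator_echar_le hm₁ α₁ β₁ v.1
  have b2 := norm_integral_indicator_echar_le hm₂ α₂ β₂ v.2
  gcongr

/-- The bound for the Fourier integral of the Gaussian kernel over slabs. -/
def slabBound (m : ℝ × ℝ) (δ : ℝ) (p : ℝ × ℝ) : ℝ :=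
  1 / (Real.pi * |m.1|) * (1 / (Real.pi * |m.2|)) * (Real.exp (-(Real.pi * (p.1 + p.2)))
    * ((p.1 + p.2) ^ (-(1 / 2) : ℝ)
      + 2 * Real.pi * (Real.pi ^ (-δ) * Real.Gamma δ) ^ 2 * (p.1 + p.2) ^ (-(1 / 2 + δ))))

theorem norm_cellFourier_slab_le {m : ℝ × ℝ} (hm₁ : m.1 ≠ 0) (hm₂ : m.2 ≠ 0) {δ : ℝ} (hδ : 0 < δ)
    (hδ' : δ < 1) {p : ℝ × ℝ} (hp : p ∈ quadrant) (α₁ β₁ α₂ β₂ : ℝ) :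
    ‖cellFourier (Set.Icc α₁ β₁ ×ˢ Set.Icc α₂ β₂ ×ˢ Set.univ) m p‖ ≤ slabBound m δ p := by
  have h1 : 0 < p.1 := hp.1
  have h2 : 0 < p.2 := hp.2
  have h3 : 0 < p.1 + p.2 := by positivity
  rw [cellFourier_prod hp, norm_mul, Complex.norm_real, Real.norm_of_nonneg (by positivity)]
  have hb := (norm_planeFourier_le hp hm₁ hm₂ α₁ β₁ α₂ β₂).trans (mul_le_mul_of_nonneg_left
    (integral_abs_mixDensity_le h2 h1 hδ hδ') (by positivity))
  calc _ ≤ Real.exp (-(Real.pi * (p.1 + p.2))) * (p.1 + p.2) ^ (-(1 / 2) : ℝ)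
      * (1 / (Real.pi * |m.1|) * (1 / (Real.pi * |m.2|))
        * (1 + 2 * Real.pi * (Real.pi ^ (-δ) * Real.Gamma δ) ^ 2 * (p.1 + p.2) ^ (-δ))) := by
        gcongr
    _ = _ := by
        rw [slabBound, show -(1 / 2 + δ) = -(1 / 2) + -δ by ring, Real.rpow_add h3]
        ring

/-- The exponent η is split in the ratio α : β. The exponents left over in the application, α (1 -
η/(α + β)) and β (1 - η/(α + β)), are then both positive precisely when η < α + β. -/
theorem add_rpow_neg_le {t s α β η : ℝ} (ht : 0 < t) (hs : 0 < s) (hα : 0 < α) (hβ : 0 < β)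
    (hη : 0 ≤ η) :
    (t + s) ^ (-η) ≤ t ^ (-(η * (α / (α + β)))) * s ^ (-(η * (β / (α + β)))) := by
  have h1 : (t + s) ^ (-(η * (α / (α + β)))) ≤ t ^ (-(η * (α / (α + β)))) :=
    Real.rpow_le_rpow_of_nonpos ht (by linarith) (by
      have : 0 ≤ η * (α / (α + β)) := by positivity
      linarith)
  have h2 : (t + s) ^ (-(η * (β / (α + β)))) ≤ s ^ (-(η * (β / (α + β)))) :=
    Real.rpow_le_rpow_of_nonpos hs (by linarith) (by
      have : 0 ≤ η * (β / (α + β)) := by positivity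
      linarith)
  have h3 : -η = -(η * (α / (α + β))) + -(η * (β / (α + β))) := by field_simp; ring
  rw [h3, Real.rpow_add (by positivity)]
  exact mul_le_mul h1 h2 (by positivity) (by positivity)

theorem integrableOn_quadrant_add_rpow {α β η : ℝ} (hα : 0 < α) (hβ : 0 < β) (hη : 0 ≤ η)
    (h : η < α + β) :
    IntegrableOn (fun p : ℝ × ℝ => p.1 ^ (α - 1) * p.2 ^ (β - 1)
      * (Real.exp (-(Real.pi * (p.1 + p.2))) * (p.1 + p.2) ^ (-η))) quadrant := by
  have hab : 0 < α + β := by positivity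
  have k : 0 < 1 - η / (α + β) := by rw [sub_pos, div_lt_one hab]; exact h
  have ha : 0 < α - η * (α / (α + β)) := by
    have : α - η * (α / (α + β)) = α * (1 - η / (α + β)) := by ring
    rw [this]; positivity
  have hb : 0 < β - η * (β / (α + β)) := by
    have : β - η * (β / (α + β)) = β * (1 - η / (α + β)) := by ring
    rw [this]; positivity
  refine Integrable.mono' (integrableOn_quadrant_mul (integrableOn_rpow_mul_exp ha Real.pi_pos)
    (integrableOn_rpow_mul_exp hb Real.pi_pos)) (by fun_prop) ?_
  filter_upwards [ae_restrict_mem measurableSet_quadrant] with p hp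
  have h1 : 0 < p.1 := hp.1
  have h2 : 0 < p.2 := hp.2
  rw [Real.norm_of_nonneg (by positivity)]
  have e := add_rpow_neg_le h1 h2 hα hβ hη
  have e1 : p.1 ^ (α - η * (α / (α + β)) - 1) = p.1 ^ (α - 1) * p.1 ^ (-(η * (α / (α + β)))) := by
    rw [← Real.rpow_add h1]; ring_nf
  have e2 : p.2 ^ (β - η * (β / (α + β)) - 1) = p.2 ^ (β - 1) * p.2 ^ (-(η * (β / (α + β)))) := by
    rw [← Real.rpow_add h2]; ring_nf
  have e3 : Real.exp (-(Real.pi * (p.1 + p.2)))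
      = Real.exp (-(Real.pi * p.1)) * Real.exp (-(Real.pi * p.2)) := by
    rw [← Real.exp_add]; congr 1; ring
  rw [e1, e2, e3]
  calc _ ≤ p.1 ^ (α - 1) * p.2 ^ (β - 1) * (Real.exp (-(Real.pi * p.1)) * Real.exp (-(Real.pi * p.2))
      * (p.1 ^ (-(η * (α / (α + β)))) * p.2 ^ (-(η * (β / (α + β)))))) := by gcongr
    _ = _ := by ring

theorem integrableOn_slabBound (m : ℝ × ℝ) {A B δ : ℝ} (hA : 0 < A) (hB : 0 < B) (hδ : 0 < δ)
    (h : 1 / 2 + δ < A + B) :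
    IntegrableOn (fun p : ℝ × ℝ => p.1 ^ (A - 1) * p.2 ^ (B - 1) * slabBound m δ p) quadrant := by
  have h1 := (integrableOn_quadrant_add_rpow hA hB (by norm_num : (0 : ℝ) ≤ 1 / 2)
    (by linarith)).const_mul (1 / (Real.pi * |m.1|) * (1 / (Real.pi * |m.2|)))
  have h2 := (integrableOn_quadrant_add_rpow hA hB (by linarith : 0 ≤ 1 / 2 + δ)
    h).const_mul (1 / (Real.pi * |m.1|) * (1 / (Real.pi * |m.2|))
      * (2 * Real.pi * (Real.pi ^ (-δ) * Real.Gamma δ) ^ 2))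
  refine (h1.add h2).congr (Eventually.of_forall fun p => ?_)
  simp only [Pi.add_apply, slabBound]
  ring

/-! ### Limits over growing slabs -/

/-- The slab `[-R₁, R₁] × [-R₂, R₂] × ℝ` translated by `u`. -/
def shiftedSlab (u : ℝ × ℝ × ℝ) (R : ℝ × ℝ) : Set (ℝ × ℝ × ℝ) :=
  Set.Icc (-R.1 + u.1) (R.1 + u.1) ×ˢ Set.Icc (-R.2 + u.2.1) (R.2 + u.2.1) ×ˢ Set.univ

theorem measurableSet_shiftedSlab (u : ℝ × ℝ × ℝ) (R : ℝ × ℝ) : MeasurableSet (shiftedSlab u R) :=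
  measurableSet_Icc.prod (measurableSet_Icc.prod MeasurableSet.univ)

theorem eventually_mem_shiftedSlab (u x : ℝ × ℝ × ℝ) :
    ∀ᶠ R in (atTop ×ˢ atTop : Filter (ℝ × ℝ)), x ∈ shiftedSlab u R := by
  have h1 := (eventually_ge_atTop |x.1 - u.1|).prod_inl (atTop : Filter ℝ)
  have h2 := (eventually_ge_atTop |x.2.1 - u.2.1|).prod_inr (atTop : Filter ℝ)
  filter_upwards [h1, h2] with R hR1 hR2
  obtain ⟨a1, a2⟩ := abs_le.mp hR1
  obtain ⟨b1, b2⟩ := abs_le.mp hR2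
  exact ⟨⟨by linarith, by linarith⟩, ⟨by linarith, by linarith⟩, trivial⟩

theorem integrable_cellKernel_mul_psi {p : ℝ × ℝ} (hp : p ∈ quadrant) (m : ℝ × ℝ) :
    Integrable (fun x : ℝ × ℝ × ℝ => (cellKernel p x : ℂ) * psi m x) :=
  ((integrable_cellKernel hp).ofReal (𝕜 := ℂ)).mul_bdd (c := 1)
    (continuous_psi m).aestronglyMeasurable (Eventually.of_forall fun x => (norm_psi m x).le)

theorem tendsto_cellFourier_shiftedSlab {p : ℝ × ℝ} (hp : p ∈ quadrant) (m : ℝ × ℝ)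
    (u : ℝ × ℝ × ℝ) :
    Tendsto (fun R => cellFourier (shiftedSlab u R) m p) (atTop ×ˢ atTop)
      (𝓝 (cellFourier Set.univ m p)) := by
  have hi := integrable_cellKernel_mul_psi hp m
  simp only [cellFourier]
  simp_rw [← integral_indicator (measurableSet_shiftedSlab u _), Measure.restrict_univ]
  refine tendsto_integral_filter_of_dominated_convergence _ ?_ ?_ hi.norm ?_
  · exact Eventually.of_forall fun R =>
      hi.aestronglyMeasurable.indicator (measurableSet_shiftedSlab u R)
  · exact Eventually.of_forall fun R => Eventually.of_forall fun x =>
      norm_indicator_le_norm_self _ _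
  · refine Eventually.of_forall fun x => tendsto_const_nhds.congr' ?_
    filter_upwards [eventually_mem_shiftedSlab u x] with R hR
    rw [Set.indicator_of_mem hR]

theorem norm_cellFourier_univ_le {m : ℝ × ℝ} (hm₁ : m.1 ≠ 0) (hm₂ : m.2 ≠ 0) {δ : ℝ} (hδ : 0 < δ)
    (hδ' : δ < 1) {p : ℝ × ℝ} (hp : p ∈ quadrant) :
    ‖cellFourier Set.univ m p‖ ≤ slabBound m δ p :=
  le_of_tendsto (tendsto_cellFourier_shiftedSlab hp m 0).norm
    (Eventually.of_forall fun _ => norm_cellFourier_slab_le hm₁ hm₂ hδ hδ' hp _ _ _ _)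

theorem measurable_cellFourier (S : Set (ℝ × ℝ × ℝ)) (m : ℝ × ℝ) :
    StronglyMeasurable (cellFourier S m) := by
  have h : StronglyMeasurable fun w : (ℝ × ℝ) × (ℝ × ℝ × ℝ) =>
      (cellKernel w.1 w.2 : ℂ) * psi m w.2 := by
    refine Continuous.stronglyMeasurable ?_
    exact (Complex.continuous_ofReal.comp continuous_cellKernel).mul
      ((continuous_psi m).comp continuous_snd)
  exact h.integral_prod_right'

/-- The Mellin transform of the Fourier integral of the Gaussian kernel. -/
def mellinFourier (S : Set (ℝ × ℝ × ℝ)) (m : ℝ × ℝ) (a b : ℂ) : ℂ :=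
  ∫ p in quadrant, (p.1 : ℂ) ^ (a - 1) * (p.2 : ℂ) ^ (b - 1) * cellFourier S m p

theorem norm_mellin_integrand_le {a b : ℂ} {m : ℝ × ℝ} {δ : ℝ} {S : Set (ℝ × ℝ × ℝ)} {p : ℝ × ℝ}
    (hp : p ∈ quadrant) (h : ‖cellFourier S m p‖ ≤ slabBound m δ p) :
    ‖(p.1 : ℂ) ^ (a - 1) * (p.2 : ℂ) ^ (b - 1) * cellFourier S m p‖
      ≤ p.1 ^ (a.re - 1) * p.2 ^ (b.re - 1) * slabBound m δ p := by
  have h1 : 0 < p.1 := hp.1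
  have h2 : 0 < p.2 := hp.2
  rw [norm_mul, norm_quadrant_cpow hp]
  gcongr

theorem tendsto_mellinFourier {a b : ℂ} (ha : 0 < a.re) (hb : 0 < b.re) (hab : 1 / 2 < (a + b).re)
    {m : ℝ × ℝ} (hm₁ : m.1 ≠ 0) (hm₂ : m.2 ≠ 0) (u : ℝ × ℝ × ℝ) :
    Tendsto (fun R => mellinFourier (shiftedSlab u R) m a b) (atTop ×ˢ atTop)
      (𝓝 (mellinFourier Set.univ m a b)) := by
  rw [Complex.add_re] at hab
  -- δ is taken below Re (a + b) - 1/2, so that `slabBound` is an integrable majorant, and below 1,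
  -- as the mass estimate demands.
  obtain ⟨δ, hδ, hδ1⟩ := exists_between (lt_min (sub_pos.mpr hab) one_pos)
  obtain ⟨hδ2, hδ3⟩ := lt_min_iff.mp hδ1
  refine tendsto_integral_filter_of_dominated_convergence
    (fun p => p.1 ^ (a.re - 1) * p.2 ^ (b.re - 1) * slabBound m δ p) ?_ ?_
    (integrableOn_slabBound m ha hb hδ (by linarith)) ?_
  · exact Eventually.of_forall fun R =>
      ((aestronglyMeasurable_quadrant_cpow _ _).stronglyMeasurable.mul
        (measurable_cellFourier _ m)).aestronglyMeasurable
  · refine Eventually.of_forall fun R => ?_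
    filter_upwards [ae_restrict_mem measurableSet_quadrant] with p hp
    exact norm_mellin_integrand_le hp (norm_cellFourier_slab_le hm₁ hm₂ hδ hδ3 hp _ _ _ _)
  · filter_upwards [ae_restrict_mem measurableSet_quadrant] with p hp
    exact (tendsto_cellFourier_shiftedSlab hp m u).const_mul _

/-- Uniformity in the translation u is what later permits the limit to be taken inside the
u-integral. -/
theorem exists_norm_mellinFourier_le {a b : ℂ} (ha : 0 < a.re) (hb : 0 < b.re)
    (hab : 1 / 2 < (a + b).re) {m : ℝ × ℝ} (hm₁ : m.1 ≠ 0) (hm₂ : m.2 ≠ 0) :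
    ∃ C, ∀ u R, ‖mellinFourier (shiftedSlab u R) m a b‖ ≤ C := by
  rw [Complex.add_re] at hab
  obtain ⟨δ, hδ, hδ1⟩ := exists_between (lt_min (sub_pos.mpr hab) one_pos)
  obtain ⟨hδ2, hδ3⟩ := lt_min_iff.mp hδ1
  refine ⟨∫ p in quadrant, p.1 ^ (a.re - 1) * p.2 ^ (b.re - 1) * slabBound m δ p, fun u R => ?_⟩
  refine norm_integral_le_of_norm_le (integrableOn_slabBound m ha hb hδ (by linarith)) ?_
  filter_upwards [ae_restrict_mem measurableSet_quadrant] with p hp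
  exact norm_mellin_integrand_le hp (norm_cellFourier_slab_le hm₁ hm₂ hδ hδ3 hp _ _ _ _)

/-! ### Linearising the quartic term -/

theorem integral_gaussian_quadratic {x : ℝ} (hx : 0 < x) (c d : ℂ) :
    ∫ v : ℝ, Complex.exp (((-(Real.pi * x) : ℝ) : ℂ) * (v : ℂ) ^ 2 + c * v + d)
      = ((x ^ (-(1 / 2) : ℝ) : ℝ) : ℂ) * Complex.exp (d + c ^ 2 / (4 * Real.pi * x)) := by
  have hpx : 0 < Real.pi * x := by positivity
  have hb : (((-(Real.pi * x) : ℝ) : ℂ)).re < 0 := by rw [Complex.ofReal_re]; linarith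
  rw [integral_cexp_quadratic hb]
  congr 1
  · have h1 : (Real.pi : ℂ) / -((-(Real.pi * x) : ℝ) : ℂ) = ((x⁻¹ : ℝ) : ℂ) := by
      push_cast
      have : (Real.pi : ℂ) ≠ 0 := by exact_mod_cast Real.pi_ne_zero
      have : (x : ℂ) ≠ 0 := by exact_mod_cast hx.ne'
      field_simp
    rw [h1, show (1 / 2 : ℂ) = ((1 / 2 : ℝ) : ℂ) by norm_num,
      ← Complex.ofReal_cpow (by positivity), Real.inv_rpow hx.le, Real.rpow_neg hx.le]
  · congr 1
    push_cast
    rw [sub_eq_add_neg, ← div_neg]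
    congr 2
    ring

/-- The quadratic form in the linearised Gaussian integral. -/
def phase (m p w : ℝ × ℝ) (v : ℝ) : ℂ :=
  ((-(Real.pi * (p.2 * w.1 ^ 2 + p.1 * w.2 ^ 2 + (p.1 + p.2) * v ^ 2)) : ℝ) : ℂ)
    + ((2 * Real.pi * (√(p.1 * p.2) * v * w.1 * w.2 + m.1 * w.1 + m.2 * w.2) : ℝ) : ℂ) * Complex.I

theorem continuous_phase (m p : ℝ × ℝ) :
    Continuous fun z : (ℝ × ℝ) × ℝ => phase m p z.1 z.2 := by
  unfold phase
  fun_prop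

theorem norm_exp_phase (m p w : ℝ × ℝ) (v : ℝ) : ‖Complex.exp (phase m p w v)‖
    = Real.exp (-(Real.pi * p.2) * w.1 ^ 2) * Real.exp (-(Real.pi * p.1) * w.2 ^ 2)
      * Real.exp (-(Real.pi * (p.1 + p.2)) * v ^ 2) := by
  rw [phase, Complex.exp_add, norm_mul, Complex.norm_exp_ofReal_mul_I, mul_one, Complex.norm_exp,
    Complex.ofReal_re, ← Real.exp_add, ← Real.exp_add]
  congr 1
  ring

/-- The frequency √(ts) w₁ w₂ against a Gaussian in v of width parameter t + s reproduces exp (-π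
(ts/(t + s)) w₁² w₂²): the quartic term is the result of the v-integration. -/
theorem integral_exp_phase_snd {p : ℝ × ℝ} (hp : p ∈ quadrant) (m w : ℝ × ℝ) :
    ∫ v : ℝ, Complex.exp (phase m p w v) = (((p.1 + p.2) ^ (-(1 / 2) : ℝ) : ℝ) : ℂ)
      * ((planeKernel p w : ℂ) * (echar m.1 w.1 * echar m.2 w.2)) := by
  have h1 : 0 < p.1 := hp.1
  have h2 : 0 < p.2 := hp.2
  have h3 : 0 < p.1 + p.2 := by positivity
  have h := integral_gaussian_quadratic h3
    ((2 * Real.pi * (√(p.1 * p.2) * w.1 * w.2) : ℝ) * Complex.I)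
    (((-(Real.pi * (p.2 * w.1 ^ 2 + p.1 * w.2 ^ 2)) : ℝ) : ℂ)
      + ((2 * Real.pi * (m.1 * w.1 + m.2 * w.2) : ℝ) : ℂ) * Complex.I)
  have e : ∀ v : ℝ, phase m p w v = ((-(Real.pi * (p.1 + p.2)) : ℝ) : ℂ) * (v : ℂ) ^ 2
      + (2 * Real.pi * (√(p.1 * p.2) * w.1 * w.2) : ℝ) * Complex.I * v
      + (((-(Real.pi * (p.2 * w.1 ^ 2 + p.1 * w.2 ^ 2)) : ℝ) : ℂ)
      + ((2 * Real.pi * (m.1 * w.1 + m.2 * w.2) : ℝ) : ℂ) * Complex.I) := by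
    intro v
    rw [phase]
    push_cast
    ring
  simp_rw [e]
  rw [h]
  congr 1
  rw [planeKernel, echar, echar, Complex.ofReal_exp, ← Complex.exp_add, ← Complex.exp_add]
  congr 1
  have hsq : ((√(p.1 * p.2) : ℝ) : ℂ) ^ 2 = (p.1 : ℂ) * p.2 := by
    rw [← Complex.ofReal_pow, Real.sq_sqrt (by positivity)]
    push_cast
    ring
  have hc : ((2 * Real.pi * (√(p.1 * p.2) * w.1 * w.2) : ℝ) * Complex.I : ℂ) ^ 2
      = -(4 * (Real.pi : ℂ) ^ 2 * (p.1 * p.2 * (w.1 ^ 2 * w.2 ^ 2))) := by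
    rw [mul_pow, Complex.I_sq]
    push_cast
    rw [mul_pow, mul_pow, mul_pow, mul_pow, hsq]
    ring
  rw [hc]
  have : (Real.pi : ℂ) ≠ 0 := by exact_mod_cast Real.pi_ne_zero
  have : (p.1 : ℂ) + p.2 ≠ 0 := by exact_mod_cast h3.ne'
  push_cast
  field_simp
  ring

theorem integrable_exp_phase_fst {p : ℝ × ℝ} (hp : p ∈ quadrant) (m : ℝ × ℝ) (v : ℝ) :
    Integrable (fun w : ℝ × ℝ => Complex.exp (phase m p w v)) (volume.prod volume) := by
  have h1 : 0 < p.1 := hp.1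
  have h2 : 0 < p.2 := hp.2
  have h := ((integrable_exp_neg_mul_sq (by positivity : 0 < Real.pi * p.2)).mul_prod
    (integrable_exp_neg_mul_sq (by positivity : 0 < Real.pi * p.1))).mul_const
    (Real.exp (-(Real.pi * (p.1 + p.2)) * v ^ 2))
  refine h.mono' ?_ (Eventually.of_forall fun w => (norm_exp_phase m p w v).le)
  exact (Complex.continuous_exp.comp ((continuous_phase m p).comp
    (by fun_prop : Continuous fun w : ℝ × ℝ => (w, v)))).aestronglyMeasurable

theorem integrable_exp_phase {p : ℝ × ℝ} (hp : p ∈ quadrant) (m : ℝ × ℝ) :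
    Integrable (Function.uncurry fun (w : ℝ × ℝ) (v : ℝ) => Complex.exp (phase m p w v))
      (volume.prod volume) := by
  have h1 : 0 < p.1 := hp.1
  have h2 : 0 < p.2 := hp.2
  have h := ((integrable_exp_neg_mul_sq (by positivity : 0 < Real.pi * p.2)).mul_prod
    (integrable_exp_neg_mul_sq (by positivity : 0 < Real.pi * p.1))).mul_prod
    (integrable_exp_neg_mul_sq (by positivity : 0 < Real.pi * (p.1 + p.2)))
  rw [← Measure.volume_eq_prod ℝ ℝ] at h
  refine h.mono' ?_ (Eventually.of_forall fun z => (norm_exp_phase m p z.1 z.2).le)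
  exact (Complex.continuous_exp.comp (continuous_phase m p)).aestronglyMeasurable

/-- For fixed v the exponent is quadratic in w, with determinant ts (1 + v²). The cross term of the
inverse form couples m₁ and m₂ and survives as the character. -/
theorem integral_exp_phase_fst {p : ℝ × ℝ} (hp : p ∈ quadrant) (m : ℝ × ℝ) (v : ℝ) :
    ∫ w : ℝ × ℝ, Complex.exp (phase m p w v)
      = ((p.1 ^ (-(1 / 2) : ℝ) * (p.2 * (1 + v ^ 2)) ^ (-(1 / 2) : ℝ)
        * Real.exp (-(Real.pi * ((p.1 + p.2) * v ^ 2)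
          + Real.pi * ((m.1 ^ 2 / p.2 + m.2 ^ 2 / p.1) / (1 + v ^ 2)))) : ℝ) : ℂ)
        * echar (-(m.1 * m.2) / √(p.1 * p.2)) (v / (1 + v ^ 2)) := by
  have h1 : 0 < p.1 := hp.1
  have h2 : 0 < p.2 := hp.2
  have h3 : 0 < p.2 * (1 + v ^ 2) := by positivity
  have hpi : (Real.pi : ℂ) ≠ 0 := by exact_mod_cast Real.pi_ne_zero
  have hp1 : (p.1 : ℂ) ≠ 0 := by exact_mod_cast h1.ne'
  have hp2 : (p.2 : ℂ) ≠ 0 := by exact_mod_cast h2.ne'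
  have hv : (1 + (v : ℂ) ^ 2) ≠ 0 := by exact_mod_cast (by positivity : (0 : ℝ) < 1 + v ^ 2).ne'
  set σ := √(p.1 * p.2) with hσ
  have hσ0 : (σ : ℂ) ≠ 0 := by
    exact_mod_cast (Real.sqrt_pos.mpr (by positivity : 0 < p.1 * p.2)).ne'
  have hsq : (σ : ℂ) ^ 2 = (p.1 : ℂ) * p.2 := by
    rw [← Complex.ofReal_pow, hσ, Real.sq_sqrt (by positivity)]
    push_cast
    ring
  rw [Measure.volume_eq_prod, integral_prod _ (integrable_exp_phase_fst hp m v)]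
  have hin : ∀ w₁ : ℝ, ∫ w₂ : ℝ, Complex.exp (phase m p (w₁, w₂) v)
      = ((p.1 ^ (-(1 / 2) : ℝ) : ℝ) : ℂ) * Complex.exp
        (((-(Real.pi * (p.2 * (1 + v ^ 2))) : ℝ) : ℂ) * (w₁ : ℂ) ^ 2
        + (2 * Real.pi * m.1 * Complex.I - 2 * Real.pi * σ * v * m.2 / p.1) * w₁
        + (-(Real.pi * (p.1 + p.2) * v ^ 2) - Real.pi * m.2 ^ 2 / p.1)) := by
    intro w₁
    have h := integral_gaussian_quadratic h1 (2 * Real.pi * (σ * v * w₁ + m.2) * Complex.I)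
      (-(Real.pi * (p.2 * w₁ ^ 2 + (p.1 + p.2) * v ^ 2)) + 2 * Real.pi * (m.1 * w₁) * Complex.I)
    have e : ∀ w₂ : ℝ, phase m p (w₁, w₂) v = ((-(Real.pi * p.1) : ℝ) : ℂ) * (w₂ : ℂ) ^ 2
        + (2 * Real.pi * (σ * v * w₁ + m.2) * Complex.I) * w₂
        + (-(Real.pi * (p.2 * w₁ ^ 2 + (p.1 + p.2) * v ^ 2))
          + 2 * Real.pi * (m.1 * w₁) * Complex.I) := by
      intro w₂
      rw [phase]
      push_cast
      ring
    simp_rw [e]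
    rw [h]
    congr 2
    have hc : (2 * (Real.pi : ℂ) * (σ * v * w₁ + m.2) * Complex.I) ^ 2
        = -(4 * (Real.pi : ℂ) ^ 2 * (p.1 * p.2 * (v * w₁) ^ 2 + 2 * σ * v * w₁ * m.2 + m.2 ^ 2)) := by
      rw [← hsq, mul_pow, Complex.I_sq]
      ring
    rw [hc]
    push_cast
    field_simp
    ring
  simp_rw [hin]
  rw [integral_const_mul, integral_gaussian_quadratic h3]
  suffices hfin : Complex.exp ((-(Real.pi * (p.1 + p.2) * v ^ 2) - Real.pi * m.2 ^ 2 / p.1)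
      + (2 * (Real.pi : ℂ) * m.1 * Complex.I - 2 * Real.pi * σ * v * m.2 / p.1) ^ 2
        / (4 * Real.pi * ((p.2 * (1 + v ^ 2) : ℝ) : ℂ)))
      = (Real.exp (-(Real.pi * ((p.1 + p.2) * v ^ 2)
          + Real.pi * ((m.1 ^ 2 / p.2 + m.2 ^ 2 / p.1) / (1 + v ^ 2)))) : ℂ)
        * echar (-(m.1 * m.2) / σ) (v / (1 + v ^ 2)) by
    rw [hfin, Complex.ofReal_mul, Complex.ofReal_mul]
    ring
  rw [echar, Complex.ofReal_exp, ← Complex.exp_add]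
  congr 1
  have hc : (2 * (Real.pi : ℂ) * m.1 * Complex.I - 2 * Real.pi * σ * v * m.2 / p.1) ^ 2
      = -(4 * (Real.pi : ℂ) ^ 2 * (m.1 ^ 2 + 2 * Complex.I * m.1 * σ * v * m.2 / p.1
        - p.2 * v ^ 2 * m.2 ^ 2 / p.1)) := by
    have : (p.2 : ℂ) = σ ^ 2 / p.1 := by rw [hsq]; field_simp
    rw [this]
    field_simp
    linear_combination (4 * (m.1 : ℂ) ^ 2 * p.1 ^ 2) * Complex.I_sq
  rw [hc]
  have hσi : (σ : ℂ) / (p.1 * p.2) = 1 / σ := by rw [← hsq]; field_simp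
  have hkey : (-(m.1 * m.2) / σ : ℂ) = -(m.1 * m.2) * σ / (p.1 * p.2) := by
    rw [mul_div_assoc, hσi]; ring
  push_cast
  rw [hkey]
  field_simp
  ring

theorem cellFourier_univ_eq {p : ℝ × ℝ} (hp : p ∈ quadrant) (m : ℝ × ℝ) :
    cellFourier Set.univ m p = ∫ v : ℝ,
      ((p.1 ^ (-(1 / 2) : ℝ) * (p.2 * (1 + v ^ 2)) ^ (-(1 / 2) : ℝ)
        * Real.exp (-(Real.pi * ((p.1 + p.2) * (1 + v ^ 2))
          + Real.pi * ((m.1 ^ 2 / p.2 + m.2 ^ 2 / p.1) / (1 + v ^ 2)))) : ℝ) : ℂ)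
        * echar (-(m.1 * m.2) / √(p.1 * p.2)) (v / (1 + v ^ 2)) := by
  have h := cellFourier_prod hp Set.univ Set.univ m
  rw [Set.univ_prod_univ, Set.univ_prod_univ] at h
  have hsw := integral_integral_swap (integrable_exp_phase hp m)
  simp_rw [integral_exp_phase_snd hp, integral_exp_phase_fst hp, integral_const_mul] at hsw
  rw [h, planeFourier, Set.univ_prod_univ, Measure.restrict_univ, Complex.ofReal_mul, mul_assoc, hsw,
    ← integral_const_mul]
  refine integral_congr_ae (Eventually.of_forall fun v => ?_)
  simp only []
  rw [← mul_assoc, ← Complex.ofReal_mul]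
  congr 2
  rw [mul_left_comm, ← Real.exp_add]
  congr 2
  ring

/-! ### Evaluation by an integral of Bessel type -/

theorem exp_neg_div_le {w x : ℝ} (hw : 0 < w) (hx : 0 < x) (N : ℕ) :
    Real.exp (-(w / x)) ≤ (N.factorial / w ^ N) * x ^ N := by
  have h := Real.pow_div_factorial_le_exp (w / x) (by positivity) N
  rw [Real.exp_neg]
  calc (Real.exp (w / x))⁻¹ ≤ ((w / x) ^ N / N.factorial)⁻¹ := inv_anti₀ (by positivity) h
    _ = _ := by rw [div_pow]; field_simp

theorem integrableOn_rpow_mul_exp_mul_exp (k : ℝ) {u w : ℝ} (hu : 0 < u) (hw : 0 < w) :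
    IntegrableOn (fun x : ℝ => x ^ k * (Real.exp (-(u * x)) * Real.exp (-(w / x)))) (Set.Ioi 0) := by
  obtain ⟨N, hN⟩ := exists_nat_gt (-k - 1)
  refine Integrable.mono' ((integrableOn_rpow_mul_exp (by linarith : 0 < k + N + 1) hu).const_mul
    (N.factorial / w ^ N)) (by fun_prop) ?_
  filter_upwards [ae_restrict_mem measurableSet_Ioi] with x hx
  have hx : 0 < x := hx
  rw [Real.norm_of_nonneg (by positivity), add_sub_cancel_right, Real.rpow_add hx, Real.rpow_natCast]
  calc _ ≤ x ^ k * (Real.exp (-(u * x)) * ((N.factorial / w ^ N) * x ^ N)) := by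
        gcongr
        exact exp_neg_div_le hw hx N
    _ = _ := by ring

/-- The positive octant. -/
def octant : Set ((ℝ × ℝ) × ℝ) := quadrant ×ˢ Set.Ioi 0

theorem measurableSet_octant : MeasurableSet octant := measurableSet_quadrant.prod measurableSet_Ioi

theorem volume_restrict_octant : (volume : Measure ((ℝ × ℝ) × ℝ)).restrict octant
    = ((volume : Measure (ℝ × ℝ)).restrict quadrant).prod (volume.restrict (Set.Ioi 0)) := by
  rw [Measure.prod_restrict, ← Measure.volume_eq_prod, octant]

/-- The two-dimensional part of the kernel of the Bessel integral. -/
def pairKernel (m P : ℝ × ℝ) : ℝ :=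
  Real.exp (-(Real.pi * (P.1 + P.2) + Real.pi * (m.1 ^ 2 / P.2 + m.2 ^ 2 / P.1)))

theorem pairKernel_pos (m P : ℝ × ℝ) : 0 < pairKernel m P := Real.exp_pos _

/-- The kernel of the Bessel integral. -/
def besselKernel (m : ℝ × ℝ) (z : (ℝ × ℝ) × ℝ) : ℝ :=
  pairKernel m z.1 * (Real.exp (-(Real.pi * z.2))
    * Real.exp (-(Real.pi * (m.1 * m.2) ^ 2 / (z.1.1 * z.1.2) / z.2)))

@[fun_prop]
theorem measurable_pairKernel (m : ℝ × ℝ) : Measurable (pairKernel m) := by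
  unfold pairKernel; fun_prop

@[fun_prop]
theorem measurable_besselKernel (m : ℝ × ℝ) : Measurable (besselKernel m) := by
  unfold besselKernel; fun_prop

theorem pairKernel_eq (m P : ℝ × ℝ) : pairKernel m P
    = (Real.exp (-(Real.pi * P.1)) * Real.exp (-(Real.pi * m.2 ^ 2 / P.1)))
      * (Real.exp (-(Real.pi * P.2)) * Real.exp (-(Real.pi * m.1 ^ 2 / P.2))) := by
  rw [pairKernel, ← Real.exp_add, ← Real.exp_add, ← Real.exp_add]
  congr 1
  ring

theorem integrableOn_pairKernel {m : ℝ × ℝ} (hm₁ : m.1 ≠ 0) (hm₂ : m.2 ≠ 0) (k l : ℝ) :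
    IntegrableOn (fun P : ℝ × ℝ => P.1 ^ k * P.2 ^ l * pairKernel m P) quadrant := by
  have h := integrableOn_quadrant_mul
    (integrableOn_rpow_mul_exp_mul_exp k Real.pi_pos (by positivity : 0 < Real.pi * m.2 ^ 2))
    (integrableOn_rpow_mul_exp_mul_exp l Real.pi_pos (by positivity : 0 < Real.pi * m.1 ^ 2))
  refine h.congr (Eventually.of_forall fun P => ?_)
  simp only [pairKernel_eq]
  ring

/-- The kernel decays faster than any power at every face of the octant and at infinity, so all real
exponents are allowed; this makes the Bessel integral entire. -/
theorem integrableOn_besselKernel {m : ℝ × ℝ} (hm₁ : m.1 ≠ 0) (hm₂ : m.2 ≠ 0) (k l j : ℝ) :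
    IntegrableOn (fun z : (ℝ × ℝ) × ℝ => z.1.1 ^ k * z.1.2 ^ l * z.2 ^ j * besselKernel m z)
      octant := by
  -- N powers of P₁ P₂ τ (with τ the third variable) are gained from the last exponential: enough to
  -- make the exponent of τ exceed -1, while the changed powers of P₁ and P₂ are harmless for
  -- `pairKernel`.
  obtain ⟨N, hN⟩ := exists_nat_gt (-j - 1)
  have hw : 0 < Real.pi * (m.1 * m.2) ^ 2 := by positivity
  have h := (integrableOn_pairKernel hm₁ hm₂ (k + N) (l + N)).mul_prod
    (integrableOn_rpow_mul_exp (by linarith : 0 < j + N + 1) Real.pi_pos)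
  rw [← volume_restrict_octant] at h
  refine Integrable.mono' (h.const_mul (N.factorial / (Real.pi * (m.1 * m.2) ^ 2) ^ N))
    (by fun_prop) ?_
  filter_upwards [ae_restrict_mem measurableSet_octant] with z hz
  have h1 : 0 < z.1.1 := hz.1.1
  have h2 : 0 < z.1.2 := hz.1.2
  have h3 : 0 < z.2 := hz.2
  have hK : 0 < pairKernel m z.1 := Real.exp_pos _
  rw [besselKernel, Real.norm_of_nonneg (by positivity), add_sub_cancel_right, Real.rpow_add h1,
    Real.rpow_add h2, Real.rpow_add h3, Real.rpow_natCast, Real.rpow_natCast, Real.rpow_natCast]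
  have e := exp_neg_div_le hw (by positivity : 0 < z.1.1 * z.1.2 * z.2) N
  rw [← div_div] at e
  calc _ ≤ z.1.1 ^ k * z.1.2 ^ l * z.2 ^ j * (pairKernel m z.1 * (Real.exp (-(Real.pi * z.2))
      * ((N.factorial / (Real.pi * (m.1 * m.2) ^ 2) ^ N) * (z.1.1 * z.1.2 * z.2) ^ N))) := by
        gcongr
    _ = _ := by rw [mul_pow, mul_pow]; ring

/-- The integral of Bessel type which represents the completed Whittaker function. -/
def besselIntegral (m : ℝ × ℝ) (a b : ℂ) : ℂ :=
  ∫ z in octant, (z.1.1 : ℂ) ^ (a - 1 / 2 - 1) * (z.1.2 : ℂ) ^ (b - 1 / 2 - 1)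
    * (z.2 : ℂ) ^ (a + b - 1 / 2 - 1 / 2 - 1) * (besselKernel m z : ℂ)

open scoped Pointwise in
theorem setIntegral_quadrant_scale {E : Type*} [NormedAddCommGroup E] [NormedSpace ℝ E] {l : ℝ}
    (hl : 0 < l) (f : ℝ × ℝ → E) :
    ∫ p in quadrant, f p = (l ^ 2)⁻¹ • ∫ P in quadrant, f (l⁻¹ • P) := by
  have hs : l⁻¹ • quadrant = quadrant := by
    ext p
    rw [Set.mem_inv_smul_set_iff₀ hl.ne']
    simp [quadrant, hl]
  rw [Measure.setIntegral_comp_smul_of_pos _ _ _ (inv_pos.mpr hl), hs]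
  have : Module.finrank ℝ (ℝ × ℝ) = 2 := by simp
  rw [this, inv_pow, inv_inv, smul_smul, inv_mul_cancel₀ (by positivity), one_smul]

/-- The integrand in the evaluation of `mellinFourier` on the whole of `U(ℝ)`. -/
def mellinKernel (m : ℝ × ℝ) (a b : ℂ) (p : ℝ × ℝ) (v : ℝ) : ℂ :=
  (p.1 : ℂ) ^ (a - 1) * (p.2 : ℂ) ^ (b - 1)
    * (((p.1 ^ (-(1 / 2) : ℝ) * (p.2 * (1 + v ^ 2)) ^ (-(1 / 2) : ℝ)
        * Real.exp (-(Real.pi * ((p.1 + p.2) * (1 + v ^ 2))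
          + Real.pi * ((m.1 ^ 2 / p.2 + m.2 ^ 2 / p.1) / (1 + v ^ 2)))) : ℝ) : ℂ)
        * echar (-(m.1 * m.2) / √(p.1 * p.2)) (v / (1 + v ^ 2)))

theorem measurable_echar_comp {α : Type*} [MeasurableSpace α] {f g : α → ℝ} (hf : Measurable f)
    (hg : Measurable g) : Measurable fun x => echar (f x) (g x) := by
  unfold echar
  fun_prop

theorem measurable_mellinKernel (m : ℝ × ℝ) (a b : ℂ) :
    Measurable (Function.uncurry (mellinKernel m a b)) := by
  unfold Function.uncurry mellinKernel
  have h := measurable_echar_comp (α := (ℝ × ℝ) × ℝ)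
    (f := fun z => -(m.1 * m.2) / √(z.1.1 * z.1.2)) (g := fun z => z.2 / (1 + z.2 ^ 2))
    (by fun_prop) (by fun_prop)
  fun_prop

theorem ofReal_rpow_mul_cpow {x : ℝ} (hx : 0 < x) (r : ℝ) (w : ℂ) :
    ((x ^ r : ℝ) : ℂ) * (x : ℂ) ^ w = (x : ℂ) ^ (w + r) := by
  rw [Complex.ofReal_cpow hx.le, ← Complex.cpow_add _ _ (by exact_mod_cast hx.ne'), add_comm]

/-- The scaling p = P/(1 + v²) removes v from the real exponential and makes the character linear in
v. The 2 in the exponent is later cancelled by the Jacobian. -/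
theorem mellinKernel_smul {m : ℝ × ℝ} (a b : ℂ) {P : ℝ × ℝ} (hP : P ∈ quadrant) (v : ℝ) :
    mellinKernel m a b ((1 + v ^ 2)⁻¹ • P) v
      = ((1 + v ^ 2 : ℝ) : ℂ) ^ (2 - (a + b - 1 / 2))
        * ((P.1 : ℂ) ^ (a - 1 / 2 - 1) * (P.2 : ℂ) ^ (b - 1 / 2 - 1) * (pairKernel m P : ℂ)
          * echar (-(m.1 * m.2) / √(P.1 * P.2)) v) := by
  have h1 : 0 < P.1 := hP.1
  have h2 : 0 < P.2 := hP.2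
  set l := 1 + v ^ 2 with hl
  have hl0 : 0 < l := by positivity
  have e1 : (l⁻¹ • P).1 = l⁻¹ * P.1 := rfl
  have e2 : (l⁻¹ • P).2 = l⁻¹ * P.2 := rfl
  have hexp : Real.exp (-(Real.pi * ((l⁻¹ * P.1 + l⁻¹ * P.2) * l)
          + Real.pi * ((m.1 ^ 2 / (l⁻¹ * P.2) + m.2 ^ 2 / (l⁻¹ * P.1)) / l))) = pairKernel m P := by
    rw [pairKernel]
    congr 1
    field_simp
  have hch : echar (-(m.1 * m.2) / √(l⁻¹ * P.1 * (l⁻¹ * P.2))) (v / l)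
      = echar (-(m.1 * m.2) / √(P.1 * P.2)) v := by
    have : √(l⁻¹ * P.1 * (l⁻¹ * P.2)) = l⁻¹ * √(P.1 * P.2) := by
      rw [show l⁻¹ * P.1 * (l⁻¹ * P.2) = (l⁻¹) ^ 2 * (P.1 * P.2) by ring,
        Real.sqrt_mul (by positivity), Real.sqrt_sq (by positivity)]
    have hs : 0 < √(P.1 * P.2) := Real.sqrt_pos.mpr (by positivity)
    rw [this, echar, echar]
    congr 1
    rw [show ((2 * Real.pi * (-(m.1 * m.2) / (l⁻¹ * √(P.1 * P.2))) : ℝ) : ℂ) * Complex.I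
        * ((v / l : ℝ) : ℂ) = ((2 * Real.pi * (-(m.1 * m.2) / (l⁻¹ * √(P.1 * P.2))) * (v / l) : ℝ) : ℂ)
        * Complex.I by push_cast; ring,
      show ((2 * Real.pi * (-(m.1 * m.2) / √(P.1 * P.2)) : ℝ) : ℂ) * Complex.I * (v : ℂ)
        = ((2 * Real.pi * (-(m.1 * m.2) / √(P.1 * P.2)) * v : ℝ) : ℂ) * Complex.I by push_cast; ring]
    congr 2
    field_simp
  have hpow : ((l⁻¹ * P.1 : ℝ) : ℂ) ^ (a - 1) * ((l⁻¹ * P.2 : ℝ) : ℂ) ^ (b - 1)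
      * (((l⁻¹ * P.1) ^ (-(1 / 2) : ℝ) * (l⁻¹ * P.2 * l) ^ (-(1 / 2) : ℝ) : ℝ) : ℂ)
      = (l : ℂ) ^ (2 - (a + b - 1 / 2))
        * ((P.1 : ℂ) ^ (a - 1 / 2 - 1) * (P.2 : ℂ) ^ (b - 1 / 2 - 1)) := by
    have hli : 0 < l⁻¹ := inv_pos.mpr hl0
    rw [show l⁻¹ * P.2 * l = P.2 by field_simp, Complex.ofReal_mul (_ ^ _),
      Complex.ofReal_cpow (by positivity), Complex.ofReal_cpow h2.le,
      ofReal_cpow_eq_exp (by positivity), ofReal_cpow_eq_exp (by positivity),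
      ofReal_cpow_eq_exp (by positivity), ofReal_cpow_eq_exp (by positivity),
      ofReal_cpow_eq_exp (by positivity), ofReal_cpow_eq_exp (by positivity),
      ofReal_cpow_eq_exp (by positivity), ← Complex.exp_add, ← Complex.exp_add, ← Complex.exp_add,
      ← Complex.exp_add, ← Complex.exp_add, Real.log_mul hli.ne' h1.ne', Real.log_mul hli.ne' h2.ne',
      Real.log_inv]
    congr 1
    push_cast
    ring
  rw [mellinKernel, e1, e2, ← hl, hexp, hch, Complex.ofReal_mul (_ * _)]
  calc _ = (((l⁻¹ * P.1 : ℝ) : ℂ) ^ (a - 1) * ((l⁻¹ * P.2 : ℝ) : ℂ) ^ (b - 1)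
      * (((l⁻¹ * P.1) ^ (-(1 / 2) : ℝ) * (l⁻¹ * P.2 * l) ^ (-(1 / 2) : ℝ) : ℝ) : ℂ))
      * ((pairKernel m P : ℂ) * echar (-(m.1 * m.2) / √(P.1 * P.2)) v) := by ring
    _ = _ := by rw [hpow]; ring

theorem mellinFourier_univ_eq (m : ℝ × ℝ) (a b : ℂ) :
    mellinFourier Set.univ m a b = ∫ p in quadrant, ∫ v : ℝ, mellinKernel m a b p v := by
  refine setIntegral_congr_fun measurableSet_quadrant fun p hp => ?_
  simp only [cellFourier_univ_eq hp, mellinKernel, integral_const_mul]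

theorem norm_pair_integrand {a b : ℂ} {m P : ℝ × ℝ} (hP : P ∈ quadrant) (v : ℝ) :
    ‖(P.1 : ℂ) ^ (a - 1 / 2 - 1) * (P.2 : ℂ) ^ (b - 1 / 2 - 1) * (pairKernel m P : ℂ)
          * echar (-(m.1 * m.2) / √(P.1 * P.2)) v‖
      = P.1 ^ (a.re - 1 / 2 - 1) * P.2 ^ (b.re - 1 / 2 - 1) * pairKernel m P := by
  rw [norm_mul, norm_echar, mul_one, norm_mul, norm_quadrant_cpow hP, Complex.norm_real,
    Real.norm_of_nonneg (pairKernel_pos m P).le]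
  simp

theorem integrable_pair_integrand {m : ℝ × ℝ} (hm₁ : m.1 ≠ 0) (hm₂ : m.2 ≠ 0) (a b : ℂ) (v : ℝ) :
    IntegrableOn (fun P : ℝ × ℝ => (P.1 : ℂ) ^ (a - 1 / 2 - 1) * (P.2 : ℂ) ^ (b - 1 / 2 - 1)
      * (pairKernel m P : ℂ) * echar (-(m.1 * m.2) / √(P.1 * P.2)) v) quadrant := by
  refine Integrable.mono' (integrableOn_pairKernel hm₁ hm₂ (a.re - 1 / 2 - 1) (b.re - 1 / 2 - 1))
    ?_ ?_
  · have h := measurable_echar_comp (α := ℝ × ℝ)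
      (f := fun P => -(m.1 * m.2) / √(P.1 * P.2)) (g := fun _ => v) (by fun_prop) (by fun_prop)
    exact Measurable.aestronglyMeasurable (by fun_prop)
  · filter_upwards [ae_restrict_mem measurableSet_quadrant] with P hP
    exact (norm_pair_integrand hP v).le

/-- After the scaling, the P-integral of the modulus is a multiple of (1 + v²)^(-(Re (a + b) -
1/2)), which is where Re (a + b) > 1 is needed. -/
theorem integrable_mellinKernel {m : ℝ × ℝ} (hm₁ : m.1 ≠ 0) (hm₂ : m.2 ≠ 0) {a b : ℂ}
    (hab : 1 < (a + b).re) :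
    Integrable (Function.uncurry (mellinKernel m a b))
      ((volume.restrict quadrant).prod volume) := by
  have hmeas := measurable_mellinKernel m a b
  refine (integrable_prod_iff' hmeas.aestronglyMeasurable).mpr ⟨Eventually.of_forall fun v => ?_, ?_⟩
  · have hl : (0 : ℝ) < 1 + v ^ 2 := by positivity
    have h1 : IntegrableOn (fun P : ℝ × ℝ => mellinKernel m a b ((1 + v ^ 2)⁻¹ • P) v) quadrant := by
      have h0 := (integrable_pair_integrand hm₁ hm₂ a b v).const_mul
        (((1 + v ^ 2 : ℝ) : ℂ) ^ (2 - (a + b - 1 / 2)))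
      refine Integrable.congr h0 ?_
      filter_upwards [ae_restrict_mem measurableSet_quadrant] with P hP
      exact (mellinKernel_smul a b hP v).symm
    rw [← integrable_indicator_iff measurableSet_quadrant] at h1
    have h2 := (integrable_comp_smul_iff volume (quadrant.indicator fun p => mellinKernel m a b p v)
      (inv_ne_zero hl.ne')).mp ?_
    · exact (integrable_indicator_iff measurableSet_quadrant).mp h2
    · refine h1.congr (Eventually.of_forall fun P => ?_)
      have : P ∈ quadrant ↔ (1 + v ^ 2)⁻¹ • P ∈ quadrant := by
        simp [quadrant, hl]
      beta_reduce
      by_cases hP : P ∈ quadrant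
      · rw [Set.indicator_of_mem hP, Set.indicator_of_mem (this.mp hP)]
      · rw [Set.indicator_of_notMem hP, Set.indicator_of_notMem fun h => hP (this.mpr h)]
  · have e : ∀ v : ℝ, ∫ p in quadrant, ‖mellinKernel m a b p v‖
        = (1 + v ^ 2) ^ (-((a + b).re - 1 / 2)) * ∫ P in quadrant,
          P.1 ^ (a.re - 1 / 2 - 1) * P.2 ^ (b.re - 1 / 2 - 1) * pairKernel m P := by
      intro v
      have hl : (0 : ℝ) < 1 + v ^ 2 := by positivity
      have h3 : ∀ P ∈ quadrant, ‖mellinKernel m a b ((1 + v ^ 2)⁻¹ • P) v‖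
          = (1 + v ^ 2) ^ (2 - ((a + b).re - 1 / 2))
            * (P.1 ^ (a.re - 1 / 2 - 1) * P.2 ^ (b.re - 1 / 2 - 1) * pairKernel m P) := by
        intro P hP
        rw [mellinKernel_smul a b hP v, norm_mul, norm_pair_integrand hP, norm_ofReal_cpow hl]
        simp
      rw [setIntegral_quadrant_scale hl, setIntegral_congr_fun measurableSet_quadrant h3,
        integral_const_mul, smul_eq_mul, ← mul_assoc]
      congr 1
      rw [show -((a + b).re - 1 / 2) = (2 - ((a + b).re - 1 / 2)) - 2 by ring,
        Real.rpow_sub hl _ 2, Real.rpow_two]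
      field_simp
    simp only [Function.uncurry_apply_pair, e]
    exact (integrable_one_add_sq_rpow (by linarith)).mul_const _

theorem mellinFourier_univ_eq_integral {m : ℝ × ℝ} (hm₁ : m.1 ≠ 0) (hm₂ : m.2 ≠ 0) {a b : ℂ}
    (hab : 1 < (a + b).re) :
    mellinFourier Set.univ m a b = ∫ v : ℝ, ((1 + v ^ 2 : ℝ) : ℂ) ^ (-(a + b - 1 / 2))
      * ∫ P in quadrant, (P.1 : ℂ) ^ (a - 1 / 2 - 1) * (P.2 : ℂ) ^ (b - 1 / 2 - 1)
        * (pairKernel m P : ℂ) * echar (-(m.1 * m.2) / √(P.1 * P.2)) v := by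
  rw [mellinFourier_univ_eq, integral_integral_swap (integrable_mellinKernel hm₁ hm₂ hab)]
  refine integral_congr_ae (Eventually.of_forall fun v => ?_)
  have hl : (0 : ℝ) < 1 + v ^ 2 := by positivity
  have hlc : ((1 + v ^ 2 : ℝ) : ℂ) ≠ 0 := by exact_mod_cast hl.ne'
  simp only []
  rw [setIntegral_quadrant_scale hl,
    setIntegral_congr_fun measurableSet_quadrant fun P hP => mellinKernel_smul a b hP v,
    integral_const_mul, Complex.real_smul, ← mul_assoc]
  congr 1
  rw [show -(a + b - 1 / 2) = (2 - (a + b - 1 / 2)) - 2 by ring, Complex.cpow_sub _ 2 hlc,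
    Complex.cpow_ofNat]
  push_cast
  field_simp

theorem integral_gaussian_echar {t : ℝ} (ht : 0 < t) (r : ℝ) :
    ∫ v : ℝ, (Real.exp (-(Real.pi * t) * v ^ 2) : ℂ) * echar r v
      = ((t ^ (-(1 / 2) : ℝ) * Real.exp (-(Real.pi * r ^ 2 / t)) : ℝ) : ℂ) := by
  have h := integral_gaussian_quadratic ht (((2 * Real.pi * r : ℝ) : ℂ) * Complex.I) 0
  have e : ∀ v : ℝ, (Real.exp (-(Real.pi * t) * v ^ 2) : ℂ) * echar r v
      = Complex.exp (((-(Real.pi * t) : ℝ) : ℂ) * (v : ℂ) ^ 2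
        + ((2 * Real.pi * r : ℝ) : ℂ) * Complex.I * v + 0) := by
    intro v
    rw [echar, Complex.ofReal_exp, ← Complex.exp_add]
    congr 1
    push_cast
    ring
  simp_rw [e]
  rw [h, Complex.ofReal_mul (t ^ _)]
  congr 1
  rw [Complex.ofReal_exp]
  congr 1
  have : (Real.pi : ℂ) ≠ 0 := by exact_mod_cast Real.pi_ne_zero
  have : (t : ℂ) ≠ 0 := by exact_mod_cast ht.ne'
  rw [mul_pow, Complex.I_sq]
  push_cast
  field_simp
  ring

/-- The integrand in the passage from `mellinFourier` to `besselIntegral`. -/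
def besselPhase (m : ℝ × ℝ) (a b : ℂ) (z : (ℝ × ℝ) × ℝ) (v : ℝ) : ℂ :=
  ((z.1.1 : ℂ) ^ (a - 1 / 2 - 1) * (z.1.2 : ℂ) ^ (b - 1 / 2 - 1) * (pairKernel m z.1 : ℂ))
    * ((z.2 : ℂ) ^ (a + b - 1 / 2 - 1) * (Real.exp (-(Real.pi * z.2)) : ℂ))
    * ((Real.exp (-(Real.pi * z.2) * v ^ 2) : ℂ) * echar (-(m.1 * m.2) / √(z.1.1 * z.1.2)) v)

theorem integral_besselPhase (m : ℝ × ℝ) (a b : ℂ) {z : (ℝ × ℝ) × ℝ} (hz : z ∈ octant) :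
    ∫ v : ℝ, besselPhase m a b z v
      = (z.1.1 : ℂ) ^ (a - 1 / 2 - 1) * (z.1.2 : ℂ) ^ (b - 1 / 2 - 1)
        * (z.2 : ℂ) ^ (a + b - 1 / 2 - 1 / 2 - 1) * (besselKernel m z : ℂ) := by
  have h1 : 0 < z.1.1 := hz.1.1
  have h2 : 0 < z.1.2 := hz.1.2
  have h3 : 0 < z.2 := hz.2
  simp only [besselPhase]
  rw [integral_const_mul, integral_gaussian_echar h3]
  have e1 : (-(m.1 * m.2) / √(z.1.1 * z.1.2)) ^ 2 = (m.1 * m.2) ^ 2 / (z.1.1 * z.1.2) := by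
    rw [div_pow, Real.sq_sqrt (by positivity), neg_sq]
  have e2 : (z.2 : ℂ) ^ (a + b - 1 / 2 - 1 / 2 - 1)
      = ((z.2 ^ (-(1 / 2) : ℝ) : ℝ) : ℂ) * (z.2 : ℂ) ^ (a + b - 1 / 2 - 1) := by
    rw [ofReal_rpow_mul_cpow h3]
    congr 1
    push_cast
    ring
  rw [e1, e2, besselKernel, mul_div_assoc Real.pi]
  push_cast
  ring_nf

theorem integrable_besselPhase {m : ℝ × ℝ} (hm₁ : m.1 ≠ 0) (hm₂ : m.2 ≠ 0) {a b : ℂ}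
    (hab : 1 < (a + b).re) :
    Integrable (Function.uncurry (besselPhase m a b)) ((volume.restrict octant).prod volume) := by
  have hmeas : Measurable (Function.uncurry (besselPhase m a b)) := by
    unfold Function.uncurry besselPhase
    have h := measurable_echar_comp (α := ((ℝ × ℝ) × ℝ) × ℝ)
      (f := fun z => -(m.1 * m.2) / √(z.1.1.1 * z.1.1.2)) (g := fun z => z.2)
      (by fun_prop) (by fun_prop)
    fun_prop
  have hnorm : ∀ z ∈ octant, ∀ v, ‖besselPhase m a b z v‖
      = (z.1.1 ^ (a.re - 1 / 2 - 1) * z.1.2 ^ (b.re - 1 / 2 - 1) * pairKernel m z.1)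
        * (z.2 ^ ((a + b).re - 1 / 2 - 1) * Real.exp (-(Real.pi * z.2)))
        * Real.exp (-(Real.pi * z.2) * v ^ 2) := by
    intro z hz v
    have h3 : 0 < z.2 := hz.2
    rw [besselPhase, norm_mul, norm_mul, norm_mul, norm_quadrant_cpow hz.1, Complex.norm_real,
      Real.norm_of_nonneg (pairKernel_pos m z.1).le, norm_mul, norm_ofReal_cpow h3, Complex.norm_real,
      Real.norm_of_nonneg (Real.exp_pos _).le, norm_mul, norm_echar, mul_one, Complex.norm_real,
      Real.norm_of_nonneg (Real.exp_pos _).le]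
    simp
  refine (integrable_prod_iff hmeas.aestronglyMeasurable).mpr ⟨?_, ?_⟩
  · filter_upwards [ae_restrict_mem measurableSet_octant] with z hz
    have h3 : 0 < z.2 := hz.2
    refine (integrable_norm_iff (hmeas.comp measurable_prodMk_left).aestronglyMeasurable).mp ?_
    refine ((integrable_exp_neg_mul_sq (by positivity : 0 < Real.pi * z.2)).const_mul _).congr
      (Eventually.of_forall fun v => (hnorm z hz v).symm)
  · have h := (integrableOn_pairKernel hm₁ hm₂ (a.re - 1 / 2 - 1) (b.re - 1 / 2 - 1)).mul_prod
      (integrableOn_rpow_mul_exp (by linarith : 0 < (a + b).re - 1 / 2 - 1 / 2) Real.pi_pos)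
    rw [← volume_restrict_octant] at h
    refine h.congr ?_
    filter_upwards [ae_restrict_mem measurableSet_octant] with z hz
    have h3 : 0 < z.2 := hz.2
    simp only [Function.uncurry_apply_pair, hnorm z hz]
    rw [integral_const_mul, integral_gaussian, div_mul_cancel_left₀ Real.pi_pos.ne', Real.sqrt_inv,
      Real.sqrt_eq_rpow, show (a + b).re - 1 / 2 - 1 / 2 - 1 = (a + b).re - 1 / 2 - 1 - 1 / 2 by ring,
      Real.rpow_sub h3 _ (1 / 2)]
    ring

/-- Evaluation of the Mellin transform in terms of the Bessel integral, in the range of absolute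
convergence. -/
theorem Gamma_mul_mellinFourier_univ {m : ℝ × ℝ} (hm₁ : m.1 ≠ 0) (hm₂ : m.2 ≠ 0) {a b : ℂ}
    (hab : 1 < (a + b).re) :
    (Real.pi : ℂ) ^ (-(a + b - 1 / 2)) * Complex.Gamma (a + b - 1 / 2)
      * mellinFourier Set.univ m a b = besselIntegral m a b := by
  have hc : 0 < (a + b - 1 / 2).re := by
    rw [Complex.sub_re]
    norm_num
    rw [Complex.add_re] at hab
    linarith
  have h1 : besselIntegral m a b = ∫ z in octant, ∫ v : ℝ, besselPhase m a b z v :=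
    setIntegral_congr_fun measurableSet_octant fun z hz => (integral_besselPhase m a b hz).symm
  rw [h1, integral_integral_swap (integrable_besselPhase hm₁ hm₂ hab),
    mellinFourier_univ_eq_integral hm₁ hm₂ hab, ← integral_const_mul]
  refine integral_congr_ae (Eventually.of_forall fun v => ?_)
  have hl : (0 : ℝ) < 1 + v ^ 2 := by positivity
  -- The Gamma factor times (1 + v²)^(-(a + b - 1/2)) is an integral over a third positive variable.
  -- The v-integral then becomes a Gaussian with a character, evaluated in `integral_besselPhase`.
  have h2 := integral_cpow_mul_exp hc (by positivity : 0 < Real.pi * (1 + v ^ 2))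
  rw [Complex.ofReal_mul, Complex.mul_cpow_ofReal_nonneg Real.pi_pos.le hl.le] at h2
  have e : ∀ z : (ℝ × ℝ) × ℝ, besselPhase m a b z v
      = ((z.1.1 : ℂ) ^ (a - 1 / 2 - 1) * (z.1.2 : ℂ) ^ (b - 1 / 2 - 1) * (pairKernel m z.1 : ℂ)
        * echar (-(m.1 * m.2) / √(z.1.1 * z.1.2)) v)
        * ((z.2 : ℂ) ^ (a + b - 1 / 2 - 1)
          * (Real.exp (-(Real.pi * (1 + v ^ 2) * z.2)) : ℂ)) := by
    intro z
    rw [besselPhase, show -(Real.pi * (1 + v ^ 2) * z.2)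
      = -(Real.pi * z.2) + -(Real.pi * z.2) * v ^ 2 by ring, Real.exp_add, Complex.ofReal_mul]
    ring
  simp only [e]
  rw [volume_restrict_octant, integral_prod_mul
    (fun P : ℝ × ℝ => (P.1 : ℂ) ^ (a - 1 / 2 - 1) * (P.2 : ℂ) ^ (b - 1 / 2 - 1)
      * (pairKernel m P : ℂ) * echar (-(m.1 * m.2) / √(P.1 * P.2)) v)
    (fun t : ℝ => (t : ℂ) ^ (a + b - 1 / 2 - 1)
      * (Real.exp (-(Real.pi * (1 + v ^ 2) * t)) : ℂ)), h2]
  ring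

/-! ### Holomorphy and analytic continuation -/

/-- Holomorphy in `z` of an integral `∫ φ exp (z₁ α + z₂ β)` which converges absolutely near `z₀`. -/
theorem differentiableAt_integral_mul_exp {X : Type*} [MeasurableSpace X] {ν : Measure X}
    {φ : X → ℂ} {α β : X → ℝ} (hφ : AEStronglyMeasurable φ ν) (hα : Measurable α)
    (hβ : Measurable β) {z₀ : ℂ × ℂ} {r : ℝ} (hr : 0 < r)
    (h : ∀ p q : ℝ, |p - z₀.1.re| ≤ r → |q - z₀.2.re| ≤ r →
      Integrable (fun x => ‖φ x‖ * Real.exp (p * α x + q * β x)) ν) :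
    DifferentiableAt ℂ
      (fun z : ℂ × ℂ => ∫ x, φ x * Complex.exp (z.1 * (α x : ℂ) + z.2 * (β x : ℂ)) ∂ν) z₀ := by
  have hmeas : ∀ z : ℂ × ℂ, AEStronglyMeasurable
      (fun x => φ x * Complex.exp (z.1 * (α x : ℂ) + z.2 * (β x : ℂ))) ν := fun z =>
    hφ.mul (Measurable.aestronglyMeasurable (by fun_prop))
  have hnorm : ∀ (z : ℂ × ℂ) x, ‖φ x * Complex.exp (z.1 * (α x : ℂ) + z.2 * (β x : ℂ))‖
      = ‖φ x‖ * Real.exp (z.1.re * α x + z.2.re * β x) := by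
    intro z x
    rw [norm_mul, Complex.norm_exp]
    simp
  set p := z₀.1.re
  set q := z₀.2.re
  have hint : ∀ s ∈ ({r, -r} : Set ℝ), ∀ t ∈ ({r, -r} : Set ℝ),
      Integrable (fun x => ‖φ x‖ * Real.exp ((p + s) * α x + (q + t) * β x)) ν := by
    intro s hs t ht
    refine h _ _ ?_ ?_
    · rcases hs with rfl | rfl <;> simp [abs_of_pos hr]
    · rcases ht with rfl | rfl <;> simp [abs_of_pos hr]
  let F' : ℂ × ℂ → X → (ℂ × ℂ →L[ℂ] ℂ) := fun z x =>
    (φ x * Complex.exp (z.1 * (α x : ℂ) + z.2 * (β x : ℂ))) •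
      ((α x : ℂ) • ContinuousLinearMap.fst ℂ ℂ ℂ + (β x : ℂ) • ContinuousLinearMap.snd ℂ ℂ ℂ)
  -- On the ball of radius r/2 the derivative is at most ‖φ‖ exp (pα + qβ + (r/2)(|α| + |β|)) (|α| +
  -- |β|). The linear factor costs another (2/r) exp ((r/2)(|α| + |β|)), and exp (r|α| + r|β|) is at
  -- most the sum over the four corners (±r, ±r).
  refine (hasFDerivAt_integral_of_dominated_of_fderiv_le (F' := F')
    (bound := fun x => 2 / r * ((‖φ x‖ * Real.exp ((p + r) * α x + (q + r) * β x)
      + ‖φ x‖ * Real.exp ((p + r) * α x + (q + -r) * β x))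
      + (‖φ x‖ * Real.exp ((p + -r) * α x + (q + r) * β x)
      + ‖φ x‖ * Real.exp ((p + -r) * α x + (q + -r) * β x))))
    (Metric.ball_mem_nhds z₀ (half_pos hr)) (Eventually.of_forall hmeas) ?_ ?_ ?_ ?_
    ?_).differentiableAt
  · refine (integrable_norm_iff (hmeas z₀)).mp ?_
    simp only [hnorm]
    exact h p q (by simp [hr.le]) (by simp [hr.le])
  · refine (hmeas z₀).smul (AEStronglyMeasurable.add ?_ ?_)
    · exact (Measurable.aestronglyMeasurable (by fun_prop)).smul_const _
    · exact (Measurable.aestronglyMeasurable (by fun_prop)).smul_const _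
  · refine Eventually.of_forall fun x z hz => ?_
    have hd : |z.1.re - p| ≤ r / 2 ∧ |z.2.re - q| ≤ r / 2 := by
      rw [Metric.mem_ball, dist_eq_norm, Prod.norm_def, max_lt_iff] at hz
      constructor
      · refine le_trans ?_ hz.1.le
        simpa [p] using Complex.abs_re_le_norm (z.1 - z₀.1)
      · refine le_trans ?_ hz.2.le
        simpa [q] using Complex.abs_re_le_norm (z.2 - z₀.2)
    have h1 : ‖F' z x‖ ≤ ‖φ x‖ * Real.exp (z.1.re * α x + z.2.re * β x) * (|α x| + |β x|) := by
      rw [norm_smul, hnorm]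
      gcongr
      refine (norm_add_le _ _).trans ?_
      rw [norm_smul, norm_smul, Complex.norm_real, Complex.norm_real, Real.norm_eq_abs,
        Real.norm_eq_abs]
      have e1 := ContinuousLinearMap.norm_fst_le ℂ ℂ ℂ
      have e2 := ContinuousLinearMap.norm_snd_le ℂ ℂ ℂ
      nlinarith [abs_nonneg (α x), abs_nonneg (β x)]
    have h2 : |α x| + |β x| ≤ 2 / r * Real.exp (r / 2 * (|α x| + |β x|)) := by
      have := Real.add_one_le_exp (r / 2 * (|α x| + |β x|))
      calc |α x| + |β x| = 2 / r * (r / 2 * (|α x| + |β x|)) := by field_simp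
        _ ≤ _ := by gcongr; linarith
    have h3 : z.1.re * α x + z.2.re * β x
        ≤ p * α x + q * β x + r / 2 * (|α x| + |β x|) := by
      have e1 : (z.1.re - p) * α x ≤ r / 2 * |α x| := by
        refine (le_abs_self _).trans ?_
        rw [abs_mul]
        gcongr
        exact hd.1
      have e2 : (z.2.re - q) * β x ≤ r / 2 * |β x| := by
        refine (le_abs_self _).trans ?_
        rw [abs_mul]
        gcongr
        exact hd.2
      linarith
    have h4 : Real.exp (p * α x + q * β x + r / 2 * (|α x| + |β x|))
        * Real.exp (r / 2 * (|α x| + |β x|))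
        = Real.exp (p * α x + q * β x) * (Real.exp |r * α x| * Real.exp |r * β x|) := by
      rw [← Real.exp_add, ← Real.exp_add, ← Real.exp_add, abs_mul, abs_mul, abs_of_pos hr]
      congr 1
      ring
    have h5 : ∀ t : ℝ, Real.exp |t| ≤ Real.exp t + Real.exp (-t) := by
      intro t
      rcases abs_cases t with ⟨e, -⟩ | ⟨e, -⟩ <;> rw [e] <;>
        linarith [Real.exp_pos t, Real.exp_pos (-t)]
    have h6 : ∀ s t : ℝ, Real.exp ((p + s) * α x + (q + t) * β x)
        = Real.exp (p * α x + q * β x) * (Real.exp (s * α x) * Real.exp (t * β x)) := by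
      intro s t
      rw [← Real.exp_add, ← Real.exp_add]
      congr 1
      ring
    calc ‖F' z x‖ ≤ ‖φ x‖ * Real.exp (p * α x + q * β x + r / 2 * (|α x| + |β x|))
          * (2 / r * Real.exp (r / 2 * (|α x| + |β x|))) := h1.trans (by gcongr)
      _ = 2 / r * ‖φ x‖ * (Real.exp (p * α x + q * β x + r / 2 * (|α x| + |β x|))
        * Real.exp (r / 2 * (|α x| + |β x|))) := by ring
      _ ≤ 2 / r * ‖φ x‖ * (Real.exp (p * α x + q * β x)
          * ((Real.exp (r * α x) + Real.exp (-(r * α x)))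
            * (Real.exp (r * β x) + Real.exp (-(r * β x))))) := by
        rw [h4]
        gcongr
        · exact h5 _
        · exact h5 _
      _ = _ := by
        simp only [h6, neg_mul]
        ring
  · exact (((hint r (by simp) r (by simp)).add (hint r (by simp) (-r) (by simp))).add
      ((hint (-r) (by simp) r (by simp)).add (hint (-r) (by simp) (-r) (by simp)))).const_mul _
  · refine Eventually.of_forall fun x z _ => ?_
    have h1 : HasFDerivAt (fun z : ℂ × ℂ => z.1 * (α x : ℂ) + z.2 * (β x : ℂ))
        ((α x : ℂ) • ContinuousLinearMap.fst ℂ ℂ ℂ + (β x : ℂ) • ContinuousLinearMap.snd ℂ ℂ ℂ) z :=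
      (hasFDerivAt_fst.mul_const _).add (hasFDerivAt_snd.mul_const _)
    have h2 := h1.cexp.const_mul (φ x)
    rwa [smul_smul] at h2

theorem differentiable_besselIntegral {m : ℝ × ℝ} (hm₁ : m.1 ≠ 0) (hm₂ : m.2 ≠ 0) :
    Differentiable ℂ fun z : ℂ × ℂ => besselIntegral m z.1 z.2 := by
  -- The integrand at a = b = 0; the parameters enter as exponentials of a (log P₁ + log τ) + b (log
  -- P₂ + log τ), with τ the third variable.
  let φ : (ℝ × ℝ) × ℝ → ℝ := fun x =>
    x.1.1 ^ (-(3 / 2) : ℝ) * x.1.2 ^ (-(3 / 2) : ℝ) * x.2 ^ (-2 : ℝ) * besselKernel m x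
  have e : (fun z : ℂ × ℂ => besselIntegral m z.1 z.2) = fun z => ∫ x in octant,
      (φ x : ℂ) * Complex.exp (z.1 * ((Real.log x.1.1 + Real.log x.2 : ℝ) : ℂ)
        + z.2 * ((Real.log x.1.2 + Real.log x.2 : ℝ) : ℂ)) := by
    funext z
    refine setIntegral_congr_fun measurableSet_octant fun x hx => ?_
    have h1 : 0 < x.1.1 := hx.1.1
    have h2 : 0 < x.1.2 := hx.1.2
    have h3 : 0 < x.2 := hx.2
    simp only [φ]
    rw [Complex.ofReal_mul, Complex.ofReal_mul, Complex.ofReal_mul, Complex.ofReal_cpow h1.le,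
      Complex.ofReal_cpow h2.le, Complex.ofReal_cpow h3.le, ofReal_cpow_eq_exp h1,
      ofReal_cpow_eq_exp h2, ofReal_cpow_eq_exp h3, ofReal_cpow_eq_exp h1, ofReal_cpow_eq_exp h2,
      ofReal_cpow_eq_exp h3, ← Complex.exp_add, ← Complex.exp_add, ← Complex.exp_add,
      ← Complex.exp_add, mul_right_comm, ← Complex.exp_add]
    congr 2
    push_cast
    ring
  rw [e]
  intro z₀
  refine differentiableAt_integral_mul_exp ?_ (by fun_prop) (by fun_prop) one_pos fun p q _ _ => ?_
  · exact Measurable.aestronglyMeasurable (by fun_prop)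
  · refine Integrable.congr (integrableOn_besselKernel hm₁ hm₂ (p - 3 / 2) (q - 3 / 2) (p + q - 2)) ?_
    filter_upwards [ae_restrict_mem measurableSet_octant] with x hx
    have h1 : 0 < x.1.1 := hx.1.1
    have h2 : 0 < x.1.2 := hx.1.2
    have h3 : 0 < x.2 := hx.2
    have h4 : 0 < besselKernel m x := mul_pos (pairKernel_pos m _) (by positivity)
    rw [Complex.norm_real, Real.norm_of_nonneg (by positivity)]
    simp only [φ]
    rw [Real.rpow_def_of_pos h1, Real.rpow_def_of_pos h2, Real.rpow_def_of_pos h3,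
      Real.rpow_def_of_pos h1, Real.rpow_def_of_pos h2, Real.rpow_def_of_pos h3,
      ← Real.exp_add, ← Real.exp_add, ← Real.exp_add, ← Real.exp_add, mul_right_comm,
      ← Real.exp_add]
    congr 2
    ring

theorem differentiableAt_mellinFourier {m : ℝ × ℝ} (hm₁ : m.1 ≠ 0) (hm₂ : m.2 ≠ 0) {z₀ : ℂ × ℂ}
    (ha : 0 < z₀.1.re) (hb : 0 < z₀.2.re) (hab : 1 / 2 < z₀.1.re + z₀.2.re) :
    DifferentiableAt ℂ (fun z : ℂ × ℂ => mellinFourier Set.univ m z.1 z.2) z₀ := by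
  let φ : ℝ × ℝ → ℂ := fun x =>
    ((x.1 ^ (-1 : ℝ) * x.2 ^ (-1 : ℝ) : ℝ) : ℂ) * cellFourier Set.univ m x
  have e : (fun z : ℂ × ℂ => mellinFourier Set.univ m z.1 z.2) = fun z => ∫ x in quadrant,
      φ x * Complex.exp (z.1 * (Real.log x.1 : ℂ) + z.2 * (Real.log x.2 : ℂ)) := by
    funext z
    refine setIntegral_congr_fun measurableSet_quadrant fun x hx => ?_
    have h1 : 0 < x.1 := hx.1
    have h2 : 0 < x.2 := hx.2
    simp only [φ]
    rw [Complex.ofReal_mul, Complex.ofReal_cpow h1.le, Complex.ofReal_cpow h2.le,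
      ofReal_cpow_eq_exp h1, ofReal_cpow_eq_exp h2, ofReal_cpow_eq_exp h1, ofReal_cpow_eq_exp h2,
      ← Complex.exp_add, ← Complex.exp_add, mul_right_comm, ← Complex.exp_add]
    congr 2
    push_cast
    ring
  rw [e]
  -- Moving both exponents by r and taking δ < r costs less than 3r. A quarter of the excess over
  -- 1/2 therefore keeps p + q > 1/2 + δ.
  obtain ⟨r, hr, hr1⟩ := exists_between (lt_min (lt_min ha hb)
    (by linarith : 0 < (z₀.1.re + z₀.2.re - 1 / 2) / 4))
  obtain ⟨hr1, hr3⟩ := lt_min_iff.mp hr1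
  obtain ⟨hr1, hr2⟩ := lt_min_iff.mp hr1
  refine differentiableAt_integral_mul_exp ?_ (by fun_prop) (by fun_prop) hr fun p q hp hq => ?_
  · exact (Measurable.aestronglyMeasurable (by fun_prop)).mul
      (measurable_cellFourier _ m).aestronglyMeasurable
  · have hp' := abs_le.mp hp
    have hq' := abs_le.mp hq
    obtain ⟨δ, hδ, hδ1⟩ := exists_between (lt_min hr one_pos)
    obtain ⟨hδ2, hδ3⟩ := lt_min_iff.mp hδ1
    refine Integrable.mono' (integrableOn_slabBound m (by linarith : 0 < p) (by linarith : 0 < q) hδ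
      (by linarith)) ?_ ?_
    · refine AEStronglyMeasurable.mul ?_ (Measurable.aestronglyMeasurable (by fun_prop))
      exact ((Measurable.aestronglyMeasurable (by fun_prop)).mul
        (measurable_cellFourier _ m).aestronglyMeasurable).norm
    · filter_upwards [ae_restrict_mem measurableSet_quadrant] with x hx
      have h1 : 0 < x.1 := hx.1
      have h2 : 0 < x.2 := hx.2
      rw [Real.norm_of_nonneg (by positivity), norm_mul, Complex.norm_real,
        Real.norm_of_nonneg (by positivity)]
      have h3 := norm_cellFourier_univ_le hm₁ hm₂ hδ hδ3 hx
      calc _ = x.1 ^ (p - 1) * x.2 ^ (q - 1) * ‖cellFourier Set.univ m x‖ := by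
            rw [Real.rpow_def_of_pos h1, Real.rpow_def_of_pos h2, Real.rpow_def_of_pos h1,
              Real.rpow_def_of_pos h2, ← Real.exp_add, ← Real.exp_add, mul_right_comm,
              ← Real.exp_add]
            congr 2
            ring
        _ ≤ _ := by gcongr

/-- Identity theorem in a, with b fixed, on the half plane Re a > max (0, 1/2 - Re b): both sides
are analytic there and agree where Re (a + b) > 1. -/
theorem mellinFourier_univ_eq_besselIntegral {m : ℝ × ℝ} (hm₁ : m.1 ≠ 0) (hm₂ : m.2 ≠ 0) {a b : ℂ}
    (ha : 0 < a.re) (hb : 0 < b.re) (hab : 1 / 2 < (a + b).re) :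
    mellinFourier Set.univ m a b = (Real.pi : ℂ) ^ (a + b - 1 / 2)
      * (Complex.Gamma (a + b - 1 / 2))⁻¹ * besselIntegral m a b := by
  have hpi : (Real.pi : ℂ) ≠ 0 := by exact_mod_cast Real.pi_ne_zero
  let U : Set ℂ := {z | max 0 (1 / 2 - b.re) < z.re}
  have hU : IsOpen U := isOpen_lt continuous_const Complex.continuous_re
  have hUc : IsPreconnected U := (convex_halfSpace_re_gt _).isPreconnected
  have hf : AnalyticOnNhd ℂ (fun z => mellinFourier Set.univ m z b) U := by
    refine DifferentiableOn.analyticOnNhd (fun z hz => ?_) hU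
    obtain ⟨h1, h2⟩ := max_lt_iff.mp (show max 0 (1 / 2 - b.re) < z.re from hz)
    have h := differentiableAt_mellinFourier hm₁ hm₂ (z₀ := (z, b)) h1 hb (by
      simp only; linarith)
    exact (h.comp (f := fun z : ℂ => (z, b)) z (by fun_prop)).differentiableWithinAt
  have hg : AnalyticOnNhd ℂ (fun z => (Real.pi : ℂ) ^ (z + b - 1 / 2)
      * (Complex.Gamma (z + b - 1 / 2))⁻¹ * besselIntegral m z b) U := by
    refine DifferentiableOn.analyticOnNhd (Differentiable.differentiableOn ?_) hU
    have h1 : Differentiable ℂ fun z : ℂ => (Real.pi : ℂ) ^ (z + b - 1 / 2) :=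
      Differentiable.const_cpow (by fun_prop) (Or.inl hpi)
    have h2 : Differentiable ℂ fun z : ℂ => (Complex.Gamma (z + b - 1 / 2))⁻¹ :=
      Differentiable.comp (f := fun z : ℂ => z + b - 1 / 2) Complex.differentiable_one_div_Gamma
        (by fun_prop)
    have h3 : Differentiable ℂ fun z : ℂ => besselIntegral m z b :=
      Differentiable.comp (f := fun z : ℂ => (z, b)) (differentiable_besselIntegral hm₁ hm₂)
        (by fun_prop)
    exact (h1.mul h2).mul h3
  let z₁ : ℂ := ((1 + |b.re| : ℝ) : ℂ)
  have hz₁ : (1 : ℝ) - b.re < z₁.re := by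
    simp only [z₁, Complex.ofReal_re]
    linarith [neg_abs_le b.re, le_abs_self b.re, abs_of_pos hb]
  have hzU : z₁ ∈ U := by
    have h0 : 0 < z₁.re := by
      simp only [z₁, Complex.ofReal_re]
      positivity
    exact max_lt h0 (by linarith : 1 / 2 - b.re < z₁.re)
  have hev : (fun z => mellinFourier Set.univ m z b) =ᶠ[𝓝 z₁]
      fun z => (Real.pi : ℂ) ^ (z + b - 1 / 2)
        * (Complex.Gamma (z + b - 1 / 2))⁻¹ * besselIntegral m z b := by
    filter_upwards [(isOpen_lt continuous_const Complex.continuous_re).mem_nhds hz₁] with z hz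
    have hz : 1 - b.re < z.re := hz
    have h1 := Gamma_mul_mellinFourier_univ hm₁ hm₂ (a := z) (b := b) (by
      rw [Complex.add_re]; linarith)
    have h2 : Complex.Gamma (z + b - 1 / 2) ≠ 0 := by
      refine Complex.Gamma_ne_zero_of_re_pos ?_
      rw [Complex.sub_re, Complex.add_re]
      norm_num
      linarith
    have h3 : (Real.pi : ℂ) ^ (z + b - 1 / 2) ≠ 0 := by simp [Complex.cpow_eq_zero_iff, hpi]
    rw [← h1, Complex.cpow_neg]
    generalize Complex.Gamma (z + b - 1 / 2) = G at h2 ⊢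
    field_simp
  rw [Complex.add_re] at hab
  exact hf.eqOn_of_preconnected_of_eventuallyEq hg hUc hzU hev
    (show max 0 (1 / 2 - b.re) < a.re from max_lt ha (by linarith))

/-- The analytic continuation of the integral of `cellFn a b` against the character `psi m`. -/
def cellWhittaker (m : ℝ × ℝ) (a b : ℂ) : ℂ :=
  (Real.pi : ℂ) ^ (a + b) * ((Complex.Gamma a)⁻¹ * (Complex.Gamma b)⁻¹)
    * ((Real.pi : ℂ) ^ (a + b - 1 / 2) * (Complex.Gamma (a + b - 1 / 2))⁻¹ * besselIntegral m a b)

theorem setIntegral_cellFn_eq_mellinFourier {a b : ℂ} (ha : 0 < a.re) (hb : 0 < b.re)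
    {S : Set (ℝ × ℝ × ℝ)}
    (hS : IntegrableOn (fun x : ℝ × ℝ × ℝ => q₁ x ^ (-a.re) * q₂ x ^ (-b.re)) S) (m : ℝ × ℝ) :
    ∫ x in S, cellFn a b x * psi m x = (Real.pi : ℂ) ^ (a + b)
      * ((Complex.Gamma a)⁻¹ * (Complex.Gamma b)⁻¹) * mellinFourier S m a b := by
  have hpi : (Real.pi : ℂ) ≠ 0 := by exact_mod_cast Real.pi_ne_zero
  have h3 : (Real.pi : ℂ) ^ (a + b) ≠ 0 := by simp [Complex.cpow_eq_zero_iff, hpi]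
  rw [mellinFourier, ← setIntegral_cellFn_mul_psi ha hb hS m, Complex.cpow_neg]
  have h1 := Complex.Gamma_ne_zero_of_re_pos ha
  have h2 := Complex.Gamma_ne_zero_of_re_pos hb
  field_simp

theorem mul_mellinFourier_univ_eq_cellWhittaker {m : ℝ × ℝ} (hm₁ : m.1 ≠ 0) (hm₂ : m.2 ≠ 0)
    {a b : ℂ} (ha : 0 < a.re) (hb : 0 < b.re) (hab : 1 / 2 < (a + b).re) :
    (Real.pi : ℂ) ^ (a + b) * ((Complex.Gamma a)⁻¹ * (Complex.Gamma b)⁻¹)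
      * mellinFourier Set.univ m a b = cellWhittaker m a b := by
  rw [cellWhittaker, mellinFourier_univ_eq_besselIntegral hm₁ hm₂ ha hb hab]

theorem integral_cellFn_mul_psi {m : ℝ × ℝ} (hm₁ : m.1 ≠ 0) (hm₂ : m.2 ≠ 0) {a b : ℂ}
    (ha : 1 / 2 < a.re) (hb : 1 / 2 < b.re) :
    ∫ x, cellFn a b x * psi m x = cellWhittaker m a b := by
  have h := setIntegral_cellFn_eq_mellinFourier (by linarith) (by linarith)
    (S := Set.univ) (integrable_q_rpow ha hb).integrableOn m
  rw [Measure.restrict_univ] at h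
  rw [h, mul_mellinFourier_univ_eq_cellWhittaker hm₁ hm₂ (by linarith) (by linarith)]
  rw [Complex.add_re]
  linarith

/-- The Bessel kernel involves m₁, m₂ and m₁ m₂ only through their squares. -/
theorem cellWhittaker_neg (m : ℝ × ℝ) (a b : ℂ) : cellWhittaker (-m) a b = cellWhittaker m a b := by
  simp [cellWhittaker, besselIntegral, besselKernel, pairKernel]

theorem differentiable_cellWhittaker {m : ℝ × ℝ} (hm₁ : m.1 ≠ 0) (hm₂ : m.2 ≠ 0) :
    Differentiable ℂ fun z : ℂ × ℂ => cellWhittaker m z.1 z.2 := by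
  have hpi : (Real.pi : ℂ) ≠ 0 := by exact_mod_cast Real.pi_ne_zero
  have hpow : ∀ f : ℂ × ℂ → ℂ, Differentiable ℂ f → Differentiable ℂ fun z => (Real.pi : ℂ) ^ f z :=
    fun f hf => hf.const_cpow (Or.inl hpi)
  have hG : ∀ f : ℂ × ℂ → ℂ, Differentiable ℂ f →
      Differentiable ℂ fun z => (Complex.Gamma (f z))⁻¹ :=
    fun f hf => Differentiable.comp (f := f) Complex.differentiable_one_div_Gamma hf
  exact ((hpow _ (by fun_prop)).mul ((hG _ (by fun_prop)).mul (hG _ (by fun_prop)))).mul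
    (((hpow _ (by fun_prop)).mul (hG _ (by fun_prop))).mul (differentiable_besselIntegral hm₁ hm₂))

/-! ### The Jacquet–Whittaker functions -/

/-- The elementary factor of the Jacquet–Whittaker function at `y⁻¹`. -/
def whittakerFactor (y : ℝ × ℝ) (μ : ℂ × ℂ) : ℂ :=
  (((y.1 ^ 2 * y.2)⁻¹ : ℝ) : ℂ) ^ (1 + μ.1)
    * (((y.1 * y.2)⁻¹ ^ 2 : ℝ) : ℂ) ^ (-((1 + μ.1 + 2 * μ.2) / 2))
    * (((y.1⁻¹ * (y.1 * y.2)⁻¹) ^ 2 : ℝ) : ℂ) ^ (-((1 + μ.1 - μ.2) / 2))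

theorem jacquetIntegral_eq_whittakerFactor_mul (μ : ℂ × ℂ) {y : ℝ × ℝ} (hy₁ : 0 < y.1)
    (hy₂ : 0 < y.2) (m : ℝ × ℝ) :
    jacquetIntegral (diagY y)⁻¹ μ m = whittakerFactor y μ * ∫ u,
      cellFn ((1 + μ.1 + 2 * μ.2) / 2) ((1 + μ.1 - μ.2) / 2) (unipScale y u) * psi m u :=
  jacquetIntegral_diagY_inv μ hy₁ hy₂ m

theorem re_cell_exponents (μ : ℂ × ℂ) :
    ((1 + μ.1 + 2 * μ.2) / 2).re = (1 + μ.1.re + 2 * μ.2.re) / 2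
      ∧ ((1 + μ.1 - μ.2) / 2).re = (1 + μ.1.re - μ.2.re) / 2 := by
  constructor
  · rw [show (1 + μ.1 + 2 * μ.2) / 2 = (((1 / 2 : ℝ) : ℂ)) * (1 + μ.1 + ((2 : ℝ) : ℂ) * μ.2) by
      push_cast; ring, Complex.re_ofReal_mul, Complex.add_re, Complex.add_re, Complex.re_ofReal_mul,
      Complex.one_re]
    ring
  · rw [show (1 + μ.1 - μ.2) / 2 = (((1 / 2 : ℝ) : ℂ)) * (1 + μ.1 - μ.2) by
      push_cast; ring, Complex.re_ofReal_mul, Complex.sub_re, Complex.add_re, Complex.one_re]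
    ring

/-- With μ₃ = -μ₁ - μ₂ one has a - 1/2 = (μ₂ - μ₃)/2 and b - 1/2 = (μ₁ - μ₂)/2, so the dominant cone
is the region where both real parts exceed 1/2. -/
theorem dominant_exponents {μ : ℂ × ℂ} (hμ : μ ∈ dominant) :
    1 / 2 < ((1 + μ.1 + 2 * μ.2) / 2).re ∧ 1 / 2 < ((1 + μ.1 - μ.2) / 2).re := by
  obtain ⟨e1, e2⟩ := re_cell_exponents μ
  obtain ⟨h1, h2⟩ := hμ
  simp only [Complex.sub_re, Complex.neg_re] at h2
  rw [e1, e2]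
  constructor <;> linarith

/-- The analytic continuation of Jacquet's integral at `y⁻¹`. -/
def whittakerDiag (y m : ℝ × ℝ) (μ : ℂ × ℂ) : ℂ :=
  whittakerFactor y μ * ((((y.1 ^ 2 * y.2 ^ 2)⁻¹ : ℝ) : ℂ)
    * cellWhittaker (m.1 / y.1, m.2 / y.2) ((1 + μ.1 + 2 * μ.2) / 2) ((1 + μ.1 - μ.2) / 2))

theorem integral_cellFn_unipScale_mul_psi {y : ℝ × ℝ} (hy₁ : 0 < y.1) (hy₂ : 0 < y.2) {m : ℝ × ℝ}
    (hm₁ : m.1 ≠ 0) (hm₂ : m.2 ≠ 0) {a b : ℂ} (ha : 1 / 2 < a.re) (hb : 1 / 2 < b.re) :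
    ∫ u, cellFn a b (unipScale y u) * psi m u
      = (((y.1 ^ 2 * y.2 ^ 2)⁻¹ : ℝ) : ℂ) * cellWhittaker (m.1 / y.1, m.2 / y.2) a b := by
  have h := integral_unipScale hy₁ hy₂ fun v => cellFn a b v * psi (m.1 / y.1, m.2 / y.2) v
  rw [integral_cellFn_mul_psi (div_ne_zero hm₁ hy₁.ne') (div_ne_zero hm₂ hy₂.ne') ha hb] at h
  simp only [psi_unipScale y m hy₁.ne' hy₂.ne'] at h
  have h0 : ((y.1 ^ 2 * y.2 ^ 2 : ℝ) : ℂ) ≠ 0 := by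
    exact_mod_cast (by positivity : (0 : ℝ) < y.1 ^ 2 * y.2 ^ 2).ne'
  rw [h, Complex.ofReal_inv, inv_mul_cancel_left₀ h0]

theorem isWhittakerContinuation_whittakerDiag {y : ℝ × ℝ} (hy₁ : 0 < y.1) (hy₂ : 0 < y.2)
    {m : ℝ × ℝ} (hm₁ : m.1 ≠ 0) (hm₂ : m.2 ≠ 0) :
    IsWhittakerContinuation (diagY y)⁻¹ m (whittakerDiag y m) := by
  constructor
  · have hpow : ∀ (r : ℝ) (f : ℂ × ℂ → ℂ), 0 < r → Differentiable ℂ f →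
        Differentiable ℂ fun z => (r : ℂ) ^ f z :=
      fun r f hr hf => hf.const_cpow (Or.inl (by exact_mod_cast hr.ne'))
    have h1 : Differentiable ℂ (whittakerFactor y) :=
      ((hpow _ _ (by positivity) (by fun_prop)).mul (hpow _ _ (by positivity) (by fun_prop))).mul
        (hpow _ _ (by positivity) (by fun_prop))
    have h2 := Differentiable.comp
      (f := fun μ : ℂ × ℂ => ((1 + μ.1 + 2 * μ.2) / 2, (1 + μ.1 - μ.2) / 2))
      (differentiable_cellWhittaker (m := (m.1 / y.1, m.2 / y.2)) (div_ne_zero hm₁ hy₁.ne')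
        (div_ne_zero hm₂ hy₂.ne')) (by fun_prop)
    exact h1.mul (h2.const_mul _)
  · intro μ hμ
    obtain ⟨ha, hb⟩ := dominant_exponents hμ
    rw [jacquetIntegral_eq_whittakerFactor_mul μ hy₁ hy₂,
      integral_cellFn_unipScale_mul_psi hy₁ hy₂ hm₁ hm₂ ha hb, whittakerDiag]

theorem diagY_one : diagY (1, 1) = 1 := by
  ext i j
  fin_cases i <;> fin_cases j <;> simp [diagY]

/-- The analytic continuation of Jacquet's integral at the identity. -/
theorem isWhittakerContinuation_one {m : ℝ × ℝ} (hm₁ : m.1 ≠ 0) (hm₂ : m.2 ≠ 0) :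
    IsWhittakerContinuation 1 m fun μ =>
      cellWhittaker m ((1 + μ.1 + 2 * μ.2) / 2) ((1 + μ.1 - μ.2) / 2) := by
  have h := isWhittakerContinuation_whittakerDiag (y := (1, 1)) one_pos one_pos hm₁ hm₂
  rw [diagY_one, inv_one] at h
  convert h using 2 with μ
  simp [whittakerDiag, whittakerFactor]

/-! ### Unfolding and passage to the limit -/

theorem measurePreserving_unipMul (u : ℝ × ℝ × ℝ) : MeasurePreserving (unipMul u) := by
  have h := (measurePreserving_add_right (volume : Measure ℝ) u.1).skew_product
    (μc := (volume : Measure (ℝ × ℝ))) (μd := volume)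
    (g := fun x₁ p => p + (u.2.1, u.2.2 + u.2.1 * x₁)) (by fun_prop)
    (Eventually.of_forall fun x₁ => (measurePreserving_add_right volume _).map_eq)
  exact h

theorem continuous_uncurry_unipMul :
    Continuous fun w : (ℝ × ℝ × ℝ) × (ℝ × ℝ × ℝ) => unipMul w.2 w.1 := by
  unfold unipMul
  fun_prop

/-- Left translation by u acts on (x₁, x₂) by addition, and x₃ is unrestricted, so a slab goes to a
translated slab in spite of the shear in the centre. -/
theorem measurePreserving_unipMul_slab (u : ℝ × ℝ × ℝ) (R : ℝ × ℝ) :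
    MeasurePreserving (unipMul u) (volume.restrict (slab R))
      (volume.restrict (shiftedSlab u R)) := by
  have h := (measurePreserving_unipMul u).restrict_preimage (measurableSet_shiftedSlab u R)
  have e : unipMul u ⁻¹' shiftedSlab u R = slab R := by
    ext x
    simp [unipMul, shiftedSlab, slab]
  rwa [e] at h

theorem psi_unipMul (m : ℝ × ℝ) (u x : ℝ × ℝ × ℝ) :
    psi m x = psi (-m) u * psi m (unipMul u x) := by
  simp only [psi, unipMul, ← Complex.exp_add]
  congr 1
  simp only [Prod.fst_neg, Prod.snd_neg]
  push_cast
  ring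

/-- The integrand of the unfolded Fourier integral of the spherical function. -/
def convolutionKernel (y m : ℝ × ℝ) (a b : ℂ) (x u : ℝ × ℝ × ℝ) : ℂ :=
  cellFn a b (unipMul u x) * cellFn (1 - a) (1 - b) (unipScale y u) * psi m x

theorem integrable_cellFn_unipScale {y : ℝ × ℝ} (hy₁ : 0 < y.1) (hy₂ : 0 < y.2) {a b : ℂ}
    (ha : 1 / 2 < a.re) (hb : 1 / 2 < b.re) : Integrable fun u => cellFn a b (unipScale y u) := by
  have h0 : Integrable (cellFn a b) := by
    refine (integrable_norm_iff (continuous_cellFn a b).aestronglyMeasurable).mp ?_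
    simp only [norm_cellFn]
    exact integrable_q_rpow ha hb
  refine (integrable_map_measure (continuous_cellFn a b).aestronglyMeasurable
    (continuous_unipScale y).aemeasurable).mp ?_
  rw [map_unipScale hy₁ hy₂]
  exact h0.smul_measure ENNReal.ofReal_ne_top

/-- Integrating over x first, left invariance and the slab estimate give a bound independent of u.
The remaining u-integral converges because 1 - a and 1 - b have real part above 1/2. -/
theorem integrable_convolutionKernel {y : ℝ × ℝ} (hy₁ : 0 < y.1) (hy₂ : 0 < y.2) (m : ℝ × ℝ)
    {a b : ℂ} (ha : 0 ≤ a.re) (ha' : a.re < 1 / 2) (hb : 0 ≤ b.re) (hb' : b.re < 1 / 2)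
    (hab : 1 / 2 < a.re + b.re) (R : ℝ × ℝ) :
    Integrable (Function.uncurry (convolutionKernel y m a b))
      ((volume.restrict (slab R)).prod volume) := by
  have hc : Continuous (Function.uncurry (convolutionKernel y m a b)) :=
    (((continuous_cellFn a b).comp continuous_uncurry_unipMul).mul
      ((continuous_cellFn (1 - a) (1 - b)).comp ((continuous_unipScale y).comp continuous_snd))).mul
      ((continuous_psi m).comp continuous_fst)
  have hg := integrable_cellFn_unipScale hy₁ hy₂ (a := 1 - a) (b := 1 - b)
    (by rw [Complex.sub_re, Complex.one_re]; linarith)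
    (by rw [Complex.sub_re, Complex.one_re]; linarith)
  refine ⟨hc.aestronglyMeasurable, ?_⟩
  rw [HasFiniteIntegral, lintegral_prod_symm _ hc.measurable.enorm.aemeasurable]
  have hin : ∀ u : ℝ × ℝ × ℝ, ∫⁻ x in slab R, ‖Function.uncurry (convolutionKernel y m a b) (x, u)‖ₑ
      ≤ ENNReal.ofReal (2 * japaneseIntegral (a.re + b.re))
        * (ENNReal.ofReal (R.1 + R.1) * ENNReal.ofReal (R.2 + R.2))
        * ‖cellFn (1 - a) (1 - b) (unipScale y u)‖ₑ := by
    intro u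
    have e : ∀ x : ℝ × ℝ × ℝ, ‖Function.uncurry (convolutionKernel y m a b) (x, u)‖ₑ
        = ‖cellFn a b (unipMul u x)‖ₑ * ‖cellFn (1 - a) (1 - b) (unipScale y u)‖ₑ := by
      intro x
      rw [Function.uncurry_apply_pair, convolutionKernel, enorm_mul, enorm_mul,
        ← ofReal_norm (psi m x), norm_psi, ENNReal.ofReal_one, mul_one]
    have hm : Measurable fun x => ‖cellFn a b x‖ₑ := (continuous_cellFn a b).measurable.enorm
    simp only [e]
    have hm' := hm.comp (measurePreserving_unipMul u).measurable
    simp only [Function.comp_def] at hm'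
    rw [lintegral_mul_const _ hm', (measurePreserving_unipMul_slab u R).lintegral_comp hm]
    gcongr
    have h := lintegral_slab_q_rpow_le ha hb hab (Set.Icc (-R.1 + u.1) (R.1 + u.1))
      (Set.Icc (-R.2 + u.2.1) (R.2 + u.2.1))
    rw [Real.volume_Icc, Real.volume_Icc,
      show R.1 + u.1 - (-R.1 + u.1) = R.1 + R.1 by ring,
      show R.2 + u.2.1 - (-R.2 + u.2.1) = R.2 + R.2 by ring] at h
    refine le_trans (le_of_eq ?_) h
    refine lintegral_congr fun x => ?_
    rw [← ofReal_norm, norm_cellFn]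
  refine (lintegral_mono hin).trans_lt ?_
  have hm' : Measurable fun u => ‖cellFn (1 - a) (1 - b) (unipScale y u)‖ₑ :=
    ((continuous_cellFn _ _).comp (continuous_unipScale y)).measurable.enorm
  rw [lintegral_const_mul _ hm']
  exact ENNReal.mul_lt_top (ENNReal.mul_lt_top ENNReal.ofReal_lt_top
    (ENNReal.mul_lt_top ENNReal.ofReal_lt_top ENNReal.ofReal_lt_top)) hg.2

theorem setIntegral_convolutionKernel {a b : ℂ} (ha : 0 < a.re) (hb : 0 < b.re)
    (hab : 1 / 2 < a.re + b.re) (y m R : ℝ × ℝ) (u : ℝ × ℝ × ℝ) :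
    ∫ x in slab R, convolutionKernel y m a b x u
      = cellFn (1 - a) (1 - b) (unipScale y u) * psi (-m) u
        * ((Real.pi : ℂ) ^ (a + b) * ((Complex.Gamma a)⁻¹ * (Complex.Gamma b)⁻¹)
          * mellinFourier (shiftedSlab u R) m a b) := by
  have hS : IntegrableOn (fun x : ℝ × ℝ × ℝ => q₁ x ^ (-a.re) * q₂ x ^ (-b.re))
      (shiftedSlab u R) :=
    integrableOn_slab_q_rpow ha.le hb.le hab (by simp) (by simp)
  have e : ∀ x, convolutionKernel y m a b x u
      = cellFn (1 - a) (1 - b) (unipScale y u) * psi (-m) u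
        * (cellFn a b (unipMul u x) * psi m (unipMul u x)) := by
    intro x
    rw [convolutionKernel, psi_unipMul m u x]
    ring
  have h := integral_map (μ := volume.restrict (slab R)) (φ := unipMul u)
    (measurePreserving_unipMul u).measurable.aemeasurable
    ((continuous_cellFn a b).mul (continuous_psi m)).aestronglyMeasurable
  simp only [Pi.mul_apply, (measurePreserving_unipMul_slab u R).map_eq] at h
  simp only [e]
  rw [integral_const_mul, ← setIntegral_cellFn_eq_mellinFourier ha hb hS m, h]

theorem tendsto_integral_convolutionKernel {y : ℝ × ℝ} (hy₁ : 0 < y.1) (hy₂ : 0 < y.2) {m : ℝ × ℝ}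
    (hm₁ : m.1 ≠ 0) (hm₂ : m.2 ≠ 0) {a b : ℂ} (ha : 0 < a.re) (ha' : a.re < 1 / 2) (hb : 0 < b.re)
    (hb' : b.re < 1 / 2) (hab : 1 / 2 < a.re + b.re) :
    Tendsto (fun R => ∫ x in slab R, ∫ u, convolutionKernel y m a b x u) (atTop ×ˢ atTop)
      (𝓝 ((((y.1 ^ 2 * y.2 ^ 2)⁻¹ : ℝ) : ℂ) * cellWhittaker (m.1 / y.1, m.2 / y.2) (1 - a) (1 - b)
        * cellWhittaker m a b)) := by
  have hab' : 1 / 2 < (a + b).re := by rwa [Complex.add_re]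
  have h1 : 1 / 2 < (1 - a).re := by rw [Complex.sub_re, Complex.one_re]; linarith
  have h2 : 1 / 2 < (1 - b).re := by rw [Complex.sub_re, Complex.one_re]; linarith
  have hg := integrable_cellFn_unipScale hy₁ hy₂ h1 h2
  -- The unfolding produces the inverse character in u; evenness in m restores the original one.
  have hneg : cellWhittaker (m.1 / y.1, m.2 / y.2) (1 - a) (1 - b)
      = cellWhittaker ((-m).1 / y.1, (-m).2 / y.2) (1 - a) (1 - b) := by
    rw [← cellWhittaker_neg]
    simp [neg_div]
  rw [hneg, ← integral_cellFn_unipScale_mul_psi hy₁ hy₂ (m := -m) (neg_ne_zero.mpr hm₁)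
    (neg_ne_zero.mpr hm₂) h1 h2, ← mul_mellinFourier_univ_eq_cellWhittaker hm₁ hm₂ ha hb hab',
    ← integral_mul_const]
  have e : ∀ R : ℝ × ℝ, ∫ x in slab R, ∫ u, convolutionKernel y m a b x u
      = ∫ u, cellFn (1 - a) (1 - b) (unipScale y u) * psi (-m) u
        * ((Real.pi : ℂ) ^ (a + b) * ((Complex.Gamma a)⁻¹ * (Complex.Gamma b)⁻¹)
          * mellinFourier (shiftedSlab u R) m a b) := by
    intro R
    rw [integral_integral_swap
      (integrable_convolutionKernel hy₁ hy₂ m ha.le ha' hb.le hb' hab R)]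
    simp only [setIntegral_convolutionKernel ha hb hab]
  obtain ⟨C, hC⟩ := exists_norm_mellinFourier_le ha hb hab' hm₁ hm₂
  simp only [e]
  -- Dominated convergence in u: for each u the inner integral tends to a limit that does not depend
  -- on u, under the uniform bound C.
  refine tendsto_integral_filter_of_dominated_convergence
    (fun u => ‖cellFn (1 - a) (1 - b) (unipScale y u)‖
      * (‖(Real.pi : ℂ) ^ (a + b) * ((Complex.Gamma a)⁻¹ * (Complex.Gamma b)⁻¹)‖ * C)) ?_ ?_
    (hg.norm.mul_const _) ?_
  · refine Eventually.of_forall fun R => ?_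
    have h := (integrable_convolutionKernel hy₁ hy₂ m ha.le ha' hb.le hb' hab
      R).integral_prod_right.aestronglyMeasurable
    simpa only [Function.uncurry_apply_pair, setIntegral_convolutionKernel ha hb hab] using h
  · refine Eventually.of_forall fun R => Eventually.of_forall fun u => ?_
    rw [norm_mul, norm_mul, norm_psi, mul_one, norm_mul _ (mellinFourier _ _ _ _)]
    gcongr
    exact hC u R
  · exact Eventually.of_forall fun u =>
      ((tendsto_mellinFourier ha hb hab' hm₁ hm₂ u).const_mul _).const_mul _

/-- The powers of y from the convolution formula, including the Jacobian y₁² y₂² of conjugation, are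
exactly the elementary factor of the Whittaker function at -μ. -/
theorem whittakerFactor_neg (μ : ℂ × ℂ) {y : ℝ × ℝ} (hy₁ : 0 < y.1) (hy₂ : 0 < y.2) :
    ((y.1 ^ 2 * y.2 : ℝ) : ℂ) ^ (1 + μ.1) * ((y.1 ^ 2 * y.2 ^ 2 : ℝ) : ℂ)
      * (((y.1 * y.2) ^ 2 : ℝ) : ℂ) ^ (-((1 + μ.1 + 2 * μ.2) / 2))
      * (((y.1 * (y.1 * y.2)) ^ 2 : ℝ) : ℂ) ^ (-((1 + μ.1 - μ.2) / 2))
      = whittakerFactor y (-μ) := by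
  have h1 := hy₁.ne'
  have h2 := hy₂.ne'
  have e : ((y.1 ^ 2 * y.2 ^ 2 : ℝ) : ℂ) = ((y.1 ^ 2 * y.2 ^ 2 : ℝ) : ℂ) ^ (1 : ℂ) := by simp
  rw [whittakerFactor, e, ofReal_cpow_eq_exp (by positivity), ofReal_cpow_eq_exp (by positivity),
    ofReal_cpow_eq_exp (by positivity), ofReal_cpow_eq_exp (by positivity),
    ofReal_cpow_eq_exp (by positivity), ofReal_cpow_eq_exp (by positivity),
    ofReal_cpow_eq_exp (by positivity)]
  simp only [← Complex.exp_add]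
  have l1 : Real.log (y.1 ^ 2 * y.2) = 2 * Real.log y.1 + Real.log y.2 := by
    rw [Real.log_mul (by positivity) h2, Real.log_pow]; norm_num
  have l2 : Real.log (y.1 * y.2) = Real.log y.1 + Real.log y.2 := Real.log_mul h1 h2
  have l3 : Real.log (y.1 * (y.1 * y.2)) = 2 * Real.log y.1 + Real.log y.2 := by
    rw [Real.log_mul h1 (by positivity), l2]; ring
  have l4 : Real.log (y.1 ^ 2 * y.2 ^ 2) = 2 * (Real.log y.1 + Real.log y.2) := by
    rw [← mul_pow, Real.log_pow, l2]; norm_num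
  have l5 : Real.log (y.1⁻¹ * (y.1 * y.2)⁻¹) = -(2 * Real.log y.1 + Real.log y.2) := by
    rw [← mul_inv, Real.log_inv, l3]
  rw [l1, Real.log_pow, l2, l4, Real.log_pow, l3, Real.log_inv, l1, Real.log_pow, Real.log_inv, l2,
    Real.log_pow, l5]
  congr 1
  simp only [Prod.fst_neg, Prod.snd_neg]
  push_cast
  ring

theorem sphericalIntegrand_eq (μ : ℂ × ℂ) {y : ℝ × ℝ} (hy₁ : 0 < y.1) (hy₂ : 0 < y.2) (m : ℝ × ℝ)
    (x : ℝ × ℝ × ℝ) : sphericalIntegrand y μ m x = kappa * whittakerFactor y (-μ)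
      * ∫ u, convolutionKernel y m ((1 + μ.1 + 2 * μ.2) / 2) ((1 + μ.1 - μ.2) / 2) x u := by
  simp only [convolutionKernel]
  rw [sphericalIntegrand, spherical_eq_convolution μ x hy₁ hy₂, integral_mul_const,
    whittakerFactor_neg μ hy₁ hy₂, kappa_eq]
  ring

theorem one_div_kappa : 1 / kappa = 2 * (Real.pi : ℂ) ^ 2 := by
  rw [kappa_eq, one_div_one_div]

end SphericalFourier

end

theorem mainTheorem7 :
    1 / SphericalFourier.kappa = 2 * (Real.pi : ℂ) ^ 2 ∧
    ∀ (ε : ℝ), 0 < ε → ε < 1 / 5 →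
    ∀ (μ : ℂ × ℂ), μ.1.re = -(1 / 3) + ε → μ.2.re = -(1 / 3) + 2 * ε →
    ∀ (y : ℝ × ℝ), 0 < y.1 → 0 < y.2 →
    ∀ (m : ℝ × ℝ), m.1 ≠ 0 → m.2 ≠ 0 →
      (∃ F, SphericalFourier.IsWhittakerContinuation (SphericalFourier.diagY y)⁻¹ m F) ∧
      (∃ F, SphericalFourier.IsWhittakerContinuation 1 m F) ∧
      (∀ R : ℝ × ℝ, MeasureTheory.IntegrableOn
        (SphericalFourier.sphericalIntegrand y μ m) (SphericalFourier.slab R)) ∧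
      Filter.Tendsto
        (fun R : ℝ × ℝ => ∫ x in SphericalFourier.slab R,
          SphericalFourier.sphericalIntegrand y μ m x)
        (Filter.atTop ×ˢ Filter.atTop)
        (nhds (SphericalFourier.kappa
          * SphericalFourier.jacquetWhittaker (SphericalFourier.diagY y)⁻¹ (-μ) m
          * SphericalFourier.jacquetWhittaker 1 μ m)) := by
  refine ⟨SphericalFourier.one_div_kappa, fun ε hε hε' μ h₁ h₂ y hy₁ hy₂ m hm₁ hm₂ => ?_⟩
  obtain ⟨ea, eb⟩ := SphericalFourier.re_cell_exponents μ
  set a : ℂ := (1 + μ.1 + 2 * μ.2) / 2 with ha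
  set b : ℂ := (1 + μ.1 - μ.2) / 2 with hb
  rw [h₁, h₂] at ea eb
  -- Re a = 5ε/2 and Re b = (1 - ε)/2, so Re a + Re b = 1/2 + 2ε; the condition ε < 1/5 amounts to
  -- Re a < 1/2.
  have ha₀ : 0 < a.re := by linarith
  have ha₁ : a.re < 1 / 2 := by linarith
  have hb₀ : 0 < b.re := by linarith
  have hb₁ : b.re < 1 / 2 := by linarith
  have hab : 1 / 2 < a.re + b.re := by linarith
  have hW := SphericalFourier.isWhittakerContinuation_whittakerDiag hy₁ hy₂ hm₁ hm₂
  have hW₁ := SphericalFourier.isWhittakerContinuation_one hm₁ hm₂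
  refine ⟨⟨_, hW⟩, ⟨_, hW₁⟩, fun R => ?_, ?_⟩
  · simp only [funext (SphericalFourier.sphericalIntegrand_eq μ hy₁ hy₂ m)]
    exact (SphericalFourier.integrable_convolutionKernel hy₁ hy₂ m ha₀.le ha₁ hb₀.le hb₁ hab
      R).integral_prod_left.const_mul _
  · have h := (SphericalFourier.tendsto_integral_convolutionKernel hy₁ hy₂ hm₁ hm₂ ha₀ ha₁ hb₀ hb₁
      hab).const_mul (SphericalFourier.kappa * SphericalFourier.whittakerFactor y (-μ))
    have e₁ : (1 + (-μ).1 + 2 * (-μ).2) / 2 = 1 - a := by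
      rw [ha, Prod.fst_neg, Prod.snd_neg]; ring
    have e₂ : (1 + (-μ).1 - (-μ).2) / 2 = 1 - b := by
      rw [hb, Prod.fst_neg, Prod.snd_neg]; ring
    rw [SphericalFourier.jacquetWhittaker_eq hW, SphericalFourier.jacquetWhittaker_eq hW₁,
      SphericalFourier.whittakerDiag, e₁, e₂]
    simp only [SphericalFourier.sphericalIntegrand_eq μ hy₁ hy₂ m,
      MeasureTheory.integral_const_mul]
    convert h using 2
    ring
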